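/- Let $X$ be a second countable connected smooth ($C^\infty$) manifold without boundary, $d$ the distance of a smooth Riemannian metric on $X$, $\mu$ a Borel probability measure on $X$, and $T:X\to X$ a measurable map preserving $\mu$. For $\eta>0$ and $\varphi:X\to\mathbb{R}$ put $[\varphi]_\eta=\sup_{x\ne y}|\varphi(x)-\varphi(y)|/d(x,y)^\eta$; $\varphi$ is called $\eta$-Hölder if $\|\varphi\|_\infty+[\varphi]_\eta<\infty$, and Hölder if it is $\eta$-Hölder for some $\eta>0$. Assume the following multiple decorrelation property: for every $\eta\in(0,1]$ there exist $C>0$ and $\delta\in(0,1)$ such that for all integers $m,m'\ge 0$, all $\eta$-Hölder functions $\varphi_1,\dots,\varphi_{m+m'}:X\to\mathbb{R}$, all integers $0\le \ell_1\le\dots\le\ell_m\le k_1\le\dots\le k_{m'}$ and all integers $N>0$, $$\mathrm{Cov}_\mu\Big(\prod_{i=1}^m\varphi_i\circ T^{\ell_i},\ \prod_{j=1}^{m'}\varphi_{m+j}\circ T^{k_j+N}\Big)\le C\Big(\prod_{i=1}^{m+m'}\|\varphi_i\|_\infty+\sum_{j=1}^{m+m'}[\varphi_j]_\eta\prod_{i\ne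 j}\|\varphi_i\|_\infty\Big)\delta^N .$$ For each $x\in X$ let $\theta_x:X\to X$ be a Hölder continuous map (that is, $d(\theta_x(y),\theta_x(z))\le C_x\,d(y,z)^{\eta_x}$ for all $y,z\in X$, for some $C_x\ge0$ and $\eta_x>0$), and suppose that there are constants $C$ and $\eta>0$ with $$\sup_{z\in X}d(\theta_x(z),\theta_y(z))\le C\,d(x,y)^\eta\qquad\text{for all }x,y\in X.$$ Let $\varphi:X\to\mathbb{R}$ be a Hölder function with $\int_X\varphi\,d\mu=0$. Put $\overline{\varphi}_{\theta_x}=\int_X\varphi(\theta_x(y))\,d\mu(y)$, $\varphi_{\theta_x}=\varphi\circ\theta_x-\overline{\varphi}_{\theta_x}$, and $$\sigma^2_{\theta_x}=\int_X\varphi_{\theta_x}^2\,d\mu+2\sum_{k=1}^\infty\int_X\varphi_{\theta_x}\cdot\varphi_{\theta_x}\circ T^k\,d\mu .$$ Then this series converges absolutely for every $x\in X$, the function $x\mapsto\sigma^2_{\theta_x}$ is nonnegative and Borel measurable, and for every $t\in\mathbb{R}$ $$\int_X\exp\Big(\frac{it}{\sqrt n}\sum_{k=0}^{n-1}\big(\varphi(\theta_x(T^kx))-\overline{\varphi}_{\theta_x}\big)\Big)\,d\mu(x)\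 \longrightarrow\ \int_X\exp\Big(-\frac12\sigma^2_{\theta_x}t^2\Big)\,d\mu(x)\qquad(n\to\infty).$$ Moreover, the limit is the characteristic function at $t$ of the mixture of Gaussian laws $\int_X\mathcal{N}(0,\sigma^2_{\theta_x})\,d\mu(x)$, where $\mathcal{N}(0,0)$ is the Dirac mass at $0$. -/

import Mathlib

open MeasureTheory ProbabilityTheory Filter Topology Bundle Manifold
open scoped NNReal ContDiff BoundedContinuousFunction

noncomputable section

/-- Multiple decorrelation for `(X, T, μ)`: for every Hölder exponent `η ∈ (0, 1]` there are `C > 0`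
and `δ ∈ (0, 1)` such that, for all `m, m'`, all real Hölder functions `φ_1, …, φ_{m+m'}` and all
times `0 ≤ s_1 ≤ … ≤ s_{m+m'}` and `N > 0`,
`Cov (∏_{i ≤ m} φ_i ∘ T^{s_i}, ∏_{i > m} φ_i ∘ T^{s_i + N})`
is at most `C (∏ ‖φ_i‖_∞ + ∑_j [φ_j]_η ∏_{i ≠ j} ‖φ_i‖_∞) δ^N`.
The norm of `X →ᵇ ℝ` is the sup norm and `nnHolderNorm η` is the seminorm `[·]_η`, the least
Hölder constant. -/
def MultipleDecorrelation {X : Type*} [MetricSpace X] [MeasurableSpace X]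
    (T : X → X) (μ : Measure X) : Prop :=
  ∀ η : ℝ≥0, 0 < η → η ≤ 1 →
    ∃ C : ℝ, 0 < C ∧ ∃ δ : ℝ, 0 < δ ∧ δ < 1 ∧
      ∀ (m m' : ℕ) (φ : Fin (m + m') → (X →ᵇ ℝ)), (∀ i, MemHolder η (φ i)) →
        ∀ s : Fin (m + m') → ℕ, Monotone s → ∀ N : ℕ, 0 < N →
          covariance
              (fun x => ∏ i : Fin m, φ (Fin.castAdd m' i) (T^[s (Fin.castAdd m' i)] x))
              (fun x => ∏ j : Fin m', φ (Fin.natAdd m j) (T^[s (Fin.natAdd m j) + N] x)) μ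
            ≤ C * (∏ i, ‖φ i‖
                + ∑ j, (nnHolderNorm η (φ j) : ℝ) * ∏ i ∈ Finset.univ.erase j, ‖φ i‖) * δ ^ N

/-- The covariance at lag `k + 1` of a centered function `ψ`. -/
def lagCovariance {X : Type*} [MeasurableSpace X] (T : X → X) (μ : Measure X) (ψ : X → ℝ)
    (k : ℕ) : ℝ :=
  ∫ y, ψ y * ψ (T^[k + 1] y) ∂μ

/-- The asymptotic variance `σ²(ψ) = μ(ψ²) + 2 ∑_{k ≥ 1} ⟨ψ, ψ ∘ T^k⟩` of a centered `ψ`. -/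
def asymptoticVariance {X : Type*} [MeasurableSpace X] (T : X → X) (μ : Measure X)
    (ψ : X → ℝ) : ℝ :=
  ∫ y, ψ y ^ 2 ∂μ + 2 * ∑' k : ℕ, lagCovariance T μ ψ k

/-- The centered function `φ_{θ_x} = φ ∘ θ_x - ∫ φ ∘ θ_x dμ`. -/
def centeredComp {X : Type*} [MeasurableSpace X] (μ : Measure X) (φ : X → ℝ) (θ : X → X → X)
    (x : X) : X → ℝ :=
  fun y => φ (θ x y) - ∫ z, φ (θ x z) ∂μ

/-- The mixture of the centered Gaussian laws of variance `v x`, for `x` distributed according to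
`μ`; the Gaussian law of variance `0` is the Dirac mass at `0`. -/
def gaussianMixture {X : Type*} [MeasurableSpace X] (μ : Measure X) (v : X → ℝ) : Measure ℝ :=
  μ.bind fun x => gaussianReal 0 (v x).toNNReal

end

/-!
For fixed `x` the function `ψ = φ ∘ θ x - ∫ φ ∘ θ x` is a centered Hölder function, and its Birkhoff
sums satisfy a central limit theorem with variance `asymptoticVariance T μ ψ`. The point of the
theorem is that the observable may be chosen by the very point `x` whose orbit is observed: since
`(T, μ)` decorrelates, the orbit soon forgets its starting point, and on the diagonal one gets the
average over `x` of the Gaussian characteristic functions.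

*One observable.* The decorrelation bound is linear in the number of functions, with the product of
their sizes (`DecorrelationRate`). Writing `exp (i τ ψ) = cos (τ ψ) + i sin (τ ψ)` and expanding a
product of `n` such factors costs `(1 + |τ| ‖ψ‖) ^ n`, which is `exp (O (√n))` for `τ = t / √n`. A
gap of length `n ^ (3/4)` beats this, so that Birkhoff sums over separated blocks are almost
independent (`DecorrelationRate.norm_charBirkhoff_mul_sub_pow_le`). The second and fourth moments of
the blocks are controlled by exponentially decaying correlations (`CorrelationDecay`), and the
method of blocks gives `DecorrelationRate.tendsto_charBirkhoff`.

*The diagonal.* Write `Ψ x` for the observable chosen by `x`; it depends on `x` in a Hölder way, for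
the sup norm. Near each point the manifold can be covered by polynomially many balls of radius
`1 / n` (`exists_monotone_polynomiallyCovered`). A partition of unity subordinate to such a cover
freezes `Ψ`, at the cost of polynomially many terms of polynomially large Hölder constant. These are
again beaten by a gap `n ^ α`, provided that the sum following the gap has at most
`O (n ^ (1/2 + β))` terms with `β < α` (`MultipleDecorrelation.tendsto_diag_sub`).

A gap longer than `√n` is thus needed before a sum of length about `n`, and this is too long to be
negligible by its sup norm. The bound is therefore used twice, with `q = ⌈n ^ (3/8)⌉` and
`p = ⌈n ^ (3/4)⌉`. The times before `q` are negligible in sup norm. The exponential over `[q, p)`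
decouples after the gap `q`, so its mean tends to `1`; being unimodular, it tends to `1` in `L²` and
can be dropped. The exponential over `[p, n)` decouples after the gap `p`, and the limit theorem for
one observable applies for each `x` (`MultipleDecorrelation.tendsto_integral_expBirkhoff_diag`).
-/

noncomputable section

/-! ### Polynomial covers of a Riemannian manifold -/

open Metric Set in
/-- Near each point the Riemannian distance is dominated by the distance in a chart: the preimage of
a segment in the chart has length at most a constant times the length of the segment. Both endpoints
vary, unlike in the estimates for the distance to the centre of the chart. -/
lemma exists_nhds_edist_le_edist_extChartAt {E : Type*} [NormedAddCommGroup E] [NormedSpace ℝ E]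
    {H : Type*} [TopologicalSpace H] (I : ModelWithCorners ℝ E H) {M : Type*} [PseudoEMetricSpace M]
    [ChartedSpace H M] [RiemannianBundle (fun (x : M) ↦ TangentSpace I x)]
    [IsManifold I 1 M] [IsContinuousRiemannianBundle E (fun (x : M) ↦ TangentSpace I x)]
    [IsRiemannianManifold I M] (x : M) :
    ∃ C : ℝ≥0, ∃ V ∈ 𝓝 x, ∀ y ∈ V, ∀ z ∈ V,
      edist y z ≤ C * edist (extChartAt I x y) (extChartAt I x z) := by
  obtain ⟨C, C_pos, hC⟩ :=
    eventually_norm_symmL_trivializationAt_lt E (fun (x : M) ↦ TangentSpace I x) x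
  have hC' : ∀ᶠ y in 𝓝[range I] (extChartAt I x x),
      ‖(trivializationAt E (TangentSpace I) x).symmL ℝ ((extChartAt I x).symm y)‖ < C := by
    have h : 𝓝 x = 𝓝 ((extChartAt I x).symm (extChartAt I x x)) := by simp
    rw [h] at hC
    exact nhdsWithin_le_nhds ((continuousAt_extChartAt_symm x).eventually hC)
  obtain ⟨r, r_pos, hr⟩ := Metric.mem_nhdsWithin_iff.1
    (inter_mem (extChartAt_target_mem_nhdsWithin (I := I) x) hC')
  have A : (extChartAt I x) ⁻¹' (ball (extChartAt I x x) r ∩ range I) ∈ 𝓝 x := by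
    apply extChartAt_preimage_mem_nhds_of_mem_nhdsWithin (by simp)
    rw [inter_comm]
    exact inter_mem_nhdsWithin _ (ball_mem_nhds _ r_pos)
  refine ⟨C.toNNReal, _, inter_mem A (chart_source_mem_nhds H x), ?_⟩
  rintro y ⟨hy, hys⟩ z ⟨hz, hzs⟩
  set η := ContinuousAffineMap.lineMap (R := ℝ) (extChartAt I x y) (extChartAt I x z) with hηdef
  set γ := (extChartAt I x).symm ∘ η with hγ
  have hη : ∀ t ∈ Icc (0:ℝ) 1, η t ∈ ball (extChartAt I x x) r ∩ range I := by
    intro t ht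
    refine ((convex_ball _ _).inter I.convex_range).segment_subset hy hz ?_
    rw [segment_eq_image_lineMap]
    exact ⟨t, ht, rfl⟩
  have hη1 : Icc 0 1 ⊆ η ⁻¹' (extChartAt I x).target := fun t ht => (hr (hη t ht)).1
  have η_smooth : ContMDiffOn 𝓘(ℝ, ℝ) 𝓘(ℝ, E) 1 η (Icc 0 1) := by
    apply ContMDiff.contMDiffOn
    rw [contMDiff_iff_contDiff]
    exact ContinuousAffineMap.contDiff _
  have h1 : riemannianEDist I y z ≤ pathELength I γ 0 1 := by
    apply riemannianEDist_le_pathELength _ _ _ zero_le_one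
    · exact (contMDiffOn_extChartAt_symm x).comp η_smooth hη1
    · simp [γ, η, ContinuousAffineMap.coe_lineMap_eq, hys]
    · simp [γ, η, ContinuousAffineMap.coe_lineMap_eq, hzs]
  rw [IsRiemannianManifold.out (I := I) y z]
  apply h1.trans
  rw [← lintegral_fderiv_lineMap_eq_edist, pathELength_eq_lintegral_mfderivWithin_Icc,
    ← lintegral_const_mul' _ _ ENNReal.coe_ne_top]
  apply setLIntegral_mono' measurableSet_Icc (fun t ht ↦ ?_)
  have h2 : mfderivWithin 𝓘(ℝ, ℝ) I γ (Icc 0 1) t =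
      (mfderivWithin 𝓘(ℝ, E) I (extChartAt I x).symm (range I) (η t)).comp
        (mfderivWithin 𝓘(ℝ, ℝ) 𝓘(ℝ, E) η (Icc 0 1) t) := by
    apply mfderivWithin_comp
    · exact mdifferentiableWithinAt_extChartAt_symm (hη1 ht)
    · exact η_smooth.mdifferentiableOn one_ne_zero t ht
    · exact hη1.trans (preimage_mono (extChartAt_target_subset_range x))
    · rw [uniqueMDiffWithinAt_iff_uniqueDiffWithinAt]
      exact uniqueDiffOn_Icc zero_lt_one t ht
  have hsrc : (extChartAt I x).symm (η t) ∈ (chartAt H x).source := by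
    simpa using (extChartAt I x).map_target (hη1 ht)
  have h3 := (hr (hη t ht)).2
  simp only [mem_ofPred_eq] at h3
  have hsymm := TangentBundle.symmL_trivializationAt (I := I) hsrc
  rw [(extChartAt I x).right_inv (hη1 ht)] at hsymm
  have key : mfderivWithin 𝓘(ℝ, ℝ) I γ (Icc 0 1) t 1 =
      (trivializationAt E (TangentSpace I) x).symmL ℝ ((extChartAt I x).symm (η t))
        (fderivWithin ℝ η (Icc 0 1) t 1) := by
    rw [h2, mfderivWithin_eq_fderivWithin]
    exact congrArg (fun A => A (fderivWithin ℝ η (Icc 0 1) t 1)) hsymm.symm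
  rw [key]
  have h4 := ContinuousLinearMap.le_opNorm
    ((trivializationAt E (TangentSpace I) x).symmL ℝ ((extChartAt I x).symm (η t)))
    (fderivWithin ℝ η (Icc 0 1) t 1)
  rw [← ofReal_norm, ← ofReal_norm, ENNReal.ofNNReal_toNNReal, ← ENNReal.ofReal_mul C_pos.le]
  exact ENNReal.ofReal_le_ofReal (h4.trans (by gcongr))

/-- A set is polynomially covered if, for some polynomial in `n`, it is covered for every `n ≥ 1` by
that many closed balls of radius `1 / n`. -/
def PolynomiallyCovered {X : Type*} [PseudoMetricSpace X] (V : Set X) : Prop :=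
  ∃ C D : ℕ, ∀ n : ℕ, 0 < n → ∃ S : Finset X, S.card ≤ C * n ^ D ∧
    ∀ x ∈ V, ∃ y ∈ S, dist x y ≤ 1 / n

namespace PolynomiallyCovered

variable {X : Type*} [PseudoMetricSpace X] {V W : Set X}

lemma empty : PolynomiallyCovered (∅ : Set X) :=
  ⟨0, 0, fun _ _ => ⟨∅, by simp, by simp⟩⟩

lemma mono (h : PolynomiallyCovered V) (hWV : W ⊆ V) : PolynomiallyCovered W := by
  obtain ⟨C, D, h⟩ := h
  refine ⟨C, D, fun n hn => ?_⟩
  obtain ⟨S, hS, hcov⟩ := h n hn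
  exact ⟨S, hS, fun x hx => hcov x (hWV hx)⟩

lemma union (hV : PolynomiallyCovered V) (hW : PolynomiallyCovered W) :
    PolynomiallyCovered (V ∪ W) := by
  classical
  obtain ⟨C, D, hV⟩ := hV
  obtain ⟨C', D', hW⟩ := hW
  refine ⟨C + C', max D D', fun n hn => ?_⟩
  obtain ⟨S, hS, hcov⟩ := hV n hn
  obtain ⟨S', hS', hcov'⟩ := hW n hn
  refine ⟨S ∪ S', ?_, ?_⟩
  · calc (S ∪ S').card ≤ S.card + S'.card := Finset.card_union_le _ _
      _ ≤ C * n ^ D + C' * n ^ D' := add_le_add hS hS'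
      _ ≤ C * n ^ max D D' + C' * n ^ max D D' := by
        gcongr <;> first | exact hn | simp
      _ = _ := by ring
  · rintro x (hx | hx)
    · obtain ⟨y, hy, hxy⟩ := hcov x hx
      exact ⟨y, Finset.mem_union_left _ hy, hxy⟩
    · obtain ⟨y, hy, hxy⟩ := hcov' x hx
      exact ⟨y, Finset.mem_union_right _ hy, hxy⟩

lemma biUnion_lt {V : ℕ → Set X} (hV : ∀ i, PolynomiallyCovered (V i)) (N : ℕ) :
    PolynomiallyCovered (⋃ i < N, V i) := by
  induction N with
  | zero => simpa using empty
  | succ N ih => rw [Set.biUnion_lt_succ]; exact ih.union (hV N)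

/-- If points of `V` with the same colour are close, a choice of one point per colour
covers `V`. -/
lemma exists_finset_of_coloring {α : Type*} (c : X → α) (F : Finset α) (hc : ∀ x ∈ V, c x ∈ F)
    {ε : ℝ} (hε : ∀ x ∈ V, ∀ y ∈ V, c x = c y → dist x y ≤ ε) :
    ∃ S : Finset X, (∀ x ∈ S, x ∈ V) ∧ S.card ≤ F.card ∧ ∀ x ∈ V, ∃ y ∈ S, dist x y ≤ ε := by
  classical
  rcases V.eq_empty_or_nonempty with rfl | ⟨x₀, hx₀⟩
  · exact ⟨∅, by simp, by simp, by simp⟩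
  have h : ∀ a, ∃ y ∈ V, (∃ x ∈ V, c x = a) → c y = a := fun a => by
    by_cases ha : ∃ x ∈ V, c x = a
    · obtain ⟨x, hx, hxa⟩ := ha
      exact ⟨x, hx, fun _ => hxa⟩
    · exact ⟨x₀, hx₀, fun h => absurd h ha⟩
  choose p hpV hp using h
  refine ⟨F.image p, ?_, Finset.card_image_le, fun x hx => ?_⟩
  · intro x hx
    obtain ⟨a, -, rfl⟩ := Finset.mem_image.1 hx
    exact hpV a
  · exact ⟨p (c x), Finset.mem_image_of_mem _ (hc x hx),
      hε x hx _ (hpV _) (hp _ ⟨x, hx, rfl⟩).symm⟩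

/-- The centres of the covering balls may be taken in the set itself. -/
lemma exists_centers_mem (h : PolynomiallyCovered V) :
    ∃ C D : ℕ, ∀ n : ℕ, 0 < n → ∃ S : Finset X, (∀ x ∈ S, x ∈ V) ∧ S.card ≤ C * n ^ D ∧
      ∀ x ∈ V, ∃ y ∈ S, dist x y ≤ 1 / n := by
  obtain ⟨C, D, h⟩ := h
  refine ⟨C * 2 ^ D, D, fun n hn => ?_⟩
  obtain ⟨S, hS, hcov⟩ := h (2 * n) (by omega)
  have h' : ∀ x, ∃ y, x ∈ V → y ∈ S ∧ dist x y ≤ 1 / (2 * n : ℕ) := fun x => by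
    by_cases hx : x ∈ V
    · obtain ⟨y, hy, hxy⟩ := hcov x hx
      exact ⟨y, fun _ => ⟨hy, hxy⟩⟩
    · exact ⟨x, fun h => absurd h hx⟩
  choose c hc using h'
  obtain ⟨S', hS'V, hS', hcov'⟩ := exists_finset_of_coloring (V := V) c S (fun x hx => (hc x hx).1)
    (ε := 1 / n) (fun x hx y hy hxy => by
      have h1 := (hc x hx).2
      have h2 := (hc y hy).2
      rw [← hxy] at h2
      calc dist x y ≤ dist x (c x) + dist y (c x) := dist_triangle_right _ _ _
        _ ≤ 1 / (2 * n : ℕ) + 1 / (2 * n : ℕ) := add_le_add h1 h2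
        _ = 1 / n := by push_cast; field_simp; norm_num)
  refine ⟨S', hS'V, hS'.trans (hS.trans (le_of_eq ?_)), hcov'⟩
  rw [mul_pow]; ring

/-- A set on which the distance is dominated by the distance between the images under a bounded
map to `ℝ ^ d` is polynomially covered: pull back a fine grid of cubes. -/
lemma of_dist_le {d : ℕ} (f : X → EuclideanSpace ℝ (Fin d)) {K R : ℝ}
    (hK : ∀ x ∈ V, ∀ y ∈ V, dist x y ≤ K * dist (f x) (f y)) (hR : ∀ x ∈ V, ‖f x‖ ≤ R) :
    PolynomiallyCovered V := by
  obtain ⟨K', hK'⟩ : ∃ K' : ℕ, K * √d ≤ K' := exists_nat_ge _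
  obtain ⟨R', hR'⟩ : ∃ R' : ℕ, R ≤ R' := exists_nat_ge _
  refine ⟨((2 * R' + 1) * (K' + 1)) ^ d, d, fun n hn => ?_⟩
  set N : ℕ := (K' + 1) * n with hN
  have hN0 : 0 < N := by positivity
  have hF : ∀ x ∈ V, (fun i => ⌊(N : ℝ) * f x i⌋) ∈
      Fintype.piFinset fun _ : Fin d => Finset.Icc (-(R' * N : ℕ) : ℤ) (R' * N : ℕ) := by
    intro x hx
    rw [Fintype.mem_piFinset]
    intro i
    have h1 : |f x i| ≤ R' := by
      have := PiLp.norm_apply_le (f x) i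
      rw [Real.norm_eq_abs] at this
      exact this.trans ((hR x hx).trans hR')
    have h2 := abs_le.1 h1
    have hNr : (0 : ℝ) < N := by exact_mod_cast hN0
    rw [Finset.mem_Icc, Int.le_floor]
    constructor
    · push_cast; nlinarith
    · rw [← Int.lt_add_one_iff, Int.floor_lt]
      push_cast; nlinarith
  have hdist : ∀ x ∈ V, ∀ y ∈ V, (fun i => ⌊(N : ℝ) * f x i⌋) = (fun i => ⌊(N : ℝ) * f y i⌋) →
      dist x y ≤ 1 / n := by
    intro x hx y hy hxy
    have hNr : (0 : ℝ) < N := by exact_mod_cast hN0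
    have hnr : (0 : ℝ) < n := by exact_mod_cast hn
    have h1 : ∀ i, dist (f x i) (f y i) ≤ 1 / N := fun i => by
      have := Int.abs_sub_lt_one_of_floor_eq_floor (congrFun hxy i)
      rw [← mul_sub, abs_mul, abs_of_pos hNr] at this
      rw [Real.dist_eq, le_div_iff₀ hNr]; linarith
    have h2 : dist (f x) (f y) ≤ √d * (1 / N) := by
      rw [EuclideanSpace.dist_eq]
      calc √(∑ i, dist (f x i) (f y i) ^ 2) ≤ √(∑ i : Fin d, (1 / (N : ℝ)) ^ 2) := by
            gcongr with i; exact h1 i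
        _ = √d * (1 / N) := by
            rw [Finset.sum_const, Finset.card_univ, Fintype.card_fin, nsmul_eq_mul,
              Real.sqrt_mul (by positivity), Real.sqrt_sq (by positivity)]
    rcases le_or_gt K 0 with hK0 | hK0
    · have := hK x hx y hy
      have h3 : K * dist (f x) (f y) ≤ 0 := mul_nonpos_of_nonpos_of_nonneg hK0 dist_nonneg
      have h4 : (0 : ℝ) ≤ 1 / n := by positivity
      linarith
    calc dist x y ≤ K * dist (f x) (f y) := hK x hx y hy
      _ ≤ K * (√d * (1 / N)) := by gcongr
      _ = K * √d * (1 / N) := by ring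
      _ ≤ (K' + 1) * (1 / N) := by gcongr; linarith
      _ = 1 / n := by rw [hN]; push_cast; field_simp
  obtain ⟨S, -, hS, hcov⟩ := exists_finset_of_coloring _ _ hF hdist
  refine ⟨S, hS.trans ?_, hcov⟩
  rw [Fintype.card_piFinset_const, Int.card_Icc, ← mul_pow]
  apply Nat.pow_le_pow_left
  have : ((R' * N : ℕ) + 1 - -((R' * N : ℕ) : ℤ)).toNat = 2 * (R' * N) + 1 := by omega
  rw [this]
  have : (2 * R' + 1) * (K' + 1) * n = (2 * R' + 1) * N := by rw [hN]; ring
  rw [this]; nlinarith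

end PolynomiallyCovered

/-- A second countable Riemannian manifold is an increasing union of polynomially covered open
sets. -/
lemma exists_monotone_polynomiallyCovered {d : ℕ} (X : Type*) [MetricSpace X]
    [SecondCountableTopology X]
    [ChartedSpace (EuclideanSpace ℝ (Fin d)) X] [IsManifold (𝓡 d) ∞ X]
    [RiemannianBundle (fun x : X => TangentSpace (𝓡 d) x)]
    [IsContMDiffRiemannianBundle (𝓡 d) ∞ (EuclideanSpace ℝ (Fin d))
      (fun x : X => TangentSpace (𝓡 d) x)]
    [IsRiemannianManifold (𝓡 d) X] :
    ∃ V : ℕ → Set X, (∀ N, IsOpen (V N)) ∧ Monotone V ∧ (⋃ N, V N) = Set.univ ∧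
      ∀ N, PolynomiallyCovered (V N) := by
  have hX : IsManifold (𝓡 d) 1 X := .of_le (n := ∞) (by simp)
  have hb : IsContinuousRiemannianBundle (EuclideanSpace ℝ (Fin d))
      (fun x : X ↦ TangentSpace (𝓡 d) x) := by
    obtain ⟨g, hg, h⟩ := IsContMDiffRiemannianBundle.exists_contMDiff (IB := 𝓡 d) (n := ∞)
      (F := EuclideanSpace ℝ (Fin d)) (E := fun x : X => TangentSpace (𝓡 d) x)
    exact ⟨g, hg.continuous, h⟩
  have hloc : ∀ x : X, ∃ V, IsOpen V ∧ x ∈ V ∧ PolynomiallyCovered V := by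
    intro x
    obtain ⟨C, V, hV, hC⟩ := exists_nhds_edist_le_edist_extChartAt (𝓡 d) x
    have h1 : (extChartAt (𝓡 d) x) ⁻¹' Metric.ball 0 (‖extChartAt (𝓡 d) x x‖ + 1) ∈ 𝓝 x :=
      (continuousAt_extChartAt x).preimage_mem_nhds
        (Metric.isOpen_ball.mem_nhds (by simp))
    obtain ⟨W, hWV, hW, hxW⟩ := mem_nhds_iff.1 (inter_mem hV h1)
    refine ⟨W, hW, hxW, ?_⟩
    refine PolynomiallyCovered.of_dist_le (extChartAt (𝓡 d) x) (K := C)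
      (R := ‖extChartAt (𝓡 d) x x‖ + 1) (fun y hy z hz => ?_) (fun y hy => ?_)
    · have := hC y (hWV hy).1 z (hWV hz).1
      rw [edist_nndist, edist_nndist] at this
      exact_mod_cast this
    · have := (hWV hy).2
      rw [Set.mem_preimage, mem_ball_zero_iff] at this
      exact this.le
  choose V hVo hxV hVp using hloc
  obtain ⟨s, hs, hcov⟩ := TopologicalSpace.countable_cover_nhds
    (f := V) (fun x => (hVo x).mem_nhds (hxV x))
  obtain ⟨e, he⟩ : ∃ e : ℕ → Set X, (∀ i, IsOpen (e i) ∧ PolynomiallyCovered (e i)) ∧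
      (⋃ i, e i) = Set.univ := by
    rcases s.eq_empty_or_nonempty with rfl | hne
    · exact ⟨fun _ => ∅, fun _ => ⟨isOpen_empty, .empty⟩, by simpa using hcov⟩
    · obtain ⟨g, hg⟩ := hs.exists_eq_range hne
      refine ⟨fun i => V (g i), fun i => ⟨hVo _, hVp _⟩, ?_⟩
      rw [hg, Set.biUnion_range] at hcov
      exact hcov
  refine ⟨fun N => ⋃ i < N, e i, fun N => ?_, ?_, ?_, fun N => ?_⟩
  · exact isOpen_biUnion fun i _ => (he.1 i).1
  · intro N N' h
    exact Set.biUnion_subset_biUnion_left fun i hi => lt_of_lt_of_le hi h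
  · rw [Set.eq_univ_iff_forall]
    intro x
    obtain ⟨i, hi⟩ := Set.mem_iUnion.1 (he.2.symm ▸ Set.mem_univ x : x ∈ ⋃ i, e i)
    exact Set.mem_iUnion.2 ⟨i + 1, Set.mem_iUnion₂.2 ⟨i, Nat.lt_succ_self i, hi⟩⟩
  · exact PolynomiallyCovered.biUnion_lt (fun i => (he.1 i).2) N

/-! ### Decorrelation for finite families of functions -/

/-- `(T, μ)` decorrelates `η`-Hölder functions at the rate `C δ ^ N`. The functions and their times
are indexed by arbitrary finite types, and the time sets are only required to be separated by a gap
`N`. The sizes are normalized: `A i` bounds the supremum of `f i` and `H * A i` its Hölder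
constant. -/
structure DecorrelationRate {X : Type*} [MetricSpace X] [MeasurableSpace X]
    (T : X → X) (μ : Measure X) (η : ℝ≥0) (C δ : ℝ) : Prop where
  const_pos : 0 < C
  rate_pos : 0 < δ
  rate_lt_one : δ < 1
  abs_le : ∀ {ι κ : Type} [Fintype ι] [Fintype κ] (f : ι → (X →ᵇ ℝ)) (g : κ → (X →ᵇ ℝ))
    (s : ι → ℕ) (s' : κ → ℕ) (a N : ℕ), 0 < N → (∀ i, s i ≤ a) → (∀ j, a + N ≤ s' j) →
    ∀ (A : ι → ℝ≥0) (B : κ → ℝ≥0) (H : ℝ≥0), (∀ i, ‖f i‖ ≤ A i) → (∀ j, ‖g j‖ ≤ B j) →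
    (∀ i, HolderWith (H * A i) η (f i)) → (∀ j, HolderWith (H * B j) η (g j)) →
    |∫ x, (∏ i, f i (T^[s i] x)) * ∏ j, g j (T^[s' j] x) ∂μ
      - (∫ x, ∏ i, f i (T^[s i] x) ∂μ) * ∫ x, ∏ j, g j (T^[s' j] x) ∂μ|
      ≤ C * (1 + (Fintype.card ι + Fintype.card κ + 1) * H) * ((∏ i, A i) * ∏ j, B j) * δ ^ N

lemma abs_prod_comp_iterate_le {X : Type*} [TopologicalSpace X] {T : X → X} {ι : Type*} [Fintype ι]
    (f : ι → (X →ᵇ ℝ)) (s : ι → ℕ) (x : X) :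
    |∏ i, f i (T^[s i] x)| ≤ ∏ i, ‖f i‖ := by
  rw [Finset.abs_prod]
  exact Finset.prod_le_prod (fun _ _ => abs_nonneg _) fun i _ => (f i).norm_coe_le_norm _

section
variable {X : Type*} [MetricSpace X] [MeasurableSpace X] [BorelSpace X]
  {T : X → X} {μ : Measure X}

lemma measurable_comp_iterate (hT : Measurable T) (f : X →ᵇ ℝ) (k : ℕ) :
    Measurable fun x => f (T^[k] x) :=
  f.continuous.measurable.comp (hT.iterate k)

lemma memLp_prod_comp_iterate [IsFiniteMeasure μ] (hT : Measurable T) {ι : Type*} [Fintype ι]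
    (f : ι → (X →ᵇ ℝ)) (s : ι → ℕ) (p : ENNReal) :
    MemLp (fun x => ∏ i, f i (T^[s i] x)) p μ :=
  MemLp.of_bound (Finset.measurable_prod _ fun i _ =>
      measurable_comp_iterate hT (f i) (s i)).aestronglyMeasurable (∏ i, ‖f i‖)
    (ae_of_all _ fun x => abs_prod_comp_iterate_le f s x)

/-- One-sided form of the bound in `DecorrelationRate`: enumerate the two index types by
increasing time. -/
lemma integral_mul_sub_le_of_covariance_le [IsProbabilityMeasure μ] (hT : Measurable T)
    {η : ℝ≥0} {C δ : ℝ} (hC : 0 < C) (hδ : 0 < δ)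
    (h : ∀ (m m' : ℕ) (φ : Fin (m + m') → (X →ᵇ ℝ)), (∀ i, MemHolder η (φ i)) →
        ∀ s : Fin (m + m') → ℕ, Monotone s → ∀ N : ℕ, 0 < N →
          covariance
              (fun x => ∏ i : Fin m, φ (Fin.castAdd m' i) (T^[s (Fin.castAdd m' i)] x))
              (fun x => ∏ j : Fin m', φ (Fin.natAdd m j) (T^[s (Fin.natAdd m j) + N] x)) μ
            ≤ C * (∏ i, ‖φ i‖
                + ∑ j, (nnHolderNorm η (φ j) : ℝ) * ∏ i ∈ Finset.univ.erase j, ‖φ i‖) * δ ^ N)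
    {ι κ : Type} [Fintype ι] [Fintype κ] (f : ι → (X →ᵇ ℝ)) (g : κ → (X →ᵇ ℝ))
    (s : ι → ℕ) (s' : κ → ℕ) (a N : ℕ) (hN : 0 < N) (hs : ∀ i, s i ≤ a) (hs' : ∀ j, a + N ≤ s' j)
    (A : ι → ℝ≥0) (B : κ → ℝ≥0) (H : ℝ≥0) (hA : ∀ i, ‖f i‖ ≤ A i) (hB : ∀ j, ‖g j‖ ≤ B j)
    (hf : ∀ i, HolderWith (H * A i) η (f i)) (hg : ∀ j, HolderWith (H * B j) η (g j)) :
    ∫ x, (∏ i, f i (T^[s i] x)) * ∏ j, g j (T^[s' j] x) ∂μ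
      - (∫ x, ∏ i, f i (T^[s i] x) ∂μ) * ∫ x, ∏ j, g j (T^[s' j] x) ∂μ
      ≤ C * (1 + (Fintype.card ι + Fintype.card κ) * H) * ((∏ i, A i) * ∏ j, B j) * δ ^ N := by
  set m := Fintype.card ι with hm
  set m' := Fintype.card κ with hm'
  let e₀ : Fin m ≃ ι := (Fintype.equivFin ι).symm
  let e : Fin m ≃ ι := (Tuple.sort (s ∘ e₀)).trans e₀
  have he : Monotone (s ∘ e) := Tuple.monotone_sort (s ∘ e₀)
  let e₀' : Fin m' ≃ κ := (Fintype.equivFin κ).symm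
  let e' : Fin m' ≃ κ := (Tuple.sort (s' ∘ e₀')).trans e₀'
  have he' : Monotone (s' ∘ e') := Tuple.monotone_sort (s' ∘ e₀')
  let φ : Fin (m + m') → (X →ᵇ ℝ) := Fin.append (f ∘ e) (g ∘ e')
  let t : Fin (m + m') → ℕ := Fin.append (s ∘ e) (fun j => s' (e' j) - N)
  let A' : Fin (m + m') → ℝ≥0 := Fin.append (A ∘ e) (B ∘ e')
  have hφ : ∀ i, HolderWith (H * A' i) η (φ i) := by
    intro i
    refine Fin.addCases (fun i => ?_) (fun j => ?_) i
    · simpa [φ, A'] using hf (e i)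
    · simpa [φ, A'] using hg (e' j)
  have hφA : ∀ i, ‖φ i‖ ≤ A' i := by
    intro i
    refine Fin.addCases (fun i => ?_) (fun j => ?_) i
    · simpa [φ, A'] using hA (e i)
    · simpa [φ, A'] using hB (e' j)
  have ht : Monotone t := by
    intro i j hij
    induction i using Fin.addCases with
    | left i =>
      induction j using Fin.addCases with
      | left j =>
        have h1 : i ≤ j := Fin.le_def.2 (by simpa using Fin.le_def.1 hij)
        simpa [t] using he h1
      | right j =>
        have h1 := hs (e i)
        have h2 := hs' (e' j)
        simp only [t, Fin.append_left, Fin.append_right, Function.comp]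
        omega
    | right i =>
      induction j using Fin.addCases with
      | left j =>
        exfalso
        have h1 : m + (i : ℕ) ≤ j := by simpa using Fin.le_def.1 hij
        have := j.2
        omega
      | right j =>
        have h1 : i ≤ j := by simpa using hij
        simpa [t] using Nat.sub_le_sub_right (he' h1) N
  have key := h m m' φ (fun i => (hφ i).memHolder) t ht N hN
  have hF : ∀ x, (∏ i : Fin m, φ (Fin.castAdd m' i) (T^[t (Fin.castAdd m' i)] x))
      = ∏ i, f i (T^[s i] x) := fun x => by
    simp only [φ, t, Fin.append_left, Function.comp]
    exact Equiv.prod_comp e fun i => f i (T^[s i] x)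
  have hG : ∀ x, (∏ j : Fin m', φ (Fin.natAdd m j) (T^[t (Fin.natAdd m j) + N] x))
      = ∏ j, g j (T^[s' j] x) := fun x => by
    simp only [φ, t, Fin.append_right, Function.comp]
    rw [← Equiv.prod_comp e' fun j => g j (T^[s' j] x)]
    refine Finset.prod_congr rfl fun j _ => ?_
    rw [Nat.sub_add_cancel ((Nat.le_add_left N a).trans (hs' _))]
  simp only [hF, hG] at key
  rw [covariance_eq_sub (memLp_prod_comp_iterate hT f s 2) (memLp_prod_comp_iterate hT g s' 2)]
    at key
  refine key.trans ?_
  have hprod : ∏ i, (A' i : ℝ) = (∏ i, (A i : ℝ)) * ∏ j, (B j : ℝ) := by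
    rw [Fin.prod_univ_add]
    simp only [A', Fin.append_left, Fin.append_right, Function.comp]
    rw [Equiv.prod_comp e fun i => (A i : ℝ), Equiv.prod_comp e' fun j => (B j : ℝ)]
  have h1 : ∏ i, ‖φ i‖ ≤ ∏ i, (A' i : ℝ) :=
    Finset.prod_le_prod (fun _ _ => norm_nonneg _) fun i _ => hφA i
  have h2 : ∀ j, (nnHolderNorm η (φ j) : ℝ) * ∏ i ∈ Finset.univ.erase j, ‖φ i‖
      ≤ H * ∏ i, (A' i : ℝ) := fun j => by
    rw [← Finset.mul_prod_erase Finset.univ (fun i => (A' i : ℝ)) (Finset.mem_univ j), ← mul_assoc]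
    refine mul_le_mul ?_ ?_ (Finset.prod_nonneg fun _ _ => norm_nonneg _) (by positivity)
    · exact_mod_cast (hφ j).nnholderNorm_le
    · exact Finset.prod_le_prod (fun _ _ => norm_nonneg _) fun i _ => hφA i
  have h3 := Finset.sum_le_sum fun j (_ : j ∈ Finset.univ) => h2 j
  rw [Finset.sum_const, Finset.card_univ, Fintype.card_fin, nsmul_eq_mul] at h3
  rw [hprod] at h1 h3
  have h4 : C * (∏ i, ‖φ i‖ + ∑ j, (nnHolderNorm η (φ j) : ℝ) * ∏ i ∈ Finset.univ.erase j, ‖φ i‖)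
      ≤ C * (1 + (m + m') * H) * ((∏ i, A i) * ∏ j, B j) := by
    rw [mul_assoc]
    refine mul_le_mul_of_nonneg_left ?_ hC.le
    calc _ ≤ _ := add_le_add h1 h3
      _ = _ := by push_cast; ring
  exact mul_le_mul_of_nonneg_right h4 (by positivity)

/-- `MultipleDecorrelation` bounds covariances from above only, for functions ordered by time. The
two-sided bound follows on changing the sign of one side. -/
lemma MultipleDecorrelation.exists_decorrelationRate [IsProbabilityMeasure μ]
    (h : MultipleDecorrelation T μ) (hT : Measurable T) {η : ℝ≥0} (hη : 0 < η) (hη1 : η ≤ 1) :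
    ∃ C δ : ℝ, DecorrelationRate T μ η C δ := by
  obtain ⟨C, hC, δ, hδ, hδ1, h⟩ := h η hη hη1
  refine ⟨C, δ, hC, hδ, hδ1, ?_⟩
  intro ι κ _ _ f g s s' a N hN hs hs' A B H hA hB hf hg
  have h1 := integral_mul_sub_le_of_covariance_le hT hC hδ h f g s s' a N hN hs hs' A B H hA hB
    hf hg
  -- The lower bound is the upper bound with the constant function `-1` as an extra factor.
  have h2 := integral_mul_sub_le_of_covariance_le hT hC hδ h
    (fun i : Option ι => i.elim (BoundedContinuousFunction.const X (-1 : ℝ)) f) g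
    (fun i : Option ι => i.elim 0 s) s' a N hN (by rintro (_ | i) <;> simp [hs]) hs'
    (fun i : Option ι => i.elim 1 A) B H
    (by
      rintro (_ | i)
      · simpa using BoundedContinuousFunction.norm_const_le (α := X) (-1 : ℝ)
      · exact hA i) hB
    (by
      rintro (_ | i)
      · intro x y; simp
      · exact hf i) hg
  simp only [Fintype.prod_option, Option.elim_none, Option.elim_some,
    BoundedContinuousFunction.const_apply, neg_mul, one_mul, integral_neg, Fintype.card_option]
    at h2
  have hpos : 0 ≤ C * H * ((∏ i, (A i : ℝ)) * ∏ j, (B j : ℝ)) * δ ^ N := by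
    have := hC.le
    positivity
  push_cast at h1 h2 ⊢
  rw [abs_le]
  constructor <;> linarith

/-- The decorrelation bound for products of complex functions `p i true + I * p i false`: expand
both products over all choices of real and imaginary parts. -/
lemma DecorrelationRate.norm_le [IsProbabilityMeasure μ] {η : ℝ≥0} {C δ : ℝ}
    (h : DecorrelationRate T μ η C δ) (hT : Measurable T)
    {ι κ : Type} [Fintype ι] [Fintype κ] [DecidableEq ι] [DecidableEq κ]
    (p : ι → Bool → (X →ᵇ ℝ)) (q : κ → Bool → (X →ᵇ ℝ))
    (s : ι → ℕ) (s' : κ → ℕ) (a N : ℕ) (hN : 0 < N) (hs : ∀ i, s i ≤ a) (hs' : ∀ j, a + N ≤ s' j)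
    (A : ι → Bool → ℝ≥0) (B : κ → Bool → ℝ≥0) (H : ℝ≥0) (hA : ∀ i c, ‖p i c‖ ≤ A i c)
    (hB : ∀ j c, ‖q j c‖ ≤ B j c) (hp : ∀ i c, HolderWith (H * A i c) η (p i c))
    (hq : ∀ j c, HolderWith (H * B j c) η (q j c)) (F G : X → ℂ)
    (hF : ∀ x, F x = ∏ i, ((p i true (T^[s i] x) : ℂ) + Complex.I * p i false (T^[s i] x)))
    (hG : ∀ x, G x = ∏ j, ((q j true (T^[s' j] x) : ℂ) + Complex.I * q j false (T^[s' j] x))) :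
    ‖∫ x, F x * G x ∂μ - (∫ x, F x ∂μ) * ∫ x, G x ∂μ‖
      ≤ C * (1 + (Fintype.card ι + Fintype.card κ + 1) * H)
        * ((∏ i, (A i true + A i false)) * ∏ j, (B j true + B j false)) * δ ^ N := by
  let u : Bool → ℂ := fun c => if c then 1 else Complex.I
  have hu : ∀ c, ‖u c‖ = 1 := by intro c; cases c <;> simp [u]
  let f : (ι → Bool) → X → ℝ := fun ε x => ∏ i, p i (ε i) (T^[s i] x)
  let g : (κ → Bool) → X → ℝ := fun ε x => ∏ j, q j (ε j) (T^[s' j] x)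
  have hF' : ∀ x, F x = ∑ ε, (∏ i, u (ε i)) * f ε x := fun x => by
    have h1 : ∀ i, (p i true (T^[s i] x) : ℂ) + Complex.I * p i false (T^[s i] x)
        = ∑ c : Bool, u c * p i c (T^[s i] x) := fun i => by simp [u]
    simp only [hF, h1]
    rw [Finset.prod_univ_sum, Fintype.piFinset_univ]
    simp only [Finset.prod_mul_distrib, f, Complex.ofReal_prod]
  have hG' : ∀ x, G x = ∑ ε, (∏ j, u (ε j)) * g ε x := fun x => by
    have h1 : ∀ j, (q j true (T^[s' j] x) : ℂ) + Complex.I * q j false (T^[s' j] x)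
        = ∑ c : Bool, u c * q j c (T^[s' j] x) := fun i => by simp [u]
    simp only [hG, h1]
    rw [Finset.prod_univ_sum, Fintype.piFinset_univ]
    simp only [Finset.prod_mul_distrib, g, Complex.ofReal_prod]
  have hfi : ∀ ε, MemLp (f ε) 2 μ := fun ε => memLp_prod_comp_iterate hT _ _ _
  have hgi : ∀ ε, MemLp (g ε) 2 μ := fun ε => memLp_prod_comp_iterate hT _ _ _
  have hIF : ∫ x, F x ∂μ = ∑ ε, (∏ i, u (ε i)) * (∫ x, f ε x ∂μ : ℝ) := by
    simp only [hF']
    rw [integral_finsetSum _ fun ε _ => ((hfi ε).integrable (by norm_num)).ofReal.const_mul _]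
    simp only [integral_const_mul, integral_complex_ofReal]
  have hIG : ∫ x, G x ∂μ = ∑ ε, (∏ j, u (ε j)) * (∫ x, g ε x ∂μ : ℝ) := by
    simp only [hG']
    rw [integral_finsetSum _ fun ε _ => ((hgi ε).integrable (by norm_num)).ofReal.const_mul _]
    simp only [integral_const_mul, integral_complex_ofReal]
  have hIFG : ∫ x, F x * G x ∂μ
      = ∑ ε, ∑ ε', (∏ i, u (ε i)) * (∏ j, u (ε' j)) * (∫ x, f ε x * g ε' x ∂μ : ℝ) := by
    have h1 : ∀ x, F x * G x
        = ∑ ε, ∑ ε', (∏ i, u (ε i)) * (∏ j, u (ε' j)) * (f ε x * g ε' x : ℝ) := fun x => by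
      rw [hF', hG', Finset.sum_mul_sum]
      refine Finset.sum_congr rfl fun ε _ => Finset.sum_congr rfl fun ε' _ => ?_
      push_cast
      ring
    simp only [h1]
    have h2 : ∀ ε ε', Integrable (fun x => (∏ i, u (ε i)) * (∏ j, u (ε' j)) *
        ((f ε x * g ε' x : ℝ) : ℂ)) μ := fun ε ε' =>
      ((hfi ε).integrable_mul (hgi ε')).ofReal.const_mul _
    rw [integral_finsetSum _ fun ε _ => integrable_finsetSum _ fun ε' _ => h2 ε ε']
    refine Finset.sum_congr rfl fun ε _ => ?_
    rw [integral_finsetSum _ fun ε' _ => h2 ε ε']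
    simp only [integral_const_mul, integral_complex_ofReal]
  have hdiff : ∫ x, F x * G x ∂μ - (∫ x, F x ∂μ) * ∫ x, G x ∂μ
      = ∑ ε, ∑ ε', (∏ i, u (ε i)) * (∏ j, u (ε' j)) *
        ((∫ x, f ε x * g ε' x ∂μ - (∫ x, f ε x ∂μ) * ∫ x, g ε' x ∂μ : ℝ) : ℂ) := by
    rw [hIFG, hIF, hIG, Finset.sum_mul_sum, ← Finset.sum_sub_distrib]
    refine Finset.sum_congr rfl fun ε _ => ?_
    rw [← Finset.sum_sub_distrib]
    refine Finset.sum_congr rfl fun ε' _ => ?_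
    push_cast
    ring
  have hAe : (∏ i, ((A i true : ℝ) + A i false)) = ∑ ε : ι → Bool, ∏ i, (A i (ε i) : ℝ) := by
    have h1 : ∀ i, (A i true : ℝ) + A i false = ∑ c : Bool, (A i c : ℝ) := fun i => by simp
    simp only [h1]
    rw [Finset.prod_univ_sum, Fintype.piFinset_univ]
  have hBe : (∏ j, ((B j true : ℝ) + B j false)) = ∑ ε : κ → Bool, ∏ j, (B j (ε j) : ℝ) := by
    have h1 : ∀ i, (B i true : ℝ) + B i false = ∑ c : Bool, (B i c : ℝ) := fun i => by simp
    simp only [h1]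
    rw [Finset.prod_univ_sum, Fintype.piFinset_univ]
  rw [hdiff]
  calc _ ≤ ∑ ε, ∑ ε', ‖(∏ i, u (ε i)) * (∏ j, u (ε' j)) *
        ((∫ x, f ε x * g ε' x ∂μ - (∫ x, f ε x ∂μ) * ∫ x, g ε' x ∂μ : ℝ) : ℂ)‖ :=
        (norm_sum_le _ _).trans (Finset.sum_le_sum fun ε _ => norm_sum_le _ _)
    _ ≤ ∑ ε : ι → Bool, ∑ ε' : κ → Bool, C * (1 + (Fintype.card ι + Fintype.card κ + 1) * H)
        * ((∏ i, (A i (ε i) : ℝ)) * ∏ j, (B j (ε' j) : ℝ)) * δ ^ N := by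
        refine Finset.sum_le_sum fun ε _ => Finset.sum_le_sum fun ε' _ => ?_
        rw [norm_mul, norm_mul, norm_prod, norm_prod]
        simp only [hu, Finset.prod_const_one, one_mul, Complex.norm_real, Real.norm_eq_abs]
        simpa using h.abs_le (fun i => p i (ε i)) (fun j => q j (ε' j)) s s' a N hN hs hs'
          (fun i => A i (ε i)) (fun j => B j (ε' j)) H (fun i => hA _ _) (fun j => hB _ _)
          (fun i => hp _ _) (fun j => hq _ _)
    _ = _ := by
        push_cast
        rw [hAe, hBe, Finset.sum_mul_sum]
        simp only [Finset.mul_sum, Finset.sum_mul]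

end

/-! ### Correlations of a centered function -/

lemma integral_comp_iterate {X : Type*} [MeasurableSpace X] {T : X → X} {μ : Measure X}
    (hT : MeasurePreserving T μ μ) {E : Type*} [NormedAddCommGroup E]
    [NormedSpace ℝ E] {f : X → E} (hf : StronglyMeasurable f) (k : ℕ) :
    ∫ x, f (T^[k] x) ∂μ = ∫ x, f x ∂μ := by
  have h := (hT.iterate k).map_eq
  conv_rhs => rw [← h]
  rw [integral_map (hT.iterate k).measurable.aemeasurable hf.aestronglyMeasurable]

lemma integral_apply_iterate {X : Type*} [TopologicalSpace X] [MeasurableSpace X] [BorelSpace X]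
    {T : X → X} {μ : Measure X} (hT : MeasurePreserving T μ μ) (ψ : X →ᵇ ℝ) (k : ℕ) :
    ∫ x, ψ (T^[k] x) ∂μ = ∫ x, ψ x ∂μ :=
  integral_comp_iterate hT ψ.continuous.measurable.stronglyMeasurable k

lemma integrable_of_abs_le {X : Type*} [MeasurableSpace X] {μ : Measure X} [IsFiniteMeasure μ]
    {f : X → ℝ} (hf : Measurable f) {C : ℝ} (hC : ∀ x, |f x| ≤ C) :
    Integrable f μ :=
  Integrable.of_bound hf.aestronglyMeasurable C (ae_of_all _ hC)

section
variable {X : Type*} [MetricSpace X] [MeasurableSpace X] [BorelSpace X]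
  {T : X → X} {μ : Measure X} [IsProbabilityMeasure μ]

/-- A multiple correlation of a centered function decays in the gap after its first time. -/
lemma DecorrelationRate.abs_integral_prod_le_first {η : ℝ≥0} {C δ : ℝ}
    (h : DecorrelationRate T μ η C δ) (hT : MeasurePreserving T μ μ) {ψ : X →ᵇ ℝ} {L M : ℝ≥0}
    (hψ : HolderWith L η ψ) (hM : ‖ψ‖ ≤ M) (hM1 : 1 ≤ M) (hψ0 : ∫ x, ψ x ∂μ = 0) {n : ℕ}
    (k : Fin (n + 1) → ℕ) (N : ℕ) (hk : ∀ i : Fin n, k 0 + N ≤ k i.succ) :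
    |∫ x, ∏ i, ψ (T^[k i] x) ∂μ| ≤ (1 + C * (1 + (n + 2) * L)) * M ^ (n + 1) * δ ^ N := by
  have hC := h.const_pos
  have hHol : HolderWith (L * M) η ψ :=
    fun x y => (hψ x y).trans (by gcongr; exact le_mul_of_one_le_right' hM1)
  rcases Nat.eq_zero_or_pos N with rfl | hN
  · have h1 : |∫ x, ∏ i, ψ (T^[k i] x) ∂μ| ≤ (M : ℝ) ^ (n + 1) := by
      rw [← Real.norm_eq_abs]
      refine (norm_integral_le_of_norm_le_const (C := (M : ℝ) ^ (n + 1)) ?_).trans (by simp)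
      refine ae_of_all _ fun x => (abs_prod_comp_iterate_le (fun _ => ψ) k x).trans ?_
      rw [Finset.prod_const, Finset.card_univ, Fintype.card_fin]
      gcongr
    refine h1.trans ?_
    rw [pow_zero, mul_one]
    exact le_mul_of_one_le_left (by positivity) (le_add_of_nonneg_right (by positivity))
  · have h2 := h.abs_le (fun _ : Unit => ψ) (fun _ : Fin n => ψ) (fun _ => k 0)
      (fun i => k i.succ) (k 0) N hN (fun _ => le_rfl) hk (fun _ => M) (fun _ => M) L
      (fun _ => hM) (fun _ => hM) (fun _ => hHol) (fun _ => hHol)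
    simp only [Finset.univ_unique, integral_apply_iterate hT, hψ0, zero_mul,
      sub_zero, Finset.prod_const, Finset.card_univ, Fintype.card_fin, Fintype.card_unit,
      Finset.card_singleton, pow_one] at h2
    simp only [Fin.prod_univ_succ]
    refine h2.trans ?_
    have h3 : 0 ≤ (M : ℝ) ^ (n + 1) * δ ^ N := by have := h.rate_pos; positivity
    push_cast
    calc _ = C * (1 + (n + 2) * L) * ((M : ℝ) ^ (n + 1) * δ ^ N) := by ring
      _ ≤ (1 + C * (1 + (n + 2) * L)) * ((M : ℝ) ^ (n + 1) * δ ^ N) := by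
        gcongr; linarith
      _ = _ := by ring

/-- A multiple correlation of a centered function decays in the gap before its last time. -/
lemma DecorrelationRate.abs_integral_prod_le_last {η : ℝ≥0} {C δ : ℝ}
    (h : DecorrelationRate T μ η C δ) (hT : MeasurePreserving T μ μ) {ψ : X →ᵇ ℝ} {L M : ℝ≥0}
    (hψ : HolderWith L η ψ) (hM : ‖ψ‖ ≤ M) (hM1 : 1 ≤ M) (hψ0 : ∫ x, ψ x ∂μ = 0) {n : ℕ}
    (k : Fin (n + 1) → ℕ) (a N : ℕ) (ha : ∀ i : Fin n, k i.castSucc ≤ a)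
    (hk : a + N ≤ k (Fin.last n)) :
    |∫ x, ∏ i, ψ (T^[k i] x) ∂μ| ≤ (1 + C * (1 + (n + 2) * L)) * M ^ (n + 1) * δ ^ N := by
  have hC := h.const_pos
  have hHol : HolderWith (L * M) η ψ :=
    fun x y => (hψ x y).trans (by gcongr; exact le_mul_of_one_le_right' hM1)
  rcases Nat.eq_zero_or_pos N with rfl | hN
  · have h1 : |∫ x, ∏ i, ψ (T^[k i] x) ∂μ| ≤ (M : ℝ) ^ (n + 1) := by
      rw [← Real.norm_eq_abs]
      refine (norm_integral_le_of_norm_le_const (C := (M : ℝ) ^ (n + 1)) ?_).trans (by simp)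
      refine ae_of_all _ fun x => (abs_prod_comp_iterate_le (fun _ => ψ) k x).trans ?_
      rw [Finset.prod_const, Finset.card_univ, Fintype.card_fin]
      gcongr
    refine h1.trans ?_
    rw [pow_zero, mul_one]
    exact le_mul_of_one_le_left (by positivity) (le_add_of_nonneg_right (by positivity))
  · have h2 := h.abs_le (fun _ : Fin n => ψ) (fun _ : Unit => ψ) (fun i => k i.castSucc)
      (fun _ => k (Fin.last n)) a N hN ha (fun _ => hk) (fun _ => M) (fun _ => M) L
      (fun _ => hM) (fun _ => hM) (fun _ => hHol) (fun _ => hHol)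
    simp only [Finset.univ_unique, integral_apply_iterate hT, hψ0, mul_zero,
      sub_zero, Finset.prod_const, Finset.card_univ, Fintype.card_fin, Fintype.card_unit,
      Finset.card_singleton, pow_one] at h2
    simp only [Fin.prod_univ_castSucc]
    refine h2.trans ?_
    have h3 : 0 ≤ (M : ℝ) ^ (n + 1) * δ ^ N := by have := h.rate_pos; positivity
    push_cast
    calc _ = C * (1 + (n + 2) * L) * ((M : ℝ) ^ (n + 1) * δ ^ N) := by ring
      _ ≤ (1 + C * (1 + (n + 2) * L)) * ((M : ℝ) ^ (n + 1) * δ ^ N) := by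
        gcongr; linarith
      _ = _ := by ring

/-- `ψ` has exponentially decaying second and fourth order correlations. For times
`i ≤ j ≤ k ≤ l` only the outer gaps `j - i` and `l - k` enter. -/
structure CorrelationDecay (T : X → X) (μ : Measure X) (ψ : X →ᵇ ℝ) (K ρ : ℝ) : Prop where
  const_nonneg : 0 ≤ K
  rate_pos : 0 < ρ
  rate_lt_one : ρ < 1
  two : ∀ i j, i ≤ j → |∫ x, ψ (T^[i] x) * ψ (T^[j] x) ∂μ| ≤ K * ρ ^ (j - i)
  four : ∀ i j k l, i ≤ j → j ≤ k → k ≤ l →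
    |∫ x, ψ (T^[i] x) * ψ (T^[j] x) * ψ (T^[k] x) * ψ (T^[l] x) ∂μ|
      ≤ K * (ρ ^ (j - i) * ρ ^ (l - k))

/-- For `i ≤ j ≤ k ≤ l` a fourth order correlation of a centered function is small if the first gap
is large, and also if the last gap is large. -/
lemma DecorrelationRate.exists_correlationDecay {η : ℝ≥0} {C δ : ℝ}
    (h : DecorrelationRate T μ η C δ) (hT : MeasurePreserving T μ μ) {ψ : X →ᵇ ℝ} {L : ℝ≥0}
    (hψ : HolderWith L η ψ) (hψ0 : ∫ x, ψ x ∂μ = 0) :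
    ∃ K ρ, CorrelationDecay T μ ψ K ρ := by
  have hC := h.const_pos
  have hδ := h.rate_pos
  set M : ℝ≥0 := ‖ψ‖₊ + 1 with hMdef
  have hM : ‖ψ‖ ≤ M := by simp [hMdef]
  have hM1 : 1 ≤ M := by simp [hMdef]
  have hM1' : (1 : ℝ) ≤ M := by exact_mod_cast hM1
  -- `max a c ≥ (a + c) / 2` turns the better of the two one-gap bounds into one in both gaps
  set ρ := √δ with hρ
  have hρ0 : 0 < ρ := Real.sqrt_pos.2 hδ
  have hρ1 : ρ < 1 := by rw [hρ, Real.sqrt_lt' one_pos]; simpa using h.rate_lt_one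
  have hρδ : δ = ρ ^ 2 := (Real.sq_sqrt hδ.le).symm
  refine ⟨(1 + C * (1 + (3 + 2) * L)) * M ^ 4, ρ, by positivity, hρ0, hρ1, ?_, ?_⟩
  · intro i j hij
    have h1 := h.abs_integral_prod_le_first hT hψ hM hM1 hψ0 ![i, j] (j - i) (by simp; omega)
    have e : ∀ x, ∏ a : Fin (1 + 1), ψ (T^[![i, j] a] x) = ψ (T^[i] x) * ψ (T^[j] x) :=
      fun x => Fin.prod_univ_two _
    simp only [e] at h1
    refine h1.trans ?_
    gcongr
    · norm_num
    · norm_num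
    · rw [hρδ]
      nlinarith
  · intro i j k l hij hjk hkl
    have h1 := h.abs_integral_prod_le_first hT hψ hM hM1 hψ0 ![i, j, k, l] (j - i)
      (by intro a; fin_cases a <;> simp <;> omega)
    have h2 := h.abs_integral_prod_le_last hT hψ hM hM1 hψ0 ![i, j, k, l] k (l - k)
      (by intro a; fin_cases a <;> simp <;> omega)
      (by change k + (l - k) ≤ l; omega)
    have e : ∀ x, ∏ a : Fin (3 + 1), ψ (T^[![i, j, k, l] a] x)
        = ψ (T^[i] x) * ψ (T^[j] x) * ψ (T^[k] x) * ψ (T^[l] x) := fun x => Fin.prod_univ_four _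
    simp only [e] at h1 h2
    rw [← pow_add]
    have h3 : δ ^ max (j - i) (l - k) ≤ ρ ^ (j - i + (l - k)) := by
      rw [hρδ, ← pow_mul]
      exact pow_le_pow_of_le_one hρ0.le hρ1.le (by omega)
    have h4 : 0 ≤ (1 + C * (1 + (3 + 2) * L)) * (M : ℝ) ^ 4 := by positivity
    refine le_trans ?_ (mul_le_mul_of_nonneg_left h3 h4)
    rcases max_cases (j - i) (l - k) with ⟨h5, -⟩ | ⟨h5, -⟩ <;> rw [h5]
    · simpa using h1
    · simpa using h2

end

/-- The weight `ρ ^ |i - j|`; one of the two truncated differences vanishes. -/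
def gapWeight (ρ : ℝ) (i j : ℕ) : ℝ := ρ ^ ((i - j) + (j - i))

lemma gapWeight_comm (ρ : ℝ) (i j : ℕ) : gapWeight ρ i j = gapWeight ρ j i := by
  unfold gapWeight; rw [add_comm]

lemma gapWeight_of_le (ρ : ℝ) {i j : ℕ} (h : i ≤ j) : gapWeight ρ i j = ρ ^ (j - i) := by
  unfold gapWeight; congr 1; omega

lemma gapWeight_nonneg {ρ : ℝ} (h : 0 ≤ ρ) (i j : ℕ) : 0 ≤ gapWeight ρ i j := pow_nonneg h _

/-- The weights are summable in one variable, so their double sum is linear in `n`. -/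
lemma sum_sum_gapWeight_le {ρ : ℝ} (h0 : 0 ≤ ρ) (h1 : ρ < 1) (n : ℕ) :
    ∑ i ∈ Finset.range n, ∑ j ∈ Finset.range n, gapWeight ρ i j ≤ (1 + 2 / (1 - ρ)) * n := by
  induction n with
  | zero => simp
  | succ n ih =>
    have h2 : ∑ i ∈ Finset.range n, gapWeight ρ i n ≤ 1 / (1 - ρ) := by
      calc ∑ i ∈ Finset.range n, gapWeight ρ i n
          = ∑ i ∈ Finset.range n, ρ ^ (n - 1 - i + 1) := by
            refine Finset.sum_congr rfl fun i hi => ?_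
            have := Finset.mem_range.1 hi
            rw [gapWeight_of_le ρ this.le]
            congr 1; omega
        _ = ∑ i ∈ Finset.range n, ρ ^ (i + 1) := Finset.sum_range_reflect (fun i => ρ ^ (i + 1)) n
        _ ≤ ∑ i ∈ Finset.range n, ρ ^ i :=
            Finset.sum_le_sum fun i _ => pow_le_pow_of_le_one h0 h1.le (Nat.le_succ i)
        _ ≤ 1 / (1 - ρ) := by
            rw [one_div, ← tsum_geometric_of_lt_one h0 h1]
            exact (summable_geometric_of_lt_one h0 h1).sum_le_tsum _ fun i _ => pow_nonneg h0 i
    simp only [Finset.sum_range_succ, Finset.sum_add_distrib]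
    have h3 : ∑ j ∈ Finset.range n, gapWeight ρ n j = ∑ i ∈ Finset.range n, gapWeight ρ i n :=
      Finset.sum_congr rfl fun j _ => gapWeight_comm ρ n j
    have h4 : gapWeight ρ n n = 1 := by simp [gapWeight]
    rw [h3, h4]
    push_cast
    have h5 : (2 : ℝ) / (1 - ρ) = 1 / (1 - ρ) + 1 / (1 - ρ) := by ring
    rw [h5] at ih ⊢
    linarith

/-- A symmetric property of four natural numbers may be checked on ordered quadruples. -/
lemma of_sorted_four {Q : ℕ → ℕ → ℕ → ℕ → Prop} (h₁₂ : ∀ i j k l, Q i j k l → Q j i k l)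
    (h₂₃ : ∀ i j k l, Q i j k l → Q i k j l) (h₃₄ : ∀ i j k l, Q i j k l → Q i j l k)
    (h : ∀ i j k l, i ≤ j → j ≤ k → k ≤ l → Q i j k l) (i j k l : ℕ) : Q i j k l := by
  have h1 : ∀ i j k l, j ≤ k → k ≤ l → Q i j k l := fun i j k l hjk hkl => by
    rcases le_total i j with hij | hij
    · exact h i j k l hij hjk hkl
    refine h₁₂ _ _ _ _ ?_
    rcases le_total i k with hik | hik
    · exact h _ _ _ _ hij hik hkl
    refine h₂₃ _ _ _ _ ?_
    rcases le_total i l with hil | hil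
    · exact h _ _ _ _ hjk hik hil
    exact h₃₄ _ _ _ _ (h _ _ _ _ hjk hkl hil)
  have h2 : ∀ i j k l, k ≤ l → Q i j k l := fun i j k l hkl => by
    rcases le_total j k with hjk | hjk
    · exact h1 _ _ _ _ hjk hkl
    refine h₂₃ _ _ _ _ ?_
    rcases le_total j l with hjl | hjl
    · exact h1 _ _ _ _ hjk hjl
    exact h₃₄ _ _ _ _ (h1 _ _ _ _ hkl hjl)
  rcases le_total k l with hkl | hkl
  · exact h2 _ _ _ _ hkl
  · exact h₃₄ _ _ _ _ (h2 _ _ _ _ hkl)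

namespace CorrelationDecay

variable {X : Type*} [MetricSpace X] [MeasurableSpace X] {T : X → X} {μ : Measure X} {ψ : X →ᵇ ℝ}
  {K ρ : ℝ}

lemma abs_two_le (h : CorrelationDecay T μ ψ K ρ) (i j : ℕ) :
    |∫ x, ψ (T^[i] x) * ψ (T^[j] x) ∂μ| ≤ K * gapWeight ρ i j := by
  rcases le_total i j with hij | hij
  · rw [gapWeight_of_le ρ hij]; exact h.two i j hij
  · rw [gapWeight_comm, gapWeight_of_le ρ hij]
    simp only [mul_comm (ψ (T^[i] _))]
    exact h.two j i hij

/-- A bound of Wick type: a sum over the three pairings of the times. It is symmetric in the times,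
which reduces it to ordered times. -/
lemma abs_four_le (h : CorrelationDecay T μ ψ K ρ) (i j k l : ℕ) :
    |∫ x, ψ (T^[i] x) * ψ (T^[j] x) * ψ (T^[k] x) * ψ (T^[l] x) ∂μ|
      ≤ K * (gapWeight ρ i j * gapWeight ρ k l + gapWeight ρ i k * gapWeight ρ j l
        + gapWeight ρ i l * gapWeight ρ j k) := by
  have hρ := h.rate_pos.le
  refine of_sorted_four (Q := fun i j k l =>
    |∫ x, ψ (T^[i] x) * ψ (T^[j] x) * ψ (T^[k] x) * ψ (T^[l] x) ∂μ|
      ≤ K * (gapWeight ρ i j * gapWeight ρ k l + gapWeight ρ i k * gapWeight ρ j l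
        + gapWeight ρ i l * gapWeight ρ j k)) ?_ ?_ ?_ ?_ i j k l
  · intro i j k l hQ
    rw [gapWeight_comm ρ j i]
    convert! hQ using 1
    · simp only [mul_comm (ψ (T^[j] _)) (ψ (T^[i] _))]
    · ring
  · intro i j k l hQ
    rw [gapWeight_comm ρ k j]
    convert! hQ using 1
    · simp only [mul_right_comm (ψ (T^[i] _)) (ψ (T^[k] _)) (ψ (T^[j] _))]
    · ring
  · intro i j k l hQ
    rw [gapWeight_comm ρ l k]
    convert! hQ using 1
    · simp only [mul_right_comm _ (ψ (T^[l] _)) (ψ (T^[k] _))]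
    · ring
  · intro i j k l hij hjk hkl
    refine (h.four i j k l hij hjk hkl).trans ?_
    have := h.const_nonneg
    rw [gapWeight_of_le ρ hij, gapWeight_of_le ρ hkl, add_assoc]
    gcongr
    refine le_add_of_nonneg_right ?_
    exact add_nonneg (mul_nonneg (gapWeight_nonneg hρ _ _) (gapWeight_nonneg hρ _ _))
      (mul_nonneg (gapWeight_nonneg hρ _ _) (gapWeight_nonneg hρ _ _))

lemma abs_lagCovariance_le (h : CorrelationDecay T μ ψ K ρ) (k : ℕ) :
    |lagCovariance T μ ψ k| ≤ K * ρ ^ (k + 1) := h.two 0 (k + 1) (Nat.zero_le _)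

lemma summable_lagCovariance (h : CorrelationDecay T μ ψ K ρ) :
    Summable (lagCovariance T μ ψ) := by
  refine Summable.of_norm_bounded (g := fun k => K * ρ * ρ ^ k) ?_ fun k => ?_
  · exact (summable_geometric_of_lt_one h.rate_pos.le h.rate_lt_one).mul_left _
  · rw [mul_assoc, ← pow_succ']
    exact h.abs_lagCovariance_le k

end CorrelationDecay

/-! ### Moments of Birkhoff sums and the asymptotic variance -/

section
variable {X : Type*} [MetricSpace X] [MeasurableSpace X] [BorelSpace X]
  {T : X → X} {μ : Measure X} [IsProbabilityMeasure μ] {ψ : X →ᵇ ℝ} {K ρ : ℝ}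

lemma measurable_birkhoffSum (hT : Measurable T) (ψ : X →ᵇ ℝ) (n : ℕ) :
    Measurable (birkhoffSum T ψ n) :=
  Finset.measurable_fun_sum _ fun k _ => measurable_comp_iterate hT ψ k

lemma abs_birkhoffSum_le {X : Type*} [TopologicalSpace X] (T : X → X) (ψ : X →ᵇ ℝ) (n : ℕ)
    (x : X) : |birkhoffSum T ψ n x| ≤ n * ‖ψ‖ := by
  refine (Finset.abs_sum_le_sum_abs _ _).trans ?_
  refine (Finset.sum_le_sum fun k _ => ψ.norm_coe_le_norm _).trans ?_
  simp

lemma integrable_birkhoffSum_pow (hT : Measurable T) (ψ : X →ᵇ ℝ) (n p : ℕ) :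
    Integrable (fun x => birkhoffSum T ψ n x ^ p) μ :=
  integrable_of_abs_le ((measurable_birkhoffSum hT ψ n).pow_const p)
    (C := (n * ‖ψ‖) ^ p) fun x => by
      rw [abs_pow]; exact pow_le_pow_left₀ (abs_nonneg _) (abs_birkhoffSum_le T ψ n x) p

lemma integrable_mul_comp_iterate (hT : Measurable T) (f g : X →ᵇ ℝ) (i j : ℕ) :
    Integrable (fun x => f (T^[i] x) * g (T^[j] x)) μ :=
  integrable_of_abs_le ((measurable_comp_iterate hT f i).mul (measurable_comp_iterate hT g j))
    (C := ‖f‖ * ‖g‖) fun x => by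
      rw [abs_mul]
      exact mul_le_mul (f.norm_coe_le_norm _) (g.norm_coe_le_norm _) (abs_nonneg _) (norm_nonneg _)

namespace CorrelationDecay

lemma integral_birkhoffSum_sq_le (h : CorrelationDecay T μ ψ K ρ) (hT : MeasurePreserving T μ μ)
    (n : ℕ) : ∫ x, birkhoffSum T ψ n x ^ 2 ∂μ ≤ K * (1 + 2 / (1 - ρ)) * n := by
  have h1 : ∀ x, birkhoffSum T ψ n x ^ 2
      = ∑ i ∈ Finset.range n, ∑ j ∈ Finset.range n, ψ (T^[i] x) * ψ (T^[j] x) := fun x => by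
    rw [sq, birkhoffSum, Finset.sum_mul_sum]
  have hI := integrable_mul_comp_iterate (μ := μ) hT.measurable ψ ψ
  simp only [h1]
  rw [integral_finsetSum _ fun i _ => integrable_finsetSum _ fun j _ => hI i j]
  have h2 : ∀ i, ∫ x, ∑ j ∈ Finset.range n, ψ (T^[i] x) * ψ (T^[j] x) ∂μ
      = ∑ j ∈ Finset.range n, ∫ x, ψ (T^[i] x) * ψ (T^[j] x) ∂μ := fun i =>
    integral_finsetSum _ fun j _ => hI i j
  simp only [h2]
  calc _ ≤ ∑ i ∈ Finset.range n, ∑ j ∈ Finset.range n, K * gapWeight ρ i j :=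
        Finset.sum_le_sum fun i _ => Finset.sum_le_sum fun j _ =>
          (le_abs_self _).trans (h.abs_two_le i j)
    _ = K * ∑ i ∈ Finset.range n, ∑ j ∈ Finset.range n, gapWeight ρ i j := by
        simp only [Finset.mul_sum]
    _ ≤ K * ((1 + 2 / (1 - ρ)) * n) := mul_le_mul_of_nonneg_left
        (sum_sum_gapWeight_le h.rate_pos.le h.rate_lt_one n) h.const_nonneg
    _ = _ := by ring

/-- The fourth moment of a Birkhoff sum is of the order of the square of its length, as for a
Gaussian variable. -/
lemma integral_birkhoffSum_pow_four_le (h : CorrelationDecay T μ ψ K ρ)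
    (hT : MeasurePreserving T μ μ) (n : ℕ) :
    ∫ x, birkhoffSum T ψ n x ^ 4 ∂μ ≤ 3 * K * ((1 + 2 / (1 - ρ)) * n) ^ 2 := by
  set R := Finset.range n with hR
  have h1 : ∀ x, birkhoffSum T ψ n x ^ 4 = ∑ i ∈ R, ∑ j ∈ R, ∑ k ∈ R, ∑ l ∈ R,
      ψ (T^[i] x) * ψ (T^[j] x) * ψ (T^[k] x) * ψ (T^[l] x) := fun x => by
    have e : birkhoffSum T ψ n x ^ 4 = (birkhoffSum T ψ n x * birkhoffSum T ψ n x)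
        * birkhoffSum T ψ n x * birkhoffSum T ψ n x := by ring
    rw [e, birkhoffSum, ← hR]
    simp only [← Finset.sum_mul, ← Finset.mul_sum]
  have hI : ∀ i j k l, Integrable
      (fun x => ψ (T^[i] x) * ψ (T^[j] x) * ψ (T^[k] x) * ψ (T^[l] x)) μ := fun i j k l => by
    have := (memLp_prod_comp_iterate (μ := μ) hT.measurable
      (fun _ : Fin 4 => ψ) ![i, j, k, l] 1).integrable le_rfl
    simp only [Fin.prod_univ_four] at this
    exact this
  have h2 : ∫ x, birkhoffSum T ψ n x ^ 4 ∂μ = ∑ i ∈ R, ∑ j ∈ R, ∑ k ∈ R, ∑ l ∈ R,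
      ∫ x, ψ (T^[i] x) * ψ (T^[j] x) * ψ (T^[k] x) * ψ (T^[l] x) ∂μ := by
    simp only [h1]
    rw [integral_finsetSum _ fun i _ => integrable_finsetSum _ fun j _ =>
      integrable_finsetSum _ fun k _ => integrable_finsetSum _ fun l _ => hI i j k l]
    refine Finset.sum_congr rfl fun i _ => ?_
    rw [integral_finsetSum _ fun j _ =>
      integrable_finsetSum _ fun k _ => integrable_finsetSum _ fun l _ => hI i j k l]
    refine Finset.sum_congr rfl fun j _ => ?_
    rw [integral_finsetSum _ fun k _ => integrable_finsetSum _ fun l _ => hI i j k l]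
    refine Finset.sum_congr rfl fun k _ => ?_
    rw [integral_finsetSum _ fun l _ => hI i j k l]
  set W := ∑ i ∈ R, ∑ j ∈ R, gapWeight ρ i j with hW
  have hW0 : 0 ≤ W := Finset.sum_nonneg fun i _ => Finset.sum_nonneg fun j _ =>
    gapWeight_nonneg h.rate_pos.le i j
  have hWle : W ≤ (1 + 2 / (1 - ρ)) * n := sum_sum_gapWeight_le h.rate_pos.le h.rate_lt_one n
  have e1 : ∑ i ∈ R, ∑ j ∈ R, ∑ k ∈ R, ∑ l ∈ R, gapWeight ρ i j * gapWeight ρ k l = W ^ 2 := by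
    rw [sq, hW]
    simp only [← Finset.sum_mul, ← Finset.mul_sum]
  have e2 : ∑ i ∈ R, ∑ j ∈ R, ∑ k ∈ R, ∑ l ∈ R, gapWeight ρ i k * gapWeight ρ j l = W ^ 2 := by
    rw [← e1]
    exact Finset.sum_congr rfl fun i _ => Finset.sum_comm
  have e3 : ∑ i ∈ R, ∑ j ∈ R, ∑ k ∈ R, ∑ l ∈ R, gapWeight ρ i l * gapWeight ρ j k = W ^ 2 := by
    rw [← e2]
    exact Finset.sum_congr rfl fun i _ => Finset.sum_congr rfl fun j _ => Finset.sum_comm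
  rw [h2]
  calc _ ≤ ∑ i ∈ R, ∑ j ∈ R, ∑ k ∈ R, ∑ l ∈ R, K * (gapWeight ρ i j * gapWeight ρ k l
        + gapWeight ρ i k * gapWeight ρ j l + gapWeight ρ i l * gapWeight ρ j k) :=
        Finset.sum_le_sum fun i _ => Finset.sum_le_sum fun j _ => Finset.sum_le_sum fun k _ =>
          Finset.sum_le_sum fun l _ => (le_abs_self _).trans (h.abs_four_le i j k l)
    _ = 3 * K * W ^ 2 := by
        have e4 : 3 * K * W ^ 2 = K * (W ^ 2 + W ^ 2 + W ^ 2) := by ring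
        rw [e4]
        nth_rw 1 [← e1]
        nth_rw 1 [← e2]
        nth_rw 1 [← e3]
        simp only [Finset.mul_sum, Finset.sum_add_distrib, mul_add]
    _ ≤ _ := by
        have := h.const_nonneg
        gcongr

/-- The increments of the variance of `birkhoffSum T ψ n` are the partial sums of the series for
the asymptotic variance, so the normalized variance converges to it in the sense of Cesàro. -/
lemma tendsto_integral_birkhoffSum_sq_div (h : CorrelationDecay T μ ψ K ρ)
    (hT : MeasurePreserving T μ μ) :
    Tendsto (fun n : ℕ => (n : ℝ)⁻¹ * ∫ x, birkhoffSum T ψ n x ^ 2 ∂μ) atTop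
      (𝓝 (asymptoticVariance T μ ψ)) := by
  have hstep : ∀ n : ℕ, ∫ x, birkhoffSum T ψ (n + 1) x ^ 2 ∂μ
      = (∫ x, ψ x ^ 2 ∂μ + 2 * ∑ k ∈ Finset.range n, lagCovariance T μ ψ k)
        + ∫ x, birkhoffSum T ψ n x ^ 2 ∂μ := fun n => by
    have hI := integrable_mul_comp_iterate (μ := μ) hT.measurable ψ ψ
    have hI2 : Integrable (fun x => birkhoffSum T ψ n (T x) ^ 2) μ :=
      integrable_of_abs_le
        (((measurable_birkhoffSum hT.measurable ψ n).comp hT.measurable).pow_const 2)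
        (C := (n * ‖ψ‖) ^ 2) fun x => by
          rw [abs_pow]; exact pow_le_pow_left₀ (abs_nonneg _) (abs_birkhoffSum_le T ψ n _) 2
    have h1 : ∀ x, birkhoffSum T ψ (n + 1) x ^ 2 = (ψ x ^ 2
        + 2 * ∑ k ∈ Finset.range n, ψ x * ψ (T^[k + 1] x)) + birkhoffSum T ψ n (T x) ^ 2 :=
      fun x => by
        rw [birkhoffSum_succ', ← Finset.mul_sum]
        have : ∑ k ∈ Finset.range n, ψ (T^[k + 1] x) = birkhoffSum T ψ n (T x) := rfl
        rw [this]; ring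
    have h2 : ∫ x, birkhoffSum T ψ n (T x) ^ 2 ∂μ = ∫ x, birkhoffSum T ψ n x ^ 2 ∂μ :=
      integral_comp_iterate hT
        ((measurable_birkhoffSum hT.measurable ψ n).pow_const 2).stronglyMeasurable 1
    have hI0 : Integrable (fun x => ψ x ^ 2) μ := by
      simpa [sq] using hI 0 0
    have hI' : ∀ k, Integrable (fun x => ψ x * ψ (T^[k + 1] x)) μ := fun k => hI 0 (k + 1)
    have hI1 : Integrable (fun x => ∑ k ∈ Finset.range n, ψ x * ψ (T^[k + 1] x)) μ :=
      integrable_finsetSum _ fun k _ => hI' k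
    simp only [h1]
    rw [integral_add (f := fun x => ψ x ^ 2 + 2 * ∑ k ∈ Finset.range n, ψ x * ψ (T^[k + 1] x))
      (hI0.add (hI1.const_mul 2)) hI2, integral_add hI0 (hI1.const_mul 2),
      integral_const_mul, integral_finsetSum _ fun k _ => hI' k, h2]
    rfl
  have hsum : ∀ n : ℕ, ∫ x, birkhoffSum T ψ n x ^ 2 ∂μ = ∑ m ∈ Finset.range n,
      (∫ x, ψ x ^ 2 ∂μ + 2 * ∑ k ∈ Finset.range m, lagCovariance T μ ψ k) := fun n => by
    induction n with
    | zero => simp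
    | succ n ih => rw [hstep, ih, Finset.sum_range_succ, add_comm]
  simp only [hsum]
  exact (((h.summable_lagCovariance.hasSum.tendsto_sum_nat).const_mul 2).const_add _).cesaro

lemma asymptoticVariance_nonneg (h : CorrelationDecay T μ ψ K ρ)
    (hT : MeasurePreserving T μ μ) : 0 ≤ asymptoticVariance T μ ψ :=
  ge_of_tendsto' (h.tendsto_integral_birkhoffSum_sq_div hT) fun n =>
    mul_nonneg (by positivity) (integral_nonneg fun x => sq_nonneg _)

end CorrelationDecay

end

/-! ### Elementary estimates -/

lemma tendsto_natCeil_rpow_div_rpow {α γ : ℝ} (hα : α < γ) (hγ : 0 < γ) :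
    Tendsto (fun n : ℕ => (⌈(n : ℝ) ^ α⌉₊ : ℝ) / (n : ℝ) ^ γ) atTop (𝓝 0) := by
  have h1 : Tendsto (fun n : ℕ => (n : ℝ) ^ (-(γ - α)) + (n : ℝ) ^ (-γ)) atTop (𝓝 0) := by
    have := ((tendsto_rpow_neg_atTop (sub_pos.2 hα)).comp tendsto_natCast_atTop_atTop).add
      ((tendsto_rpow_neg_atTop hγ).comp (tendsto_natCast_atTop_atTop (R := ℝ)))
    simpa using this
  refine squeeze_zero' (Eventually.of_forall fun n => by positivity) ?_ h1
  filter_upwards [eventually_gt_atTop 0] with n hn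
  have hn' : (0 : ℝ) < n := by exact_mod_cast hn
  rw [div_le_iff₀ (by positivity), add_mul, ← Real.rpow_add hn', ← Real.rpow_add hn',
    neg_add_cancel, Real.rpow_zero, show -(γ - α) + γ = α by ring]
  exact (Nat.ceil_lt_add_one (by positivity)).le

lemma tendsto_natCeil_rpow_div {α : ℝ} (hα : α < 1) :
    Tendsto (fun n : ℕ => (⌈(n : ℝ) ^ α⌉₊ : ℝ) / n) atTop (𝓝 0) := by
  simpa only [Real.rpow_one] using tendsto_natCeil_rpow_div_rpow hα one_pos

/-- A geometric factor `δ ^ (n ^ α)` beats any polynomial times `exp (A n ^ β)` with `β < α`. -/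
lemma tendsto_pow_mul_exp_mul_pow_ceil {δ : ℝ} (h0 : 0 < δ) (h1 : δ < 1) (D : ℕ) (A : ℝ)
    {α β : ℝ} (hα : 0 < α) (hβ : β < α) :
    Tendsto (fun n : ℕ => (n : ℝ) ^ D * Real.exp (A * (n : ℝ) ^ β) * δ ^ ⌈(n : ℝ) ^ α⌉₊) atTop
      (𝓝 0) := by
  set c := -Real.log δ with hc
  have hc0 : 0 < c := neg_pos.2 (Real.log_neg h0 h1)
  have h2 : Tendsto (fun n : ℕ => ((n : ℝ) ^ α) ^ (D / α) * Real.exp (-(c / 2) * (n : ℝ) ^ α))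
      atTop (𝓝 0) :=
    (tendsto_rpow_mul_exp_neg_mul_atTop_nhds_zero (D / α) (c / 2) (by positivity)).comp
      ((tendsto_rpow_atTop hα).comp tendsto_natCast_atTop_atTop)
  have h3 : Tendsto (fun n : ℕ => A * (n : ℝ) ^ (-(α - β))) atTop (𝓝 0) := by
    have := ((tendsto_rpow_neg_atTop (sub_pos.2 hβ)).comp
      tendsto_natCast_atTop_atTop).const_mul A
    simpa using this
  refine squeeze_zero' (Eventually.of_forall fun n => by positivity) ?_ h2
  filter_upwards [eventually_gt_atTop 0, h3.eventually_lt_const (half_pos hc0)] with n hn hn3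
  have hn' : (0 : ℝ) < n := by exact_mod_cast hn
  have h4 : A * (n : ℝ) ^ β ≤ c / 2 * (n : ℝ) ^ α := by
    have : (n : ℝ) ^ β = (n : ℝ) ^ (-(α - β)) * (n : ℝ) ^ α := by
      rw [← Real.rpow_add hn']; congr 1; ring
    rw [this, ← mul_assoc]
    exact mul_le_mul_of_nonneg_right hn3.le (by positivity)
  have h5 : δ ^ ⌈(n : ℝ) ^ α⌉₊ ≤ Real.exp (-c * (n : ℝ) ^ α) := by
    rw [← Real.rpow_natCast, Real.rpow_def_of_pos h0, hc, neg_neg]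
    refine Real.exp_le_exp.2 (mul_le_mul_of_nonpos_left (Nat.le_ceil _) (Real.log_neg h0 h1).le)
  have h6 : ((n : ℝ) ^ α) ^ (D / α) = (n : ℝ) ^ D := by
    rw [← Real.rpow_mul hn'.le, mul_div_cancel₀ _ hα.ne', Real.rpow_natCast]
  rw [h6, mul_assoc]
  gcongr
  calc _ ≤ Real.exp (c / 2 * (n : ℝ) ^ α) * Real.exp (-c * (n : ℝ) ^ α) := by gcongr
    _ = _ := by rw [← Real.exp_add]; congr 1; ring

/-- A sequence that is bounded, for each `k`, by a null sequence plus an error `b k` with `b k → 0`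
is itself a null sequence. -/
lemma tendsto_zero_of_forall_le_add {u : ℕ → ℝ} {r : ℕ → ℕ → ℝ} {b : ℕ → ℝ} (hu : ∀ n, 0 ≤ u n)
    (h : ∀ᶠ k in atTop, ∀ᶠ n in atTop, u n ≤ r k n + b k)
    (hr : ∀ᶠ k in atTop, Tendsto (r k) atTop (𝓝 0)) (hb : Tendsto b atTop (𝓝 0)) :
    Tendsto u atTop (𝓝 0) := by
  rw [Metric.tendsto_atTop']
  intro ε hε
  obtain ⟨k, hk, hkr, hkb⟩ :=
    (h.and (hr.and (hb.eventually_lt_const (half_pos hε)))).exists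
  have := hk.and (hkr.eventually_lt_const (half_pos hε))
  obtain ⟨N, hN⟩ := eventually_atTop.1 this
  refine ⟨N, fun n hn => ?_⟩
  obtain ⟨h1, h2⟩ := hN n hn.le
  rw [Real.dist_eq, sub_zero, abs_of_nonneg (hu n)]
  linarith

lemma norm_exp_I_mul_ofReal (y : ℝ) : ‖Complex.exp (Complex.I * y)‖ = 1 := by
  rw [mul_comm]; exact Complex.norm_exp_ofReal_mul_I y

lemma norm_exp_I_mul_sub_le (y z : ℝ) :
    ‖Complex.exp (Complex.I * y) - Complex.exp (Complex.I * z)‖ ≤ |y - z| := by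
  have h : Complex.exp (Complex.I * y) - Complex.exp (Complex.I * z)
      = Complex.exp (Complex.I * z) * (Complex.exp (Complex.I * (y - z : ℝ)) - 1) := by
    rw [mul_sub, ← Complex.exp_add, mul_one]
    congr 2
    push_cast; ring
  rw [h, norm_mul, norm_exp_I_mul_ofReal, one_mul]
  exact Real.norm_exp_I_mul_ofReal_sub_one_le

lemma norm_exp_I_mul_sub_taylor_le (y : ℝ) :
    ‖Complex.exp (Complex.I * y) - (1 + Complex.I * y - y ^ 2 / 2)‖ ≤ 4 * |y| ^ 3 := by
  rcases le_or_gt |y| 1 with hy | hy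
  · have h := Complex.norm_exp_sub_sum_le_norm_mul_exp (Complex.I * y) 3
    have h1 : ∑ m ∈ Finset.range 3, (Complex.I * y) ^ m / (m.factorial : ℂ)
        = 1 + Complex.I * y - y ^ 2 / 2 := by
      simp [Finset.sum_range_succ, Nat.factorial, mul_pow]
      ring
    have h2 : ‖Complex.I * (y : ℂ)‖ = |y| := by simp
    rw [h1, h2] at h
    refine h.trans ?_
    have h3 : Real.exp |y| ≤ 4 := by
      have := Real.exp_one_lt_d9
      have := Real.exp_le_exp.2 hy
      linarith
    nlinarith [pow_nonneg (abs_nonneg y) 3]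
  · have h1 : ‖Complex.exp (Complex.I * y) - (1 + Complex.I * y - y ^ 2 / 2)‖
        ≤ 1 + (1 + |y| + |y| ^ 2 / 2) := by
      refine (norm_sub_le _ _).trans (add_le_add (norm_exp_I_mul_ofReal y).le ?_)
      refine (norm_sub_le _ _).trans (add_le_add ((norm_add_le _ _).trans ?_) ?_)
      · simp
      · simp
    have h2 : |y| ≤ |y| ^ 3 := by nlinarith [mul_pos (lt_trans one_pos hy) (lt_trans one_pos hy)]
    have h3 : |y| ^ 2 ≤ |y| ^ 3 := pow_le_pow_right₀ hy.le (by norm_num)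
    nlinarith

lemma abs_exp_neg_sub_le {z : ℝ} (hz : 0 ≤ z) : |Real.exp (-z) - (1 - z)| ≤ z ^ 2 := by
  have h1 := Real.add_one_le_exp (-z)
  have h2 : Real.exp (-z) ≤ 1 - z + z ^ 2 := by
    rw [Real.exp_neg]
    have h3 := Real.add_one_le_exp z
    calc (Real.exp z)⁻¹ ≤ (z + 1)⁻¹ := inv_anti₀ (by positivity) h3
      _ ≤ 1 - z + z ^ 2 := by
        rw [inv_le_iff_one_le_mul₀ (by positivity)]
        nlinarith [pow_nonneg hz 3]
  rw [abs_le]; constructor <;> linarith [sq_nonneg z]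

lemma norm_pow_sub_pow_le {a b : ℂ} (ha : ‖a‖ ≤ 1) (hb : ‖b‖ ≤ 1) (k : ℕ) :
    ‖a ^ k - b ^ k‖ ≤ k * ‖a - b‖ := by
  induction k with
  | zero => simp
  | succ k ih =>
    have h : a ^ (k + 1) - b ^ (k + 1) = a ^ k * (a - b) + (a ^ k - b ^ k) * b := by ring
    rw [h]
    refine (norm_add_le _ _).trans ?_
    rw [norm_mul, norm_mul, norm_pow]
    have h1 : ‖a‖ ^ k ≤ 1 := pow_le_one₀ (norm_nonneg _) ha
    push_cast
    nlinarith [norm_nonneg (a - b), norm_nonneg (a ^ k - b ^ k)]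

/-- Monotonicity of `L^p` norms between `p = 1` and `p = 2`. -/
lemma integral_abs_le_sqrt {X : Type*} [MeasurableSpace X] {μ : Measure X} [IsProbabilityMeasure μ]
    {f : X → ℝ} (hf : Measurable f) {C : ℝ} (hC : ∀ x, |f x| ≤ C) :
    ∫ x, |f x| ∂μ ≤ √(∫ x, f x ^ 2 ∂μ) := by
  refine Real.le_sqrt_of_sq_le ?_
  set m := ∫ x, |f x| ∂μ with hm
  have hi : Integrable (fun x => |f x|) μ :=
    integrable_of_abs_le (by fun_prop) (C := C) fun x => by rw [abs_abs]; exact hC x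
  have hi2 : Integrable (fun x => f x ^ 2) μ :=
    integrable_of_abs_le (by fun_prop) (C := C ^ 2) fun x => by
      rw [abs_pow]; exact pow_le_pow_left₀ (abs_nonneg _) (hC x) 2
  have h1 : 0 ≤ ∫ x, (|f x| - m) ^ 2 ∂μ := integral_nonneg fun x => sq_nonneg _
  have h2 : ∀ x, (|f x| - m) ^ 2 = f x ^ 2 - (2 * m * |f x| - m ^ 2) := fun x => by
    rw [sub_sq, sq_abs]; ring
  simp only [h2] at h1
  rw [integral_sub (g := fun x => 2 * m * |f x| - m ^ 2) hi2
      ((hi.const_mul _).sub (integrable_const _)),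
    integral_sub (hi.const_mul _) (integrable_const _), integral_const_mul, ← hm] at h1
  simp at h1
  nlinarith

/-! ### Characteristic functions of Birkhoff sums -/

/-- `exp (i τ S_n)`, where `S_n` is the `n`-th Birkhoff sum of `ψ`. -/
def expBirkhoff {X : Type*} (T : X → X) (ψ : X → ℝ) (τ : ℝ) (n : ℕ) (x : X) : ℂ :=
  Complex.exp (Complex.I * ((τ * birkhoffSum T ψ n x : ℝ) : ℂ))

/-- The real part `cos (τ ψ)` (at `true`) and the imaginary part `sin (τ ψ)` (at `false`) of
`exp (i τ ψ)`. -/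
def trigPart {X : Type*} [TopologicalSpace X] (ψ : X →ᵇ ℝ) (τ : ℝ) : Bool → (X →ᵇ ℝ)
  | true => BoundedContinuousFunction.ofNormedAddCommGroup (fun x => Real.cos (τ * ψ x))
      (by fun_prop) 1 fun x => Real.abs_cos_le_one _
  | false => BoundedContinuousFunction.ofNormedAddCommGroup (fun x => Real.sin (τ * ψ x))
      (by fun_prop) 1 fun x => Real.abs_sin_le_one _

section trigPart
variable {X : Type*} [MetricSpace X]

lemma norm_trigPart_le (ψ : X →ᵇ ℝ) (τ : ℝ) {M : ℝ≥0} (hM : ‖ψ‖ ≤ M) (c : Bool) :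
    ‖trigPart ψ τ c‖ ≤ ((if c then 1 else ‖τ‖₊ * M : ℝ≥0) : ℝ) := by
  refine (BoundedContinuousFunction.norm_le (by positivity)).2 fun x => ?_
  cases c with
  | true => simpa [trigPart] using Real.abs_cos_le_one _
  | false =>
    have h1 : ‖trigPart ψ τ false x‖ = |Real.sin (τ * ψ x)| := rfl
    rw [h1]
    have h2 : |Real.sin (τ * ψ x)| ≤ |τ * ψ x| := by
      simpa using Real.abs_sin_sub_sin_le (τ * ψ x) 0
    refine h2.trans ?_
    rw [abs_mul]
    simp only [Bool.false_eq_true, if_false, NNReal.coe_mul, coe_nnnorm, Real.norm_eq_abs]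
    gcongr
    exact (ψ.norm_coe_le_norm x).trans hM

lemma holderWith_of_dist_le {f : X → ℝ} {C r : ℝ≥0}
    (h : ∀ x y, dist (f x) (f y) ≤ C * dist x y ^ (r : ℝ)) : HolderWith C r f := by
  intro x y
  rw [edist_dist, edist_dist, ENNReal.ofReal_rpow_of_nonneg dist_nonneg r.coe_nonneg,
    ← ENNReal.ofReal_coe_nnreal (p := C), ← ENNReal.ofReal_mul C.coe_nonneg]
  exact ENNReal.ofReal_le_ofReal (h x y)

/-- A bounded Hölder function is Hölder for every smaller exponent, at all scales. -/
lemma HolderWith.of_exponent_le {f : X →ᵇ ℝ} {c r s M : ℝ≥0} (hf : HolderWith c r f)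
    (hM : ‖f‖ ≤ M) (hsr : s ≤ r) : HolderWith (c + 2 * M) s f := by
  refine holderWith_of_dist_le fun x y => ?_
  push_cast
  have hd : (0 : ℝ) ≤ dist x y ^ (s : ℝ) := by positivity
  rcases le_total (dist x y) 1 with hle | hle
  · have h1 : dist x y ^ (r : ℝ) ≤ dist x y ^ (s : ℝ) := by
      rcases hsr.eq_or_lt with rfl | hlt
      · exact le_rfl
      · refine Real.rpow_le_rpow_of_exponent_ge_of_imp dist_nonneg hle (by exact_mod_cast hsr) ?_
        intro _ h0
        exact absurd h0 (by
          have : (0 : ℝ≥0) < r := lt_of_le_of_lt (zero_le) hlt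
          exact_mod_cast this.ne')
    have h2 := hf.dist_le x y
    have h3 : (c : ℝ) * dist x y ^ (r : ℝ) ≤ c * dist x y ^ (s : ℝ) := by gcongr
    nlinarith [M.coe_nonneg]
  · have h1 : (1 : ℝ) ≤ dist x y ^ (s : ℝ) := Real.one_le_rpow hle s.coe_nonneg
    have h2 : dist (f x) (f y) ≤ 2 * M := (f.dist_le_two_norm x y).trans (by gcongr)
    nlinarith [c.coe_nonneg, M.coe_nonneg]

lemma holderWith_trigPart {ψ : X →ᵇ ℝ} {L r : ℝ≥0} (hψ : HolderWith L r ψ) (τ : ℝ) (c : Bool) :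
    HolderWith (‖τ‖₊ * L) r (trigPart ψ τ c) := by
  refine holderWith_of_dist_le fun x y => ?_
  have h1 : dist (trigPart ψ τ c x) (trigPart ψ τ c y) ≤ |τ * ψ x - τ * ψ y| := by
    cases c
    · exact Real.abs_sin_sub_sin_le _ _
    · exact Real.abs_cos_sub_cos_le _ _
  refine h1.trans ?_
  rw [← mul_sub, abs_mul, NNReal.coe_mul, coe_nnnorm, Real.norm_eq_abs, mul_assoc]
  exact mul_le_mul_of_nonneg_left (hψ.dist_le x y) (abs_nonneg _)

/-- The Hölder constant of either trigonometric part is at most `H` times the sup norm bound of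
`norm_trigPart_le`; the sine is small, and so is its Hölder constant. -/
lemma holderWith_trigPart_normalized {ψ : X →ᵇ ℝ} {L M H r : ℝ≥0} (hψ : HolderWith L r ψ)
    (hM1 : 1 ≤ M) (τ : ℝ) (hLH : L ≤ H) (hτH : ‖τ‖₊ * L ≤ H) (c : Bool) :
    HolderWith (H * if c then 1 else ‖τ‖₊ * M) r (trigPart ψ τ c) := by
  have h1 : ‖τ‖₊ * L ≤ H * if c then 1 else ‖τ‖₊ * M := by
    cases c with
    | true => simpa using hτH
    | false =>
      simp only [Bool.false_eq_true, if_false]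
      calc ‖τ‖₊ * L ≤ ‖τ‖₊ * (H * M) := by
            gcongr; exact hLH.trans (le_mul_of_one_le_right' hM1)
        _ = H * (‖τ‖₊ * M) := by ring
  exact fun x y => (holderWith_trigPart hψ τ c x y).trans
    (mul_le_mul_left (ENNReal.coe_le_coe.2 h1) _)

end trigPart

lemma expBirkhoff_eq_prod {X : Type*} [TopologicalSpace X] (T : X → X) (ψ : X →ᵇ ℝ) (τ : ℝ)
    (n : ℕ) (x : X) :
    expBirkhoff T ψ τ n x = ∏ k : Fin n, ((trigPart ψ τ true (T^[k] x) : ℂ)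
      + Complex.I * trigPart ψ τ false (T^[k] x)) := by
  rw [expBirkhoff, birkhoffSum, Finset.mul_sum, Complex.ofReal_sum, Finset.mul_sum, Complex.exp_sum,
    Finset.prod_range]
  refine Finset.prod_congr rfl fun k _ => ?_
  have h1 : (trigPart ψ τ true (T^[k] x) : ℂ) = Complex.cos (τ * ψ (T^[k] x) : ℝ) :=
    Complex.ofReal_cos _
  have h2 : (trigPart ψ τ false (T^[k] x) : ℂ) = Complex.sin (τ * ψ (T^[k] x) : ℝ) :=
    Complex.ofReal_sin _
  rw [h1, h2, mul_comm Complex.I, Complex.exp_mul_I, mul_comm Complex.I]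

lemma expBirkhoff_add {X : Type*} (T : X → X) (ψ : X → ℝ) (τ : ℝ) (m n : ℕ) (x : X) :
    expBirkhoff T ψ τ (m + n) x = expBirkhoff T ψ τ m x * expBirkhoff T ψ τ n (T^[m] x) := by
  rw [expBirkhoff, expBirkhoff, expBirkhoff, birkhoffSum_add, ← Complex.exp_add]
  congr 1
  push_cast; ring

lemma norm_expBirkhoff {X : Type*} (T : X → X) (ψ : X → ℝ) (τ : ℝ) (n : ℕ) (x : X) :
    ‖expBirkhoff T ψ τ n x‖ = 1 := norm_exp_I_mul_ofReal _

/-- The characteristic function of the `n`-th Birkhoff sum. -/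
def charBirkhoff {X : Type*} [MeasurableSpace X] (T : X → X) (μ : Measure X) (ψ : X → ℝ)
    (τ : ℝ) (n : ℕ) : ℂ :=
  ∫ x, expBirkhoff T ψ τ n x ∂μ

lemma norm_charBirkhoff_le {X : Type*} [MeasurableSpace X] (T : X → X) (μ : Measure X)
    [IsProbabilityMeasure μ] (ψ : X → ℝ) (τ : ℝ) (n : ℕ) : ‖charBirkhoff T μ ψ τ n‖ ≤ 1 :=
  (norm_integral_le_of_norm_le_const (C := 1)
    (ae_of_all _ fun x => (norm_expBirkhoff T ψ τ n x).le)).trans (by simp)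

section
variable {X : Type*} [MetricSpace X] [MeasurableSpace X] [BorelSpace X]
  {T : X → X} {μ : Measure X} [IsProbabilityMeasure μ] {ψ : X →ᵇ ℝ} {K ρ : ℝ}

lemma measurable_expBirkhoff (hT : Measurable T) (ψ : X →ᵇ ℝ) (τ : ℝ) (n : ℕ) :
    Measurable (expBirkhoff T ψ τ n) := by
  have := measurable_birkhoffSum hT ψ n
  unfold expBirkhoff
  fun_prop

/-- A product of complex functions observed up to time `a` decorrelates from the exponential of a
Birkhoff sum started at time `a + N`. The exponential is a product of `n` factors
`cos (τ ψ) + i sin (τ ψ)`, and this costs a factor `(1 + |τ| M) ^ n`. -/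
lemma DecorrelationRate.norm_expBirkhoff_le {η : ℝ≥0} {C δ : ℝ}
    (h : DecorrelationRate T μ η C δ) (hT : MeasurePreserving T μ μ) {L M : ℝ≥0}
    (hψ : HolderWith L η ψ) (hM : ‖ψ‖ ≤ M) (hM1 : 1 ≤ M) (τ : ℝ)
    {ι : Type} [Fintype ι] [DecidableEq ι] (p : ι → Bool → (X →ᵇ ℝ)) (s : ι → ℕ)
    (a N n : ℕ) (hN : 0 < N) (hs : ∀ i, s i ≤ a) (A : ι → Bool → ℝ≥0) (H : ℝ≥0)
    (hA : ∀ i c, ‖p i c‖ ≤ A i c) (hp : ∀ i c, HolderWith (H * A i c) η (p i c))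
    (hLH : L ≤ H) (hτH : ‖τ‖₊ * L ≤ H) (F : X → ℂ)
    (hF : ∀ x, F x = ∏ i, ((p i true (T^[s i] x) : ℂ) + Complex.I * p i false (T^[s i] x))) :
    ‖∫ x, F x * expBirkhoff T ψ τ n (T^[a + N] x) ∂μ
        - (∫ x, F x ∂μ) * ∫ x, expBirkhoff T ψ τ n x ∂μ‖
      ≤ C * (1 + (Fintype.card ι + n + 1) * H)
        * ((∏ i, (A i true + A i false)) * (1 + |τ| * M) ^ n) * δ ^ N := by
  have h1 := h.norm_le hT.measurable p (fun _ : Fin n => trigPart ψ τ) s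
    (fun j => (j : ℕ) + (a + N)) a N hN hs (fun j => by omega) A
    (fun _ c => if c then 1 else ‖τ‖₊ * M) H hA (fun _ c => norm_trigPart_le ψ τ hM c) hp
    (fun _ c => holderWith_trigPart_normalized hψ hM1 τ hLH hτH c)
    F (fun x => expBirkhoff T ψ τ n (T^[a + N] x)) hF (fun x => by
      rw [expBirkhoff_eq_prod]
      simp only [Function.iterate_add_apply])
  rw [integral_comp_iterate hT (measurable_expBirkhoff hT.measurable ψ τ n).stronglyMeasurable]
    at h1
  simpa using h1

/-- Two Birkhoff sums separated by a gap `g` are nearly independent. -/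
lemma DecorrelationRate.norm_integral_mul_expBirkhoff_sub_le {η : ℝ≥0} {C δ : ℝ}
    (h : DecorrelationRate T μ η C δ) (hT : MeasurePreserving T μ μ) {L M : ℝ≥0}
    (hψ : HolderWith L η ψ) (hM : ‖ψ‖ ≤ M) (hM1 : 1 ≤ M) (τ : ℝ) {H : ℝ≥0}
    (hLH : L ≤ H) (hτH : ‖τ‖₊ * L ≤ H) (a g b : ℕ) (hg : 0 < g) :
    ‖∫ x, expBirkhoff T ψ τ a x * expBirkhoff T ψ τ b (T^[a + g] x) ∂μ
        - charBirkhoff T μ ψ τ a * charBirkhoff T μ ψ τ b‖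
      ≤ C * (1 + (a + b + 1) * H) * (1 + |τ| * M) ^ (a + b) * δ ^ g := by
  have h1 := h.norm_expBirkhoff_le hT hψ hM hM1 τ (fun _ : Fin a => trigPart ψ τ) (fun i => i)
    a g b hg (fun i => i.2.le) (fun _ c => if c then 1 else ‖τ‖₊ * M) H
    (fun _ c => norm_trigPart_le ψ τ hM c)
    (fun _ c => holderWith_trigPart_normalized hψ hM1 τ hLH hτH c)
    hLH hτH (expBirkhoff T ψ τ a) (fun x => expBirkhoff_eq_prod T ψ τ a x)
  refine h1.trans (le_of_eq ?_)
  simp [pow_add]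

/-- Dropping a Birkhoff sum from an exponent costs at most its size in `L²`. -/
lemma norm_integral_mul_expBirkhoff_sub_le_sqrt (hT : MeasurePreserving T μ μ) {F G : X → ℂ}
    (hF : Measurable F) (hG : Measurable G)
    (hF1 : ∀ x, ‖F x‖ = 1) (hG1 : ∀ x, ‖G x‖ = 1) (τ : ℝ) (a n : ℕ) :
    ‖∫ x, F x * expBirkhoff T ψ τ n (T^[a] x) * G x ∂μ - ∫ x, F x * G x ∂μ‖
      ≤ |τ| * √(∫ x, birkhoffSum T ψ n x ^ 2 ∂μ) := by
  have hm := (measurable_expBirkhoff hT.measurable ψ τ n).comp (hT.measurable.iterate a)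
  have hS := measurable_birkhoffSum hT.measurable ψ n
  have hi1 : Integrable (fun x => F x * expBirkhoff T ψ τ n (T^[a] x) * G x) μ :=
    Integrable.of_bound ((hF.mul hm).mul hG).aestronglyMeasurable 1 (ae_of_all _ fun x => by
      simp [hF1, hG1, norm_expBirkhoff])
  have hi2 : Integrable (fun x => F x * G x) μ :=
    Integrable.of_bound (hF.mul hG).aestronglyMeasurable 1 (ae_of_all _ fun x => by
      simp [hF1, hG1])
  rw [← integral_sub hi1 hi2]
  have habs : Measurable fun x => |birkhoffSum T ψ n x| := by fun_prop
  have hi3 : Integrable (fun x => |τ| * |birkhoffSum T ψ n (T^[a] x)|) μ := by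
    refine (integrable_of_abs_le (habs.comp (hT.measurable.iterate a)) (C := n * ‖ψ‖)
      fun x => ?_).const_mul _
    simpa using abs_birkhoffSum_le T ψ n (T^[a] x)
  calc _ ≤ ∫ x, |τ| * |birkhoffSum T ψ n (T^[a] x)| ∂μ := by
        refine norm_integral_le_of_norm_le hi3 (ae_of_all _ fun x => ?_)
        have h1 : F x * expBirkhoff T ψ τ n (T^[a] x) * G x - F x * G x
            = F x * (expBirkhoff T ψ τ n (T^[a] x) - 1) * G x := by ring
        rw [h1, norm_mul, norm_mul, hF1, hG1, one_mul, mul_one, ← abs_mul]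
        simpa [expBirkhoff] using norm_exp_I_mul_sub_le (τ * birkhoffSum T ψ n (T^[a] x)) 0
    _ = |τ| * ∫ x, |birkhoffSum T ψ n x| ∂μ := by
        rw [integral_const_mul, integral_comp_iterate hT habs.stronglyMeasurable]
    _ ≤ _ := by
        gcongr
        exact integral_abs_le_sqrt hS (abs_birkhoffSum_le T ψ n)

/-- The initial part of a Birkhoff sum can be dropped. -/
lemma norm_charBirkhoff_add_sub_le_right (hT : MeasurePreserving T μ μ) (τ : ℝ) (m n : ℕ) :
    ‖charBirkhoff T μ ψ τ (m + n) - charBirkhoff T μ ψ τ n‖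
      ≤ |τ| * √(∫ x, birkhoffSum T ψ m x ^ 2 ∂μ) := by
  have h := norm_integral_mul_expBirkhoff_sub_le_sqrt (ψ := ψ) hT (F := fun _ => 1)
    (G := fun x => expBirkhoff T ψ τ n (T^[m] x)) measurable_const
    ((measurable_expBirkhoff hT.measurable ψ τ n).comp (hT.measurable.iterate m)) (by simp)
    (fun x => norm_expBirkhoff _ _ _ _ _) τ 0 m
  simp only [one_mul, Function.iterate_zero, id, ← expBirkhoff_add] at h
  rw [integral_comp_iterate hT (measurable_expBirkhoff hT.measurable ψ τ n).stronglyMeasurable]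
    at h
  exact h

/-- The final part of a Birkhoff sum can be dropped. -/
lemma norm_charBirkhoff_add_sub_le_left (hT : MeasurePreserving T μ μ) (τ : ℝ) (m n : ℕ) :
    ‖charBirkhoff T μ ψ τ (m + n) - charBirkhoff T μ ψ τ m‖
      ≤ |τ| * √(∫ x, birkhoffSum T ψ n x ^ 2 ∂μ) := by
  have h := norm_integral_mul_expBirkhoff_sub_le_sqrt (ψ := ψ) hT (F := expBirkhoff T ψ τ m)
    (G := fun _ => 1) (measurable_expBirkhoff hT.measurable ψ τ m) measurable_const
    (fun x => norm_expBirkhoff _ _ _ _ _) (by simp) τ m n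
  simpa only [mul_one, ← expBirkhoff_add, charBirkhoff] using h

/-- The characteristic function of a Birkhoff sum is almost multiplicative in the length: a gap of
length `g` is removed, which costs its `L²` size, and the two remaining parts decorrelate. -/
lemma DecorrelationRate.norm_charBirkhoff_add_sub_mul_le {η : ℝ≥0} {C δ : ℝ}
    (h : DecorrelationRate T μ η C δ) (hT : MeasurePreserving T μ μ) {L M : ℝ≥0}
    (hψ : HolderWith L η ψ) (hM : ‖ψ‖ ≤ M) (hM1 : 1 ≤ M) (τ : ℝ) {H : ℝ≥0}
    (hLH : L ≤ H) (hτH : ‖τ‖₊ * L ≤ H) {a l g n : ℕ} (hg : 0 < g) (hgl : g ≤ l) (hn : a + l ≤ n) :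
    ‖charBirkhoff T μ ψ τ (a + l) - charBirkhoff T μ ψ τ a * charBirkhoff T μ ψ τ l‖
      ≤ 2 * |τ| * √(∫ x, birkhoffSum T ψ g x ^ 2 ∂μ)
        + C * (1 + (n + 1) * H) * (1 + |τ| * M) ^ n * δ ^ g := by
  obtain ⟨b, rfl⟩ := Nat.exists_eq_add_of_le hgl
  have hmb := (measurable_expBirkhoff hT.measurable ψ τ b).comp (hT.measurable.iterate (a + g))
  have h1 : ‖charBirkhoff T μ ψ τ (a + (g + b))
      - ∫ x, expBirkhoff T ψ τ a x * expBirkhoff T ψ τ b (T^[a + g] x) ∂μ‖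
      ≤ |τ| * √(∫ x, birkhoffSum T ψ g x ^ 2 ∂μ) := by
    have := norm_integral_mul_expBirkhoff_sub_le_sqrt (ψ := ψ) hT (F := expBirkhoff T ψ τ a)
      (G := fun x => expBirkhoff T ψ τ b (T^[a + g] x)) (measurable_expBirkhoff hT.measurable ψ τ a)
      hmb (fun x => norm_expBirkhoff _ _ _ _ _) (fun x => norm_expBirkhoff _ _ _ _ _) τ a g
    simpa only [← expBirkhoff_add, add_assoc, charBirkhoff] using this
  have h2 := h.norm_integral_mul_expBirkhoff_sub_le hT hψ hM hM1 τ hLH hτH a g b hg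
  have h3 : ‖charBirkhoff T μ ψ τ a * charBirkhoff T μ ψ τ b
      - charBirkhoff T μ ψ τ a * charBirkhoff T μ ψ τ (g + b)‖
      ≤ |τ| * √(∫ x, birkhoffSum T ψ g x ^ 2 ∂μ) := by
    rw [← mul_sub, norm_mul, norm_sub_rev]
    refine (mul_le_of_le_one_left (norm_nonneg _) (norm_charBirkhoff_le _ _ _ _ _)).trans ?_
    exact norm_charBirkhoff_add_sub_le_right hT τ g b
  have h4 : C * (1 + (a + b + 1) * H) * (1 + |τ| * M) ^ (a + b) * δ ^ g
      ≤ C * (1 + (n + 1) * H) * (1 + |τ| * M) ^ n * δ ^ g := by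
    have hC := h.const_pos
    have hδ := h.rate_pos
    have hab : (a : ℝ) + b ≤ n := by exact_mod_cast (by omega : a + b ≤ n)
    gcongr
    · exact le_add_of_nonneg_right (by positivity)
    · omega
  have h5 := norm_sub_le_norm_sub_add_norm_sub (charBirkhoff T μ ψ τ (a + (g + b)))
    (∫ x, expBirkhoff T ψ τ a x * expBirkhoff T ψ τ b (T^[a + g] x) ∂μ)
    (charBirkhoff T μ ψ τ a * charBirkhoff T μ ψ τ (g + b))
  have h6 := norm_sub_le_norm_sub_add_norm_sub
    (∫ x, expBirkhoff T ψ τ a x * expBirkhoff T ψ τ b (T^[a + g] x) ∂μ)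
    (charBirkhoff T μ ψ τ a * charBirkhoff T μ ψ τ b)
    (charBirkhoff T μ ψ τ a * charBirkhoff T μ ψ τ (g + b))
  linarith

/-- Iterating almost multiplicativity over `k` blocks of length `l`. -/
lemma DecorrelationRate.norm_charBirkhoff_mul_sub_pow_le {η : ℝ≥0} {C δ : ℝ}
    (h : DecorrelationRate T μ η C δ) (hT : MeasurePreserving T μ μ) {L M : ℝ≥0}
    (hψ : HolderWith L η ψ) (hM : ‖ψ‖ ≤ M) (hM1 : 1 ≤ M) (τ : ℝ) {H : ℝ≥0}
    (hLH : L ≤ H) (hτH : ‖τ‖₊ * L ≤ H) {l g n : ℕ} (hg : 0 < g) (hgl : g ≤ l) (k : ℕ)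
    (hn : k * l ≤ n) :
    ‖charBirkhoff T μ ψ τ (k * l) - charBirkhoff T μ ψ τ l ^ k‖
      ≤ k * (2 * |τ| * √(∫ x, birkhoffSum T ψ g x ^ 2 ∂μ)
        + C * (1 + (n + 1) * H) * (1 + |τ| * M) ^ n * δ ^ g) := by
  induction k with
  | zero => simp [charBirkhoff, expBirkhoff]
  | succ k ih =>
    rw [add_mul, one_mul] at hn ⊢
    have h1 := h.norm_charBirkhoff_add_sub_mul_le hT hψ hM hM1 τ hLH hτH hg hgl hn
    have h2 := ih ((Nat.le_add_right _ _).trans hn)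
    have h3 : ‖charBirkhoff T μ ψ τ (k * l) * charBirkhoff T μ ψ τ l
        - charBirkhoff T μ ψ τ l ^ (k + 1)‖
        ≤ ‖charBirkhoff T μ ψ τ (k * l) - charBirkhoff T μ ψ τ l ^ k‖ := by
      rw [pow_succ, ← sub_mul, norm_mul]
      exact mul_le_of_le_one_right (norm_nonneg _) (norm_charBirkhoff_le _ _ _ _ _)
    have h4 := norm_sub_le_norm_sub_add_norm_sub (charBirkhoff T μ ψ τ (k * l + l))
      (charBirkhoff T μ ψ τ (k * l) * charBirkhoff T μ ψ τ l) (charBirkhoff T μ ψ τ l ^ (k + 1))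
    push_cast
    linarith

end

/-! ### The central limit theorem for one observable -/

section
variable {X : Type*} [MetricSpace X] [MeasurableSpace X] [BorelSpace X]
  {T : X → X} {μ : Measure X} [IsProbabilityMeasure μ] {ψ : X →ᵇ ℝ}

/-- Second order Taylor expansion of the characteristic function of a centered Birkhoff sum. The
free parameter `s` balances second against fourth moments in the cubic remainder. -/
lemma norm_charBirkhoff_sub_taylor_le (hT : MeasurePreserving T μ μ) (hψ0 : ∫ x, ψ x ∂μ = 0)
    (τ : ℝ) (l : ℕ) {s : ℝ} (hs : 0 < s) :
    ‖charBirkhoff T μ ψ τ l - ((1 - τ ^ 2 * (∫ x, birkhoffSum T ψ l x ^ 2 ∂μ) / 2 : ℝ) : ℂ)‖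
      ≤ 2 * (τ ^ 2 * (∫ x, birkhoffSum T ψ l x ^ 2 ∂μ) / s
        + s * (τ ^ 4 * ∫ x, birkhoffSum T ψ l x ^ 4 ∂μ)) := by
  set S := birkhoffSum T ψ l with hS
  have hi1 : Integrable S μ := by
    simpa using integrable_birkhoffSum_pow (μ := μ) hT.measurable ψ l 1
  have hi2 : Integrable (fun x => S x ^ 2) μ := integrable_birkhoffSum_pow hT.measurable ψ l 2
  have hi4 : Integrable (fun x => S x ^ 4) μ := integrable_birkhoffSum_pow hT.measurable ψ l 4
  have hS0 : ∫ x, S x ∂μ = 0 := by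
    simp only [hS, birkhoffSum]
    rw [integral_finsetSum]
    · simp only [integral_apply_iterate hT, hψ0, Finset.sum_const_zero]
    · intro i _
      exact integrable_of_abs_le (measurable_comp_iterate hT.measurable ψ i) (C := ‖ψ‖)
        fun x => ψ.norm_coe_le_norm _
  have hie : Integrable (expBirkhoff T ψ τ l) μ :=
    Integrable.of_bound (measurable_expBirkhoff hT.measurable ψ τ l).aestronglyMeasurable 1
      (ae_of_all _ fun x => (norm_expBirkhoff T ψ τ l x).le)
  have hiq : Integrable (fun x => 1 - τ ^ 2 / 2 * S x ^ 2) μ :=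
    (integrable_const 1).sub (hi2.const_mul _)
  have hip : Integrable (fun x => ((1 - τ ^ 2 / 2 * S x ^ 2 : ℝ) : ℂ)
      + Complex.I * τ * (S x : ℂ)) μ := hiq.ofReal.add (hi1.ofReal.const_mul _)
  have hp : ∫ x, ((1 - τ ^ 2 / 2 * S x ^ 2 : ℝ) : ℂ) + Complex.I * τ * (S x : ℂ) ∂μ
      = ((1 - τ ^ 2 * (∫ x, S x ^ 2 ∂μ) / 2 : ℝ) : ℂ) := by
    rw [integral_add hiq.ofReal (hi1.ofReal.const_mul _), integral_const_mul,
      integral_complex_ofReal, integral_complex_ofReal, hS0,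
      integral_sub (integrable_const 1) (hi2.const_mul _), integral_const_mul]
    simp
    ring
  rw [← hp, charBirkhoff, ← integral_sub hie hip]
  have hib : Integrable (fun x => 2 * (τ ^ 2 / s * S x ^ 2 + s * τ ^ 4 * S x ^ 4)) μ :=
    ((hi2.const_mul _).add (hi4.const_mul _)).const_mul 2
  refine (norm_integral_le_of_norm_le hib (ae_of_all _ fun x => ?_)).trans (le_of_eq ?_)
  · set y := τ * S x with hy
    have h1 := norm_exp_I_mul_sub_taylor_le y
    have h2 : expBirkhoff T ψ τ l x - (((1 - τ ^ 2 / 2 * S x ^ 2 : ℝ) : ℂ)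
        + Complex.I * τ * (S x : ℂ))
        = Complex.exp (Complex.I * y) - (1 + Complex.I * y - y ^ 2 / 2) := by
      rw [expBirkhoff, ← hS, ← hy, hy]
      push_cast; ring
    rw [h2]
    refine h1.trans ?_
    have h3 : 2 * |y| ^ 3 ≤ y ^ 2 / s + s * y ^ 4 := by
      have h4 : 0 ≤ |y| ^ 2 * (1 / s - |y|) ^ 2 * s := by positivity
      have h5 : |y| ^ 2 * (1 / s - |y|) ^ 2 * s = |y| ^ 2 / s + s * |y| ^ 4 - 2 * |y| ^ 3 := by
        field_simp; ring
      have h6 : |y| ^ 4 = y ^ 4 := by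
        rw [show (4 : ℕ) = 2 * 2 by norm_num, pow_mul, pow_mul, sq_abs]
      rw [h5, sq_abs, h6] at h4
      linarith
    have h7 : τ ^ 2 / s * S x ^ 2 + s * τ ^ 4 * S x ^ 4 = y ^ 2 / s + s * y ^ 4 := by
      rw [hy]; ring
    rw [h7]; linarith
  · rw [integral_const_mul, integral_add (hi2.const_mul _) (hi4.const_mul _), integral_const_mul,
      integral_const_mul]
    ring

/-- The error in almost multiplicativity, with a gap of length about `n ^ (3 / 4)`. -/
lemma tendsto_gap_error {δ : ℝ} (h0 : 0 < δ) (h1 : δ < 1) (C V H M t : ℝ) :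
    Tendsto (fun n : ℕ => 2 * |t| * √(V * (⌈(n : ℝ) ^ (3 / 4 : ℝ)⌉₊ / n))
      + C * (1 + 2 * H) * ((n : ℝ) ^ 1 * Real.exp (|t| * M * (n : ℝ) ^ (1 / 2 : ℝ))
        * δ ^ ⌈(n : ℝ) ^ (3 / 4 : ℝ)⌉₊)) atTop (𝓝 0) := by
  have h2 := ((tendsto_natCeil_rpow_div (α := 3 / 4) (by norm_num)).const_mul V).sqrt.const_mul
    (2 * |t|)
  have h3 := (tendsto_pow_mul_exp_mul_pow_ceil h0 h1 1 (|t| * M) (α := 3 / 4) (β := 1 / 2)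
    (by norm_num) (by norm_num)).const_mul (C * (1 + 2 * H))
  simpa using h2.add h3

/-- The expansion of `m` factors `exp (i τ ψ)` with `τ = t / √n` costs `exp (O (m / √n))`. This is
the growth that a gap of length `n ^ α` has to beat. -/
lemma one_add_div_sqrt_mul_pow_le (t : ℝ) (M : ℝ≥0) (n : ℕ) {m : ℕ} {B : ℝ}
    (hm : (m : ℝ) ≤ B * √n) (hn : 0 < n) :
    (1 + |t / √n| * M) ^ m ≤ Real.exp (|t| * M * B) := by
  have hn' : (0 : ℝ) < √n := Real.sqrt_pos.2 (by exact_mod_cast hn)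
  rw [add_comm]
  refine (pow_le_pow_left₀ (by positivity) (Real.add_one_le_exp _) m).trans ?_
  rw [← Real.exp_nat_mul, Real.exp_le_exp, abs_div, abs_of_pos hn']
  calc (m : ℝ) * (|t| / √n * M) ≤ B * √n * (|t| / √n * M) := by gcongr
    _ = |t| * M * B := by field_simp

/-- **Central limit theorem** for a centered Hölder function. With `k` fixed, the sum of length `n`
is cut into `k` blocks of length `l = n / k`. Almost multiplicativity replaces its characteristic
function by the `k`-th power of the one of a block, up to an error vanishing as `n → ∞`, and the
Taylor expansion identifies this power with the Gaussian up to `O (1 / √k)`. -/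
theorem DecorrelationRate.tendsto_charBirkhoff {η : ℝ≥0} {C δ : ℝ}
    (h : DecorrelationRate T μ η C δ) (hT : MeasurePreserving T μ μ) {L : ℝ≥0}
    (hψ : HolderWith L η ψ) (hψ0 : ∫ x, ψ x ∂μ = 0) (t : ℝ) :
    Tendsto (fun n : ℕ => charBirkhoff T μ ψ (t / √n) n) atTop
      (𝓝 ((Real.exp (-(1 / 2) * asymptoticVariance T μ ψ * t ^ 2) : ℝ) : ℂ)) := by
  obtain ⟨K, ρ, hd⟩ := h.exists_correlationDecay hT hψ hψ0
  set σ := asymptoticVariance T μ ψ with hσ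
  have hσ0 : 0 ≤ σ := hd.asymptoticVariance_nonneg hT
  have hρ1 : 0 < 1 - ρ := sub_pos.2 hd.rate_lt_one
  have hK := hd.const_nonneg
  obtain ⟨V, hV0, hV⟩ : ∃ V : ℝ, 0 ≤ V ∧ ∀ n, ∫ x, birkhoffSum T ψ n x ^ 2 ∂μ ≤ V * n :=
    ⟨_, by positivity, hd.integral_birkhoffSum_sq_le hT⟩
  obtain ⟨Q, hQ0, hQ⟩ : ∃ Q : ℝ, 0 ≤ Q ∧ ∀ n : ℕ, ∫ x, birkhoffSum T ψ n x ^ 4 ∂μ ≤ Q * n ^ 2 :=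
    ⟨3 * K * (1 + 2 / (1 - ρ)) ^ 2, by positivity, fun n => by
      refine (hd.integral_birkhoffSum_pow_four_le hT n).trans (le_of_eq ?_); ring⟩
  set M : ℝ≥0 := ‖ψ‖₊ + 1 with hMdef
  have hM : ‖ψ‖ ≤ M := by simp [hMdef]
  have hM1 : 1 ≤ M := by simp [hMdef]
  set H : ℝ≥0 := (1 + ‖t‖₊) * L with hH
  have hLH : L ≤ H := le_mul_of_one_le_left' (by simp)
  set g : ℕ → ℕ := fun n => ⌈(n : ℝ) ^ (3 / 4 : ℝ)⌉₊ with hg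
  set E : ℕ → ℝ := fun n => 2 * |t| * √(V * (g n / n))
      + C * (1 + 2 * H) * ((n : ℝ) ^ 1 * Real.exp (|t| * M * (n : ℝ) ^ (1 / 2 : ℝ)) * δ ^ g n)
    with hE
  have hE0 : Tendsto E atTop (𝓝 0) := tendsto_gap_error h.rate_pos h.rate_lt_one C V H M t
  set z : ℝ := σ * t ^ 2 / 2 with hz
  set v : ℕ → ℝ := fun l => ∫ x, birkhoffSum T ψ l x ^ 2 ∂μ with hv
  set B : ℝ := 2 * (t ^ 2 * V + t ^ 4 * Q) with hB
  have hexp : ∀ k : ℕ, 0 < k → ((Real.exp (-(1 / 2) * σ * t ^ 2) : ℝ) : ℂ)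
      = ((Real.exp (-(z / k)) : ℝ) : ℂ) ^ k := fun k hk => by
    have hk' : (k : ℝ) ≠ 0 := by exact_mod_cast hk.ne'
    rw [← Complex.ofReal_pow, ← Real.exp_nat_mul]
    congr 2
    rw [hz]; field_simp
  rw [tendsto_iff_norm_sub_tendsto_zero]
  refine tendsto_zero_of_forall_le_add
    (r := fun k n => |t / √n| * √(V * k) + k * E n
      + k * |(t / √n) ^ 2 * v (n / k) / 2 - z / k|)
    (b := fun k => B * (√(k : ℝ))⁻¹ + z ^ 2 * (k : ℝ)⁻¹) (fun n => norm_nonneg _) ?_ ?_ ?_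
  · filter_upwards [eventually_gt_atTop 0] with k hk
    have hk' : (0 : ℝ) < k := by exact_mod_cast hk
    have hgk := (tendsto_natCeil_rpow_div (α := 3 / 4) (by norm_num)).eventually_lt_const
      (inv_pos.2 hk')
    filter_upwards [eventually_gt_atTop 0, hgk] with n hn hgn
    have hn' : (0 : ℝ) < n := by exact_mod_cast hn
    have hsn : (0 : ℝ) < √n := Real.sqrt_pos.2 hn'
    set τ := t / √n with hτ
    set l := n / k with hl
    have hkl : k * l ≤ n := Nat.mul_div_le n k
    have hτ2 : τ ^ 2 = t ^ 2 / n := by rw [hτ, div_pow, Real.sq_sqrt hn'.le]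
    have hg0 : 0 < g n := Nat.ceil_pos.2 (by positivity)
    have hgl : g n ≤ l := by
      rw [hl, Nat.le_div_iff_mul_le hk]
      have h1 : (g n : ℝ) * k < n := by
        rw [div_lt_iff₀ hn', inv_mul_eq_div, lt_div_iff₀ hk'] at hgn
        exact hgn
      exact_mod_cast h1.le
    have hτt : |τ| ≤ |t| := by
      rw [hτ, abs_div, abs_of_pos hsn]
      exact div_le_self (abs_nonneg _) (Real.one_le_sqrt.2 (by exact_mod_cast hn))
    have hτH : ‖τ‖₊ * L ≤ H := by
      rw [hH]
      gcongr
      have : ‖τ‖₊ ≤ ‖t‖₊ := hτt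
      exact this.trans (by simp)
    -- the leftover of length `n % k`
    have e1 : ‖charBirkhoff T μ ψ τ n - charBirkhoff T μ ψ τ (k * l)‖ ≤ |τ| * √(V * k) := by
      have h1 := norm_charBirkhoff_add_sub_le_left (ψ := ψ) hT τ (k * l) (n % k)
      rw [hl, Nat.div_add_mod] at h1
      refine h1.trans ?_
      gcongr
      refine (hV _).trans ?_
      gcongr
      exact (Nat.mod_lt _ hk).le
    -- the `k` blocks are almost independent
    have e2 : ‖charBirkhoff T μ ψ τ (k * l) - charBirkhoff T μ ψ τ l ^ k‖ ≤ k * E n := by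
      refine (h.norm_charBirkhoff_mul_sub_pow_le hT hψ hM hM1 τ hLH hτH hg0 hgl k hkl).trans ?_
      refine mul_le_mul_of_nonneg_left ?_ hk'.le
      have hC := h.const_pos
      have hδ := h.rate_pos
      refine add_le_add ?_ ?_
      · have h1 : |τ| * √(v (g n)) ≤ |t| * √(V * (g n / n)) := by
          rw [hτ, abs_div, abs_of_pos hsn, div_mul_eq_mul_div, mul_div_assoc,
            ← Real.sqrt_div' _ hn'.le]
          gcongr
          rw [← mul_div_assoc]
          gcongr
          exact hV _
        rw [mul_assoc, mul_assoc]
        exact mul_le_mul_of_nonneg_left h1 (by norm_num)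
      · have h1 : (1 + |τ| * M) ^ n ≤ Real.exp (|t| * M * (n : ℝ) ^ (1 / 2 : ℝ)) := by
          refine one_add_div_sqrt_mul_pow_le t M n ?_ hn
          rw [← Real.sqrt_eq_rpow, Real.mul_self_sqrt hn'.le]
        have h2 : (1 + ((n : ℝ) + 1) * H) ≤ (1 + 2 * H) * n := by
          have : (1 : ℝ) ≤ n := by exact_mod_cast hn
          nlinarith [H.coe_nonneg]
        calc _ ≤ C * ((1 + 2 * H) * n) * Real.exp (|t| * M * (n : ℝ) ^ (1 / 2 : ℝ)) * δ ^ g n := by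
              gcongr
          _ = _ := by ring
    -- each block is close to the `k`-th root of the Gaussian
    have e3 : ‖charBirkhoff T μ ψ τ l ^ k - ((Real.exp (-(1 / 2) * σ * t ^ 2) : ℝ) : ℂ)‖
        ≤ k * |τ ^ 2 * v l / 2 - z / k| + (B * (√(k : ℝ))⁻¹ + z ^ 2 * (k : ℝ)⁻¹) := by
      have hz0 : 0 ≤ z / k := by positivity
      rw [hexp k hk]
      have h1 : ‖((Real.exp (-(z / k)) : ℝ) : ℂ)‖ ≤ 1 := by
        rw [Complex.norm_real, Real.norm_eq_abs, abs_of_pos (Real.exp_pos _)]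
        exact Real.exp_le_one_iff.2 (by linarith)
      refine (norm_pow_sub_pow_le (norm_charBirkhoff_le _ _ _ _ _) h1 k).trans ?_
      have hsk : 0 < √(k : ℝ) := Real.sqrt_pos.2 hk'
      -- on a block `τ S_l` has second moment `O (1 / k)` and fourth moment `O (1 / k²)`, so the
      -- parameter `√k` makes the two remainder terms equal in order
      have h2 := norm_charBirkhoff_sub_taylor_le hT hψ0 τ l hsk
      have hlk : (l : ℝ) / n ≤ 1 / k := by
        rw [div_le_div_iff₀ hn' hk', one_mul, mul_comm]
        exact_mod_cast hkl
      have h3 : τ ^ 2 * v l ≤ t ^ 2 * V * (1 / k) := by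
        calc τ ^ 2 * v l ≤ t ^ 2 / n * (V * l) := by rw [hτ2]; gcongr; exact hV l
          _ = t ^ 2 * V * (l / n) := by ring
          _ ≤ _ := by gcongr
      have h4 : τ ^ 4 * ∫ x, birkhoffSum T ψ l x ^ 4 ∂μ ≤ t ^ 4 * Q * (1 / k) ^ 2 := by
        calc τ ^ 4 * ∫ x, birkhoffSum T ψ l x ^ 4 ∂μ ≤ (t ^ 2 / n) ^ 2 * (Q * l ^ 2) := by
              rw [show τ ^ 4 = (τ ^ 2) ^ 2 by ring, hτ2]; gcongr; exact hQ l
          _ = t ^ 4 * Q * (l / n) ^ 2 := by ring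
          _ ≤ _ := by gcongr
      have h5 : 2 * (τ ^ 2 * v l / √k + √k * (τ ^ 4 * ∫ x, birkhoffSum T ψ l x ^ 4 ∂μ))
          ≤ B * (√(k : ℝ))⁻¹ * (k : ℝ)⁻¹ := by
        calc _ ≤ 2 * (t ^ 2 * V * (1 / k) / √k + √k * (t ^ 4 * Q * (1 / k) ^ 2)) := by gcongr
          _ = B * (√(k : ℝ))⁻¹ * (k : ℝ)⁻¹ := by
            rw [hB]
            field_simp
            rw [Real.sq_sqrt hk'.le]
            ring
      have h6 : ‖((1 - τ ^ 2 * v l / 2 : ℝ) : ℂ) - ((Real.exp (-(z / k)) : ℝ) : ℂ)‖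
          ≤ |τ ^ 2 * v l / 2 - z / k| + (z / k) ^ 2 := by
        rw [← Complex.ofReal_sub, Complex.norm_real, Real.norm_eq_abs]
        have h7 := abs_exp_neg_sub_le hz0
        have h8 : 1 - τ ^ 2 * v l / 2 - Real.exp (-(z / k))
            = -(τ ^ 2 * v l / 2 - z / k) - (Real.exp (-(z / k)) - (1 - z / k)) := by ring
        rw [h8]
        refine (abs_sub _ _).trans ?_
        rw [abs_neg]
        linarith
      have h9 := norm_sub_le_norm_sub_add_norm_sub (charBirkhoff T μ ψ τ l)
        ((1 - τ ^ 2 * v l / 2 : ℝ) : ℂ) ((Real.exp (-(z / k)) : ℝ) : ℂ)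
      calc (k : ℝ) * ‖charBirkhoff T μ ψ τ l - ((Real.exp (-(z / k)) : ℝ) : ℂ)‖
          ≤ k * (B * (√(k : ℝ))⁻¹ * (k : ℝ)⁻¹
            + (|τ ^ 2 * v l / 2 - z / k| + (z / k) ^ 2)) := by
            refine mul_le_mul_of_nonneg_left ?_ hk'.le
            linarith [h2.trans h5]
        _ = _ := by field_simp; ring
    have e4 := norm_sub_le_norm_sub_add_norm_sub (charBirkhoff T μ ψ τ n)
      (charBirkhoff T μ ψ τ (k * l)) ((Real.exp (-(1 / 2) * σ * t ^ 2) : ℝ) : ℂ)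
    have e5 := norm_sub_le_norm_sub_add_norm_sub (charBirkhoff T μ ψ τ (k * l))
      (charBirkhoff T μ ψ τ l ^ k) ((Real.exp (-(1 / 2) * σ * t ^ 2) : ℝ) : ℂ)
    linarith
  · filter_upwards [eventually_gt_atTop 0] with k hk
    have hk' : (0 : ℝ) < k := by exact_mod_cast hk
    have hsqrt : Tendsto (fun n : ℕ => √(n : ℝ)) atTop atTop :=
      Real.tendsto_sqrt_atTop.comp tendsto_natCast_atTop_atTop
    have l1 : Tendsto (fun n : ℕ => |t / √n| * √(V * k)) atTop (𝓝 0) := by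
      have := ((hsqrt.const_div_atTop t).abs).mul_const (√(V * k))
      simpa using this
    have l2 : Tendsto (fun n : ℕ => (t / √n) ^ 2 * v (n / k) / 2) atTop (𝓝 (z / k)) := by
      have hdiv : Tendsto (fun n : ℕ => n / k) atTop atTop :=
        Nat.tendsto_div_const_atTop hk.ne'
      have h1 : Tendsto (fun n : ℕ => ((n / k : ℕ) : ℝ)⁻¹ * v (n / k)) atTop (𝓝 σ) :=
        (hd.tendsto_integral_birkhoffSum_sq_div hT).comp hdiv
      have h2 : Tendsto (fun n : ℕ => ((n / k : ℕ) : ℝ) / n) atTop (𝓝 (k : ℝ)⁻¹) := by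
        have := (tendsto_nat_floor_mul_div_atTop (R := ℝ) (a := (k : ℝ)⁻¹)
          (by positivity)).comp tendsto_natCast_atTop_atTop
        refine this.congr fun n => ?_
        simp only [Function.comp]
        rw [inv_mul_eq_div, Nat.floor_div_natCast, Nat.floor_natCast]
      have h3 := (h1.mul h2).const_mul (t ^ 2 / 2)
      have h4 : t ^ 2 / 2 * (σ * (k : ℝ)⁻¹) = z / k := by rw [hz]; field_simp
      rw [h4] at h3
      refine h3.congr' ?_
      filter_upwards [eventually_ge_atTop k] with n hn
      have hn' : (0 : ℝ) < n := by exact_mod_cast lt_of_lt_of_le hk hn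
      have hl' : ((n / k : ℕ) : ℝ) ≠ 0 := by
        have := Nat.div_pos hn hk
        exact_mod_cast this.ne'
      rw [div_pow, Real.sq_sqrt hn'.le]
      field_simp
    have l3 := ((l2.sub_const (z / k)).abs).const_mul (k : ℝ)
    have := (l1.add (hE0.const_mul (k : ℝ))).add l3
    simpa using this
  · have l1 : Tendsto (fun k : ℕ => (√(k : ℝ))⁻¹) atTop (𝓝 0) :=
      (Real.tendsto_sqrt_atTop.comp tendsto_natCast_atTop_atTop).inv_tendsto_atTop
    have := (l1.const_mul B).add ((tendsto_inv_atTop_nhds_zero_nat (𝕜 := ℝ)).const_mul (z ^ 2))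
    simpa using this

end

/-! ### Lipschitz partitions of unity -/

section bump
variable {X : Type*} [MetricSpace X]

/-- The tent function `min 1 (2 - d(x, y) / ε)` cut off at `0`: it is `1` on the closed ball of
radius `ε` around `y` and `0` outside the ball of radius `2 ε`. -/
def tent (y : X) (ε : ℝ) (x : X) : ℝ := max 0 (min 1 (2 - dist x y / ε))

lemma continuous_tent (y : X) (ε : ℝ) : Continuous (tent y ε) := by unfold tent; fun_prop

lemma tent_nonneg (y : X) (ε : ℝ) (x : X) : 0 ≤ tent y ε x := le_max_left _ _

lemma tent_le_one (y : X) (ε : ℝ) (x : X) : tent y ε x ≤ 1 :=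
  max_le zero_le_one (min_le_left _ _)

lemma tent_eq_one {y x : X} {ε : ℝ} (hε : 0 < ε) (h : dist x y ≤ ε) : tent y ε x = 1 := by
  have h1 : dist x y / ε ≤ 1 := (div_le_one hε).2 h
  rw [tent, min_eq_left (by linarith), max_eq_right zero_le_one]

lemma dist_le_of_tent_ne_zero {y x : X} {ε : ℝ} (hε : 0 < ε) (h : tent y ε x ≠ 0) :
    dist x y ≤ 2 * ε := by
  by_contra! hlt
  apply h
  have h1 : 2 < dist x y / ε := (lt_div_iff₀ hε).2 hlt
  exact max_eq_left (min_le_of_right_le (by linarith))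

lemma abs_tent_sub_le {y : X} {ε : ℝ} (hε : 0 < ε) (x x' : X) :
    |tent y ε x - tent y ε x'| ≤ dist x x' / ε := by
  have h0 : 0 ≤ dist x x' / ε := by positivity
  refine (abs_max_sub_max_le_max _ _ _ _).trans (max_le (by simpa using h0) ?_)
  refine (abs_min_sub_min_le_max _ _ _ _).trans (max_le (by simpa using h0) ?_)
  have h1 : 2 - dist x y / ε - (2 - dist x' y / ε) = (dist x' y - dist x y) / ε := by ring
  rw [h1, abs_div, abs_of_pos hε]
  gcongr
  rw [dist_comm x x']
  exact abs_dist_sub_le x' x y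

/-- A function with values in an interval of length one that is `1 / ε`-Lipschitz is Hölder of every
exponent at most one, with constant `1 / ε` if `ε ≤ 1`. -/
lemma holderWith_of_abs_sub_le_div {f : X → ℝ} {ε : ℝ} (hε : 0 < ε) (hε1 : ε ≤ 1)
    (h1 : ∀ x x', |f x - f x'| ≤ 1) (h : ∀ x x', |f x - f x'| ≤ dist x x' / ε)
    {r H : ℝ≥0} (hr1 : r ≤ 1) (hH : 1 / ε ≤ H) : HolderWith H r f := by
  refine holderWith_of_dist_le fun x x' => ?_
  rw [Real.dist_eq]
  have hs : 0 ≤ dist x x' / ε := by positivity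
  have hr1' : (r : ℝ) ≤ 1 := by exact_mod_cast hr1
  have h2 : |f x - f x'| ≤ (dist x x' / ε) ^ (r : ℝ) := by
    rcases le_total (dist x x' / ε) 1 with hle | hle
    · refine (h x x').trans ?_
      conv_lhs => rw [← Real.rpow_one (dist x x' / ε)]
      exact Real.rpow_le_rpow_of_exponent_ge_of_imp hs hle hr1' (by intro _ h; simp at h)
    · exact (h1 x x').trans (Real.one_le_rpow hle r.coe_nonneg)
  refine h2.trans ?_
  rw [div_eq_inv_mul, Real.mul_rpow (by positivity) dist_nonneg]
  gcongr
  refine le_trans ?_ (by simpa using hH)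
  conv_rhs => rw [← Real.rpow_one ε⁻¹]
  exact Real.rpow_le_rpow_of_exponent_le ((one_le_inv₀ hε).2 hε1) hr1'

/-- A partition of unity on `D` subordinate to the balls of radius `2 ε` around the points of `S`.
The `j`-th function is the product over `i` of the functions `f j i`, whose Hölder constants do not
depend on the number of balls. -/
lemma exists_partition {D : Set X} {S : Finset X} {ε : ℝ} (hε : 0 < ε) (hε1 : ε ≤ 1)
    (hS : ∀ x ∈ D, ∃ y ∈ S, dist x y ≤ ε) {r H : ℝ≥0} (hr1 : r ≤ 1) (hH : 1 / ε ≤ H) :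
    ∃ (y : Fin S.card → X) (f : Fin S.card → Fin S.card → (X →ᵇ ℝ)), (∀ j, y j ∈ S) ∧
      (∀ j i, ‖f j i‖ ≤ 1) ∧ (∀ j i, HolderWith H r (f j i)) ∧
      (∀ j x, 0 ≤ ∏ i, f j i x) ∧ (∀ x, ∑ j, ∏ i, f j i x ≤ 1) ∧
      (∀ x ∈ D, ∑ j, ∏ i, f j i x = 1) ∧
      (∀ j x, ∏ i, f j i x ≠ 0 → dist x (y j) ≤ 2 * ε) := by
  let e := S.equivFin.symm
  let y : Fin S.card → X := fun j => e j
  let u : Fin S.card → (X →ᵇ ℝ) := fun j =>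
    BoundedContinuousFunction.ofNormedAddCommGroup (tent (y j) ε) (continuous_tent _ _) 1
      fun x => by rw [Real.norm_eq_abs, abs_of_nonneg (tent_nonneg _ _ _)]; exact tent_le_one _ _ _
  let v : Fin S.card → (X →ᵇ ℝ) := fun j =>
    BoundedContinuousFunction.ofNormedAddCommGroup (fun x => 1 - tent (y j) ε x)
      (continuous_const.sub (continuous_tent _ _)) 1 fun x => by
        rw [Real.norm_eq_abs, abs_of_nonneg (sub_nonneg.2 (tent_le_one _ _ _))]
        linarith [tent_nonneg (y j) ε x]
  have hosc : ∀ j x x', |tent (y j) ε x - tent (y j) ε x'| ≤ 1 := fun j x x' => by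
    rw [abs_le]
    constructor <;> linarith [tent_nonneg (y j) ε x, tent_nonneg (y j) ε x',
      tent_le_one (y j) ε x, tent_le_one (y j) ε x']
  have hu : ∀ j, HolderWith H r (u j) := fun j =>
    holderWith_of_abs_sub_le_div hε hε1 (hosc j) (fun x x' => abs_tent_sub_le hε x x') hr1 hH
  have hv : ∀ j, HolderWith H r (v j) := fun j => by
    have h1 : ∀ x x', |v j x - v j x'| = |tent (y j) ε x - tent (y j) ε x'| := fun x x' => by
      have : v j x - v j x' = -(tent (y j) ε x - tent (y j) ε x') := by
        change (1 - tent (y j) ε x) - (1 - tent (y j) ε x') = _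
        ring
      rw [this, abs_neg]
    refine holderWith_of_abs_sub_le_div hε hε1 (fun x x' => ?_) (fun x x' => ?_) hr1 hH
    · rw [h1]; exact hosc j x x'
    · rw [h1]; exact abs_tent_sub_le hε x x'
  -- `∏ i, f j i = u j * ∏ i < j, (1 - u i)`, so that the sum over `j` telescopes
  let f : Fin S.card → Fin S.card → (X →ᵇ ℝ) := fun j i =>
    if i = j then u i else if i < j then v i else BoundedContinuousFunction.const X 1
  have hprod : ∀ j x, ∏ i, f j i x
      = tent (y j) ε x * ∏ i ∈ Finset.univ with i < j, (1 - tent (y i) ε x) := fun j x => by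
    have h1 : ∀ i, f j i x = (if i = j then tent (y i) ε x else 1)
        * (if i < j then 1 - tent (y i) ε x else 1) := fun i => by
      by_cases hij : i = j
      · subst hij; simp [f, u]
      · by_cases hlt : i < j <;> simp [f, hij, hlt, v]
    simp only [h1]
    rw [Finset.prod_mul_distrib, Finset.prod_ite_eq' Finset.univ j, Finset.prod_filter]
    simp
  have hsum : ∀ x, ∑ j, ∏ i, f j i x = 1 - ∏ i, (1 - tent (y i) ε x) := fun x => by
    rw [Finset.prod_one_sub_ordered]
    simp only [hprod]
    ring
  refine ⟨y, f, fun j => (e j).2, fun j i => ?_, fun j i => ?_, fun j x => ?_, fun x => ?_,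
    fun x hx => ?_, fun j x hx => ?_⟩
  · dsimp only [f]
    split_ifs
    · exact BoundedContinuousFunction.norm_ofNormedAddCommGroup_le _ zero_le_one _
    · exact BoundedContinuousFunction.norm_ofNormedAddCommGroup_le _ zero_le_one _
    · simpa using BoundedContinuousFunction.norm_const_le (α := X) (1 : ℝ)
  · dsimp only [f]
    split_ifs
    · exact hu i
    · exact hv i
    · intro x x'; simp
  · rw [hprod]
    exact mul_nonneg (tent_nonneg _ _ _) (Finset.prod_nonneg fun i _ =>
      sub_nonneg.2 (tent_le_one _ _ _))
  · rw [hsum]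
    have : 0 ≤ ∏ i, (1 - tent (y i) ε x) := Finset.prod_nonneg fun i _ =>
      sub_nonneg.2 (tent_le_one _ _ _)
    linarith
  · obtain ⟨z, hz, hxz⟩ := hS x hx
    rw [hsum, Finset.prod_eq_zero (Finset.mem_univ (e.symm ⟨z, hz⟩)), sub_zero]
    have : y (e.symm ⟨z, hz⟩) = z := by simp [y]
    rw [this, tent_eq_one hε hxz, sub_self]
  · rw [hprod] at hx
    exact dist_le_of_tent_ne_zero hε (left_ne_zero_of_mul hx)

end bump

/-! ### Decoupling the observable from the starting point -/

lemma abs_birkhoffSum_sub_le {X : Type*} [TopologicalSpace X] (T : X → X) (ψ ψ' : X →ᵇ ℝ) (n : ℕ)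
    (x : X) :
    |birkhoffSum T ψ n x - birkhoffSum T ψ' n x| ≤ n * dist ψ ψ' := by
  rw [birkhoffSum, birkhoffSum, ← Finset.sum_sub_distrib]
  refine (Finset.abs_sum_le_sum_abs _ _).trans ?_
  refine (Finset.sum_le_sum fun k _ => (BoundedContinuousFunction.dist_coe_le_dist
    (f := ψ) (g := ψ') (T^[k] x))).trans ?_
  simp

lemma norm_expBirkhoff_sub_le {X : Type*} [TopologicalSpace X] (T : X → X) (ψ ψ' : X →ᵇ ℝ)
    (τ : ℝ) (n : ℕ) (x : X) :
    ‖expBirkhoff T ψ τ n x - expBirkhoff T ψ' τ n x‖ ≤ |τ| * (n * dist ψ ψ') := by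
  refine (norm_exp_I_mul_sub_le _ _).trans ?_
  rw [← mul_sub, abs_mul]
  gcongr
  exact abs_birkhoffSum_sub_le T ψ ψ' n x

/-- Replacing a function `q` by its values `q' j` at the centres of a partition of unity on `D`. -/
lemma norm_integral_sub_sum_le {X : Type*} [MeasurableSpace X] {μ : Measure X}
    [IsProbabilityMeasure μ] {D : Set X} (hD : MeasurableSet D) {J : ℕ} {χ : Fin J → X → ℝ}
    (hχm : ∀ j, Measurable (χ j)) (hχ0 : ∀ j x, 0 ≤ χ j x) (hχ1 : ∀ x, ∑ j, χ j x ≤ 1)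
    (hχD : ∀ x ∈ D, ∑ j, χ j x = 1) {q : X → ℂ} {q' : Fin J → X → ℂ} (hq : Measurable q)
    (hq' : ∀ j, Measurable (q' j)) (hq1 : ∀ x, ‖q x‖ ≤ 1) (hq'1 : ∀ j x, ‖q' j x‖ ≤ 1) {κ : ℝ}
    (hκ : ∀ j x, χ j x ≠ 0 → ‖q x - q' j x‖ ≤ κ) (hκ0 : 0 ≤ κ) :
    ‖∫ x, q x ∂μ - ∑ j, ∫ x, (χ j x : ℂ) * q' j x ∂μ‖ ≤ κ + μ.real Dᶜ := by
  have hχle : ∀ j x, χ j x ≤ 1 := fun j x =>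
    (Finset.single_le_sum (fun i _ => hχ0 i x) (Finset.mem_univ j)).trans (hχ1 x)
  have hi : ∀ j, Integrable (fun x => (χ j x : ℂ) * q' j x) μ := fun j => by
    have := hχm j
    have := hq' j
    refine Integrable.of_bound (C := 1) (by fun_prop) (ae_of_all _ fun x => ?_)
    rw [norm_mul, Complex.norm_real, Real.norm_eq_abs, abs_of_nonneg (hχ0 j x)]
    exact mul_le_one₀ (hχle j x) (norm_nonneg _) (hq'1 j x)
  have hqi : Integrable q μ := Integrable.of_bound (C := 1) (by fun_prop) (ae_of_all _ hq1)
  rw [← integral_finsetSum _ fun j _ => hi j,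
    ← integral_sub hqi (integrable_finsetSum _ fun j _ => hi j)]
  have hb : Integrable (fun x => κ + Dᶜ.indicator (fun _ => (1 : ℝ)) x) μ :=
    (integrable_const _).add ((integrable_const _).indicator hD.compl)
  refine (norm_integral_le_of_norm_le hb (ae_of_all _ fun x => ?_)).trans (le_of_eq ?_)
  · have h1 : q x - ∑ j, (χ j x : ℂ) * q' j x
        = ((1 - ∑ j, χ j x : ℝ) : ℂ) * q x + ∑ j, (χ j x : ℂ) * (q x - q' j x) := by
      push_cast
      simp only [mul_sub, Finset.sum_sub_distrib, sub_mul, Finset.sum_mul]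
      ring
    rw [h1]
    refine (norm_add_le _ _).trans ?_
    rw [add_comm]
    refine add_le_add ?_ ?_
    · calc ‖∑ j, (χ j x : ℂ) * (q x - q' j x)‖ ≤ ∑ j, χ j x * κ := by
            refine (norm_sum_le _ _).trans (Finset.sum_le_sum fun j _ => ?_)
            rw [norm_mul, Complex.norm_real, Real.norm_eq_abs, abs_of_nonneg (hχ0 j x)]
            by_cases h0 : χ j x = 0
            · simp [h0]
            · exact mul_le_mul_of_nonneg_left (hκ j x h0) (hχ0 j x)
        _ ≤ κ := by
            rw [← Finset.sum_mul]
            exact mul_le_of_le_one_left hκ0 (hχ1 x)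
    · rw [norm_mul, Complex.norm_real, Real.norm_eq_abs, abs_of_nonneg (sub_nonneg.2 (hχ1 x))]
      by_cases hx : x ∈ D
      · simp [hχD x hx, hx]
      · have h0 : 0 ≤ ∑ j, χ j x := Finset.sum_nonneg fun j _ => hχ0 j x
        rw [Set.indicator_of_mem (show x ∈ Dᶜ from hx)]
        exact mul_le_one₀ (by linarith) (norm_nonneg _) (hq1 x)
  · rw [integral_add (integrable_const _) ((integrable_const _).indicator hD.compl),
      integral_indicator_const _ hD.compl]
    simp

section
variable {X : Type*} [MetricSpace X] [MeasurableSpace X] [BorelSpace X]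
  {T : X → X} {μ : Measure X} [IsProbabilityMeasure μ]

/-- Joint measurability, in the parameter of the observable and in the point. -/
lemma measurable_expBirkhoff_diag [SecondCountableTopology X] (hT : Measurable T)
    {Ψ : X → (X →ᵇ ℝ)} (hΨ : Continuous Ψ) (τ : ℝ) (n a : ℕ) :
    Measurable fun x => expBirkhoff T (Ψ x) τ n (T^[a] x) := by
  have h1 : Continuous fun q : X × X => Ψ q.1 q.2 := by fun_prop
  have h2 : ∀ k, Measurable fun x => Ψ x (T^[k] (T^[a] x)) := fun k =>
    h1.measurable.comp (measurable_id.prodMk ((hT.iterate k).comp (hT.iterate a)))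
  have h3 : Measurable fun x => birkhoffSum T (Ψ x) n (T^[a] x) :=
    Finset.measurable_fun_sum _ fun k _ => h2 k
  unfold expBirkhoff
  fun_prop

lemma norm_charBirkhoff_sub_le (hT : Measurable T) (ψ ψ' : X →ᵇ ℝ) (τ : ℝ) (n : ℕ) :
    ‖charBirkhoff T μ ψ τ n - charBirkhoff T μ ψ' τ n‖ ≤ |τ| * (n * dist ψ ψ') := by
  have hi : ∀ ψ : X →ᵇ ℝ, Integrable (expBirkhoff T ψ τ n) μ := fun ψ =>
    Integrable.of_bound (measurable_expBirkhoff hT ψ τ n).aestronglyMeasurable 1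
      (ae_of_all _ fun x => (norm_expBirkhoff T ψ τ n x).le)
  rw [charBirkhoff, charBirkhoff, ← integral_sub (hi _) (hi _)]
  refine (norm_integral_le_of_norm_le_const (ae_of_all _ fun x =>
    norm_expBirkhoff_sub_le T ψ ψ' τ n x)).trans (by simp)

lemma continuous_charBirkhoff (hT : Measurable T) {Ψ : X → (X →ᵇ ℝ)} (hΨ : Continuous Ψ) (τ : ℝ)
    (n : ℕ) : Continuous fun x => charBirkhoff T μ (Ψ x) τ n := by
  have h : LipschitzWith (‖τ‖₊ * n) fun ψ : X →ᵇ ℝ => charBirkhoff T μ ψ τ n :=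
    LipschitzWith.of_dist_le_mul fun ψ ψ' => by
      rw [dist_eq_norm]
      refine (norm_charBirkhoff_sub_le hT ψ ψ' τ n).trans (le_of_eq ?_)
      push_cast
      rw [Real.norm_eq_abs, mul_assoc]
  exact h.continuous.comp hΨ

/-- Diagonal decoupling on a set `D` covered by finitely many small balls. After time `a` the
dependence of the observable on the starting point is forgotten: freezing the observable at the
centres of a partition of unity turns the diagonal integral into a sum of correlations between
functions of the starting point and exponentials of Birkhoff sums. -/
lemma DecorrelationRate.norm_integral_diag_sub_le [SecondCountableTopology X] {r : ℝ≥0} {C δ : ℝ}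
    (h : DecorrelationRate T μ r C δ) (hr1 : r ≤ 1) (hT : MeasurePreserving T μ μ)
    {Ψ : X → (X →ᵇ ℝ)} (hΨ : Continuous Ψ) {D : Set X} (hD : MeasurableSet D) {L M H : ℝ≥0}
    (hL : ∀ x ∈ D, HolderWith L r (Ψ x)) (hM : ∀ x, ‖Ψ x‖ ≤ M) (hM1 : 1 ≤ M) (τ : ℝ)
    {S : Finset X} (hSD : ∀ y ∈ S, y ∈ D) {ε osc : ℝ} (hε : 0 < ε) (hε1 : ε ≤ 1)
    (hS : ∀ x ∈ D, ∃ y ∈ S, dist x y ≤ ε) (hosc0 : 0 ≤ osc)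
    (hosc : ∀ x y, dist x y ≤ 2 * ε → dist (Ψ x) (Ψ y) ≤ osc)
    (hLH : L ≤ H) (hτH : ‖τ‖₊ * L ≤ H) (hεH : 1 / ε ≤ H) {a n : ℕ} (ha : 0 < a) :
    ‖∫ x, expBirkhoff T (Ψ x) τ n (T^[a] x) ∂μ - ∫ x, charBirkhoff T μ (Ψ x) τ n ∂μ‖
      ≤ 2 * (|τ| * (n * osc) + μ.real Dᶜ)
        + S.card * (C * (1 + (S.card + n + 1) * H) * (1 + |τ| * M) ^ n * δ ^ a) := by
  obtain ⟨y, f, hyS, hf1, hfH, hχ0, hχ1, hχD, hχy⟩ := exists_partition hε hε1 hS hr1 hεH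
  set χ : Fin S.card → X → ℝ := fun j x => ∏ i, f j i x with hχ
  have hχm : ∀ j, Measurable (χ j) := fun j =>
    Finset.measurable_fun_prod _ fun i _ => (f j i).continuous.measurable
  have hκ0 : 0 ≤ |τ| * (n * osc) := by positivity
  have h1 := norm_integral_sub_sum_le (μ := μ) hD hχm hχ0 hχ1 hχD
    (q := fun x => expBirkhoff T (Ψ x) τ n (T^[a] x))
    (q' := fun j x => expBirkhoff T (Ψ (y j)) τ n (T^[a] x)) (κ := |τ| * (n * osc))
    (measurable_expBirkhoff_diag hT.measurable hΨ τ n a)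
    (fun j => (measurable_expBirkhoff hT.measurable _ τ n).comp (hT.measurable.iterate a))
    (fun x => (norm_expBirkhoff _ _ _ _ _).le) (fun j x => (norm_expBirkhoff _ _ _ _ _).le)
    (fun j x hx => (norm_expBirkhoff_sub_le T _ _ τ n _).trans (by
      gcongr; exact hosc _ _ (hχy j x hx))) hκ0
  have h2 := norm_integral_sub_sum_le (μ := μ) hD hχm hχ0 hχ1 hχD
    (q := fun x => charBirkhoff T μ (Ψ x) τ n)
    (q' := fun j _ => charBirkhoff T μ (Ψ (y j)) τ n) (κ := |τ| * (n * osc))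
    (continuous_charBirkhoff hT.measurable hΨ τ n).measurable (fun j => measurable_const)
    (fun x => norm_charBirkhoff_le _ _ _ _ _) (fun j x => norm_charBirkhoff_le _ _ _ _ _)
    (fun j x hx => (norm_charBirkhoff_sub_le hT.measurable _ _ τ n).trans (by
      gcongr; exact hosc _ _ (hχy j x hx))) hκ0
  have h3 : ∀ j, ‖∫ x, (χ j x : ℂ) * expBirkhoff T (Ψ (y j)) τ n (T^[a] x) ∂μ
      - ∫ x, (χ j x : ℂ) * charBirkhoff T μ (Ψ (y j)) τ n ∂μ‖
      ≤ C * (1 + (S.card + n + 1) * H) * (1 + |τ| * M) ^ n * δ ^ a := fun j => by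
    -- the real factors `f j i`, all at time `0`, have imaginary part `0`
    have h4 := h.norm_expBirkhoff_le hT (hL (y j) (hSD _ (hyS j))) (hM _) hM1 τ
      (fun (i : Fin S.card) c => if c then f j i else 0) (fun _ => 0) 0 a n ha (fun _ => le_rfl)
      (fun _ c => if c then 1 else 0) H (fun i c => by cases c <;> simp [hf1])
      (fun i c => by
        cases c
        · intro x x'; simp
        · simpa using hfH j i) hLH hτH (fun x => (χ j x : ℂ))
      (fun x => by simp [hχ])
    rw [integral_mul_const]
    refine (le_of_eq ?_).trans (h4.trans (le_of_eq ?_))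
    · simp [charBirkhoff]
    · simp
  have h5 : ‖∑ j, ∫ x, (χ j x : ℂ) * expBirkhoff T (Ψ (y j)) τ n (T^[a] x) ∂μ
      - ∑ j, ∫ x, (χ j x : ℂ) * charBirkhoff T μ (Ψ (y j)) τ n ∂μ‖
      ≤ S.card * (C * (1 + (S.card + n + 1) * H) * (1 + |τ| * M) ^ n * δ ^ a) := by
    rw [← Finset.sum_sub_distrib]
    refine (norm_sum_le _ _).trans ((Finset.sum_le_sum fun j _ => h3 j).trans ?_)
    simp
  have h6 := norm_sub_le_norm_sub_add_norm_sub
    (∫ x, expBirkhoff T (Ψ x) τ n (T^[a] x) ∂μ)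
    (∑ j, ∫ x, (χ j x : ℂ) * expBirkhoff T (Ψ (y j)) τ n (T^[a] x) ∂μ)
    (∫ x, charBirkhoff T μ (Ψ x) τ n ∂μ)
  have h7 := norm_sub_le_norm_sub_add_norm_sub
    (∑ j, ∫ x, (χ j x : ℂ) * expBirkhoff T (Ψ (y j)) τ n (T^[a] x) ∂μ)
    (∑ j, ∫ x, (χ j x : ℂ) * charBirkhoff T μ (Ψ (y j)) τ n ∂μ)
    (∫ x, charBirkhoff T μ (Ψ x) τ n ∂μ)
  rw [norm_sub_rev] at h2
  linarith

end

lemma isClosed_setOf_holderWith {X : Type*} [MetricSpace X] {Ψ : X → (X →ᵇ ℝ)}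
    (hΨ : Continuous Ψ) (L r : ℝ≥0) :
    IsClosed {x | HolderWith L r (Ψ x)} := by
  have h : {x | HolderWith L r (Ψ x)}
      = ⋂ y, ⋂ z, {x | edist (Ψ x y) (Ψ x z) ≤ (L : ENNReal) * edist y z ^ (r : ℝ)} := by
    ext x; simp [HolderWith]
  rw [h]
  refine isClosed_iInter fun y => isClosed_iInter fun z => isClosed_le ?_ continuous_const
  fun_prop

section
variable {X : Type*} [MetricSpace X] [MeasurableSpace X] [BorelSpace X] [SecondCountableTopology X]
  {T : X → X} {μ : Measure X} [IsProbabilityMeasure μ]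

/-- Diagonal decoupling on a fixed polynomially covered set `D` on which the observables are
uniformly Hölder. The mesh of the cover is a large negative power of `n`, so that freezing the
observable is harmless even after summation along the orbit, while the number of balls stays
polynomial and is beaten by `δ ^ ⌈n ^ α⌉`. -/
lemma DecorrelationRate.exists_tendsto_diag_error {r : ℝ≥0} {C δ : ℝ}
    (h : DecorrelationRate T μ r C δ) (hr1 : r ≤ 1) (hT : MeasurePreserving T μ μ)
    {Ψ : X → (X →ᵇ ℝ)} (hΨc : Continuous Ψ) {c η : ℝ} (hc : 0 ≤ c) (hη : 0 < η)
    (hΨ : ∀ x y, dist (Ψ x) (Ψ y) ≤ c * dist x y ^ η) {D : Set X} (hD : MeasurableSet D)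
    (hDp : PolynomiallyCovered D) {L M : ℝ≥0}
    (hL : ∀ x ∈ D, HolderWith L r (Ψ x)) (hM : ∀ x, ‖Ψ x‖ ≤ M) (hM1 : 1 ≤ M) (t : ℝ)
    {α β b : ℝ} (hα : 0 < α) (hβ : β < α) {m : ℕ → ℕ} (hmn : ∀ n, m n ≤ n)
    (hm : ∀ n : ℕ, 0 < n → (m n : ℝ) ≤ b * (n : ℝ) ^ β * √n) :
    ∃ R : ℕ → ℝ, Tendsto R atTop (𝓝 0) ∧ ∀ᶠ n : ℕ in atTop,
      ‖∫ x, expBirkhoff T (Ψ x) (t / √n) (m n) (T^[⌈(n : ℝ) ^ α⌉₊] x) ∂μ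
        - ∫ x, charBirkhoff T μ (Ψ x) (t / √n) (m n) ∂μ‖ ≤ R n + 2 * μ.real Dᶜ := by
  obtain ⟨C', D', hcov⟩ := hDp.exists_centers_mem
  -- balls of radius `n ^ (-e)` make the oscillation of `Ψ` of order `1 / n`
  set e : ℕ := ⌈1 / η⌉₊ with he
  have heη : 1 ≤ e * η := by
    have := Nat.le_ceil (1 / η)
    rwa [div_le_iff₀ hη] at this
  set L' : ℝ≥0 := (1 + ‖t‖₊) * L with hL'
  have hC := h.const_pos
  have hδ := h.rate_pos
  set Q : ℕ := e * D' + (e * D' + 1 + e) with hQ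
  set K : ℝ := C' * (C * (1 + (C' + 2) * (1 + L'))) with hK
  refine ⟨fun n => 2 * (|t| * (c * 2 ^ η) * (√(n : ℝ))⁻¹) + K * ((n : ℝ) ^ Q *
    Real.exp (|t| * M * b * (n : ℝ) ^ β) * δ ^ ⌈(n : ℝ) ^ α⌉₊), ?_, ?_⟩
  · have h1 : Tendsto (fun n : ℕ => (√(n : ℝ))⁻¹) atTop (𝓝 0) :=
      (Real.tendsto_sqrt_atTop.comp tendsto_natCast_atTop_atTop).inv_tendsto_atTop
    have h2 := tendsto_pow_mul_exp_mul_pow_ceil hδ h.rate_lt_one Q (|t| * M * b) hα hβ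
    have := ((h1.const_mul (|t| * (c * 2 ^ η))).const_mul 2).add (h2.const_mul K)
    simpa using this
  · filter_upwards [eventually_gt_atTop 0] with n hn
    have hn' : (0 : ℝ) < n := by exact_mod_cast hn
    have hn1 : (1 : ℝ) ≤ n := by exact_mod_cast hn
    have hsn : (0 : ℝ) < √n := Real.sqrt_pos.2 hn'
    obtain ⟨S, hSD, hScard, hS⟩ := hcov (n ^ e) (by positivity)
    set τ := t / √n with hτ
    set ε : ℝ := 1 / (n ^ e : ℕ) with hε
    have hε0 : 0 < ε := by positivity
    have hε1 : ε ≤ 1 := by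
      rw [hε, div_le_one (by positivity)]
      exact_mod_cast Nat.one_le_pow _ _ hn
    set H : ℝ≥0 := (n : ℝ≥0) ^ e + L' with hH
    have hLL' : L ≤ L' := le_mul_of_one_le_left' (by simp)
    have hτt : ‖τ‖₊ ≤ ‖t‖₊ := by
      have : |τ| ≤ |t| := by
        rw [hτ, abs_div, abs_of_pos hsn]
        exact div_le_self (abs_nonneg _) (Real.one_le_sqrt.2 hn1)
      exact this
    have hτL : ‖τ‖₊ * L ≤ L' := by
      rw [hL']
      gcongr
      exact hτt.trans (by simp)
    have hεη : (2 * ε) ^ η ≤ 2 ^ η * (n : ℝ)⁻¹ := by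
      rw [Real.mul_rpow (by norm_num) hε0.le]
      gcongr
      rw [hε, one_div, Nat.cast_pow, Real.inv_rpow (by positivity), ← Real.rpow_natCast,
        ← Real.rpow_mul hn'.le]
      gcongr
      conv_lhs => rw [← Real.rpow_one (n : ℝ)]
      exact Real.rpow_le_rpow_of_exponent_le hn1 heη
    have ha : 0 < ⌈(n : ℝ) ^ α⌉₊ := Nat.ceil_pos.2 (by positivity)
    have key := h.norm_integral_diag_sub_le hr1 hT hΨc hD hL hM hM1 τ hSD hε0 hε1 hS
      (osc := c * (2 ^ η * (n : ℝ)⁻¹)) (H := H) (by positivity)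
      (fun x y hxy => (hΨ x y).trans (by
        gcongr
        exact (Real.rpow_le_rpow dist_nonneg hxy hη.le).trans hεη))
      (hLL'.trans le_add_self) (hτL.trans le_add_self) (by
        rw [hε, one_div_one_div, hH]; push_cast; simp) (n := m n) ha
    refine key.trans ?_
    have e1 : |τ| * (m n * (c * (2 ^ η * (n : ℝ)⁻¹))) ≤ |t| * (c * 2 ^ η) * (√(n : ℝ))⁻¹ := by
      rw [hτ, abs_div, abs_of_pos hsn]
      calc |t| / √n * (m n * (c * (2 ^ η * (n : ℝ)⁻¹)))
          ≤ |t| / √n * (n * (c * (2 ^ η * (n : ℝ)⁻¹))) := by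
            gcongr; exact_mod_cast hmn n
        _ = _ := by field_simp
    have hScard' : (S.card : ℝ) ≤ C' * n ^ (e * D') := by
      rw [pow_mul]; exact_mod_cast hScard
    have hexp : (1 + |τ| * M) ^ m n ≤ Real.exp (|t| * M * (b * (n : ℝ) ^ β)) :=
      one_add_div_sqrt_mul_pow_le t M n (hm n hn) hn
    have e2 : 1 + ((S.card : ℝ) + m n + 1) * H
        ≤ (1 + (C' + 2) * (1 + L')) * n ^ (e * D' + 1 + e) := by
      have f1 : (S.card : ℝ) + m n + 1 ≤ (C' + 2) * n ^ (e * D' + 1) := by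
        have g1 : (n : ℝ) ^ (e * D') ≤ n ^ (e * D' + 1) := pow_le_pow_right₀ hn1 (by omega)
        have g2 : (m n : ℝ) ≤ n ^ (e * D' + 1) := by
          calc (m n : ℝ) ≤ n := by exact_mod_cast hmn n
            _ = (n : ℝ) ^ 1 := (pow_one _).symm
            _ ≤ _ := pow_le_pow_right₀ hn1 (by omega)
        have g3 : (1 : ℝ) ≤ n ^ (e * D' + 1) := one_le_pow₀ hn1
        have g4 : (C' : ℝ) * n ^ (e * D') ≤ C' * n ^ (e * D' + 1) := by gcongr
        linarith
      have f2 : (H : ℝ) ≤ (1 + L') * n ^ e := by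
        have g3 : (1 : ℝ) ≤ n ^ e := one_le_pow₀ hn1
        rw [hH]; push_cast
        nlinarith [L'.coe_nonneg]
      have f3 : (1 : ℝ) ≤ n ^ (e * D' + 1 + e) := one_le_pow₀ hn1
      calc 1 + ((S.card : ℝ) + m n + 1) * H
          ≤ n ^ (e * D' + 1 + e) + (C' + 2) * n ^ (e * D' + 1) * ((1 + L') * n ^ e) := by gcongr
        _ = _ := by ring
    have e3 : S.card * (C * (1 + (S.card + m n + 1) * H) * (1 + |τ| * M) ^ m n
        * δ ^ ⌈(n : ℝ) ^ α⌉₊) ≤ K * ((n : ℝ) ^ Q *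
        Real.exp (|t| * M * b * (n : ℝ) ^ β) * δ ^ ⌈(n : ℝ) ^ α⌉₊) := by
      calc _ ≤ C' * n ^ (e * D') * (C * ((1 + (C' + 2) * (1 + L')) * n ^ (e * D' + 1 + e))
            * Real.exp (|t| * M * (b * (n : ℝ) ^ β)) * δ ^ ⌈(n : ℝ) ^ α⌉₊) := by gcongr
        _ = _ := by
          rw [hK, hQ, pow_add _ (e * D') (e * D' + 1 + e), ← mul_assoc (|t| * (M : ℝ)) b]
          ring
    linarith

/-- **Diagonal decoupling.** The observable may depend on the starting point: after time
`⌈n ^ α⌉` this dependence is asymptotically forgotten. The Hölder exponents and constants of the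
observables need not be bounded: the points where they are bad have small measure. -/
theorem MultipleDecorrelation.tendsto_diag_sub (hdec : MultipleDecorrelation T μ)
    (hT : MeasurePreserving T μ μ) {V : ℕ → Set X} (hVo : ∀ N, IsOpen (V N)) (hVm : Monotone V)
    (hVu : (⋃ N, V N) = Set.univ) (hVp : ∀ N, PolynomiallyCovered (V N))
    {Ψ : X → (X →ᵇ ℝ)} (hΨc : Continuous Ψ) {c η : ℝ} (hc : 0 ≤ c) (hη : 0 < η)
    (hΨ : ∀ x y, dist (Ψ x) (Ψ y) ≤ c * dist x y ^ η)
    (hHol : ∀ x, ∃ r : ℝ≥0, 0 < r ∧ MemHolder r (Ψ x)) {M : ℝ≥0} (hM : ∀ x, ‖Ψ x‖ ≤ M)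
    (hM1 : 1 ≤ M) (t : ℝ) {α β b : ℝ} (hα : 0 < α) (hβ : β < α) {m : ℕ → ℕ} (hmn : ∀ n, m n ≤ n)
    (hm : ∀ n : ℕ, 0 < n → (m n : ℝ) ≤ b * (n : ℝ) ^ β * √n) :
    Tendsto (fun n : ℕ => ∫ x, expBirkhoff T (Ψ x) (t / √n) (m n) (T^[⌈(n : ℝ) ^ α⌉₊] x) ∂μ
        - ∫ x, charBirkhoff T μ (Ψ x) (t / √n) (m n) ∂μ) atTop (𝓝 0) := by
  -- the points with Hölder exponent `1 / (N + 1)` and Hölder constant `N`, in the `N`-th set `V N`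
  set D : ℕ → Set X := fun N => {x | HolderWith N (1 / (N + 1)) (Ψ x)} ∩ V N with hDdef
  have hDm : ∀ N, MeasurableSet (D N) := fun N =>
    (isClosed_setOf_holderWith hΨc _ _).measurableSet.inter (hVo N).measurableSet
  have hDev : ∀ x, ∀ᶠ N in atTop, x ∈ D N := fun x => by
    obtain ⟨r, hr, L, hL⟩ := hHol x
    obtain ⟨N₀, hN₀⟩ := Set.mem_iUnion.1 (hVu.symm ▸ Set.mem_univ x : x ∈ ⋃ N, V N)
    obtain ⟨N₁, hN₁⟩ := exists_nat_ge (L + 2 * M)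
    obtain ⟨N₂, hN₂⟩ := exists_nat_ge (1 / r)
    filter_upwards [eventually_ge_atTop (max N₀ (max N₁ N₂))] with N hN
    have hN0 : N₀ ≤ N := (le_max_left _ _).trans hN
    have hN1 : N₁ ≤ N := ((le_max_left _ _).trans (le_max_right _ _)).trans hN
    have hN2 : N₂ ≤ N := ((le_max_right _ _).trans (le_max_right _ _)).trans hN
    refine ⟨?_, hVm hN0 hN₀⟩
    have h1 : (1 : ℝ≥0) / (N + 1) ≤ r := by
      rw [div_le_iff₀ hr] at hN₂
      rw [div_le_iff₀ (by positivity), mul_comm]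
      refine hN₂.trans ?_
      gcongr
      exact (Nat.cast_le.2 hN2).trans (le_add_of_nonneg_right zero_le_one)
    have h2 : L + 2 * M ≤ N := hN₁.trans (Nat.cast_le.2 hN1)
    intro y z
    refine (HolderWith.of_exponent_le hL (hM x) h1 y z).trans ?_
    gcongr
  have hμD : Tendsto (fun N => 2 * μ.real (D N)ᶜ) atTop (𝓝 0) := by
    have h1 : ∀ N, μ.real (D N)ᶜ = ∫ x, (D N)ᶜ.indicator (fun _ => (1 : ℝ)) x ∂μ := fun N => by
      rw [integral_indicator_const _ (hDm N).compl]; simp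
    have h2 : Tendsto (fun N => ∫ x, (D N)ᶜ.indicator (fun _ => (1 : ℝ)) x ∂μ) atTop
        (𝓝 (∫ _, (0 : ℝ) ∂μ)) := by
      refine tendsto_integral_of_dominated_convergence (fun _ => 1)
        (fun N => (measurable_const.indicator (hDm N).compl).aestronglyMeasurable)
        (integrable_const _) (fun N => ae_of_all _ fun x => ?_) (ae_of_all _ fun x => ?_)
      · by_cases hx : x ∈ (D N)ᶜ <;> simp [Set.indicator, hx]
      · refine tendsto_const_nhds.congr' ?_
        filter_upwards [hDev x] with N hN
        rw [Set.indicator_of_notMem (by simpa using hN)]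
    simp only [h1]
    simpa using h2.const_mul 2
  have hN : ∀ N, ∃ R : ℕ → ℝ, Tendsto R atTop (𝓝 0) ∧ ∀ᶠ n : ℕ in atTop,
      ‖∫ x, expBirkhoff T (Ψ x) (t / √n) (m n) (T^[⌈(n : ℝ) ^ α⌉₊] x) ∂μ
        - ∫ x, charBirkhoff T μ (Ψ x) (t / √n) (m n) ∂μ‖ ≤ R n + 2 * μ.real (D N)ᶜ := fun N => by
    have hr1 : (1 : ℝ≥0) / (N + 1) ≤ 1 := by
      rw [div_le_one (by positivity)]; exact le_add_of_nonneg_left (zero_le)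
    obtain ⟨C, δ, h⟩ := hdec.exists_decorrelationRate hT.measurable
      (η := 1 / (N + 1)) (by positivity) hr1
    exact h.exists_tendsto_diag_error hr1 hT hΨc hc hη hΨ (hDm N)
      ((hVp N).mono Set.inter_subset_right) (L := N) (fun x hx => hx.1) hM hM1 t hα hβ hmn hm
  choose R hR hRle using hN
  rw [tendsto_zero_iff_norm_tendsto_zero]
  exact tendsto_zero_of_forall_le_add (fun _ => norm_nonneg _)
    (Eventually.of_forall hRle) (Eventually.of_forall hR) hμD

end

/-! ### The limit theorem on the diagonal -/

/-- A unimodular factor whose mean is close to `1` can be dropped. -/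
lemma norm_integral_mul_sub_le_sqrt {X : Type*} [MeasurableSpace X] {μ : Measure X}
    [IsProbabilityMeasure μ] {A B : X → ℂ} (hA : Measurable A) (hB : Measurable B)
    (hA1 : ∀ x, ‖A x‖ = 1) (hB1 : ∀ x, ‖B x‖ = 1) :
    ‖∫ x, A x * B x ∂μ - ∫ x, B x ∂μ‖ ≤ √(2 * ‖∫ x, A x ∂μ - 1‖) := by
  have hiA : Integrable A μ := Integrable.of_bound hA.aestronglyMeasurable 1
    (ae_of_all _ fun x => (hA1 x).le)
  have hiB : Integrable B μ := Integrable.of_bound hB.aestronglyMeasurable 1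
    (ae_of_all _ fun x => (hB1 x).le)
  have hiAB : Integrable (fun x => A x * B x) μ :=
    Integrable.of_bound (hA.mul hB).aestronglyMeasurable 1
      (ae_of_all _ fun x => by simp [hA1, hB1])
  have hm : Measurable fun x => ‖A x - 1‖ := by fun_prop
  have h2 : ∀ x, ‖A x - 1‖ ≤ 2 := fun x => by
    have := norm_sub_le (A x) 1
    rw [hA1, norm_one] at this
    linarith
  have h3 : ∀ x, ‖A x - 1‖ ^ 2 = 2 * (1 - A x).re := fun x => by
    have h4 : Complex.normSq (A x) = 1 := by rw [Complex.normSq_eq_norm_sq, hA1, one_pow]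
    rw [← Complex.normSq_eq_norm_sq, Complex.normSq_sub, h4]
    simp
    ring
  have hb : ∀ x, |‖A x - 1‖| ≤ 2 := fun x => by rw [abs_norm]; exact h2 x
  calc _ ≤ ∫ x, |‖A x - 1‖| ∂μ := by
        rw [← integral_sub hiAB hiB]
        refine norm_integral_le_of_norm_le (integrable_of_abs_le hm.abs (C := 2) fun x => ?_)
          (ae_of_all _ fun x => ?_)
        · rw [abs_abs]; exact hb x
        · rw [← sub_one_mul, norm_mul, hB1, mul_one, abs_norm]
    _ ≤ √(∫ x, ‖A x - 1‖ ^ 2 ∂μ) := integral_abs_le_sqrt hm hb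
    _ ≤ _ := by
        refine Real.sqrt_le_sqrt ?_
        have h5 : ∫ x, (1 - A x).re ∂μ = (∫ x, (1 - A x) ∂μ).re :=
          integral_re ((integrable_const 1).sub hiA)
        simp only [h3]
        rw [integral_const_mul, h5, integral_sub (integrable_const 1) hiA, norm_sub_rev]
        simpa using Complex.re_le_norm (1 - ∫ x, A x ∂μ)

section
variable {X : Type*} [MetricSpace X] [MeasurableSpace X] [BorelSpace X]
  {T : X → X} {μ : Measure X} [IsProbabilityMeasure μ]

/-- Blocks of length `o(n)` are negligible in a Birkhoff sum of length `n` normalized by `√n`. -/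
lemma CorrelationDecay.tendsto_abs_mul_sqrt_integral_sq {ψ : X →ᵇ ℝ} {K ρ : ℝ}
    (h : CorrelationDecay T μ ψ K ρ) (hT : MeasurePreserving T μ μ) (t : ℝ) {p : ℕ → ℕ}
    (hp : Tendsto (fun n => (p n : ℝ) / n) atTop (𝓝 0)) :
    Tendsto (fun n : ℕ => |t / √n| * √(∫ x, birkhoffSum T ψ (p n) x ^ 2 ∂μ)) atTop (𝓝 0) := by
  have h1 := (hp.const_mul (K * (1 + 2 / (1 - ρ)))).sqrt.const_mul |t|
  simp only [mul_zero, Real.sqrt_zero] at h1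
  refine squeeze_zero (fun n => by positivity) (fun n => ?_) h1
  rw [abs_div, abs_of_nonneg (Real.sqrt_nonneg _), ← mul_div_assoc, Real.sqrt_div' _ n.cast_nonneg,
    div_mul_eq_mul_div, mul_div_assoc]
  gcongr
  exact h.integral_birkhoffSum_sq_le hT _

lemma MultipleDecorrelation.exists_decorrelationRate_of_memHolder
    (hdec : MultipleDecorrelation T μ) (hT : Measurable T) {ψ : X →ᵇ ℝ} {r : ℝ≥0} (hr : 0 < r)
    (hψ : MemHolder r ψ) :
    ∃ (s L : ℝ≥0) (C δ : ℝ), DecorrelationRate T μ s C δ ∧ HolderWith L s ψ := by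
  obtain ⟨L, hL⟩ := hψ
  obtain ⟨C, δ, h⟩ := hdec.exists_decorrelationRate hT (η := min r 1) (lt_min hr one_pos)
    (min_le_right _ _)
  exact ⟨_, _, C, δ, h, HolderWith.of_exponent_le (M := ‖ψ‖₊) hL le_rfl (min_le_left _ _)⟩

lemma continuous_lagCovariance (hT : Measurable T) {Ψ : X → (X →ᵇ ℝ)} (hΨ : Continuous Ψ) {M : ℝ}
    (hM : ∀ x, ‖Ψ x‖ ≤ M) (k : ℕ) : Continuous fun x => lagCovariance T μ (Ψ x) k := by
  refine continuous_of_dominated (bound := fun _ => M * M) (fun x => ?_) (fun x => ?_)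
    (integrable_const _) (ae_of_all _ fun _ => by fun_prop)
  · exact (integrable_mul_comp_iterate hT (Ψ x) (Ψ x) 0 (k + 1)).aestronglyMeasurable
  · refine ae_of_all _ fun y => ?_
    rw [norm_mul]
    exact mul_le_mul (((Ψ x).norm_coe_le_norm _).trans (hM x))
      (((Ψ x).norm_coe_le_norm _).trans (hM x)) (norm_nonneg _) ((norm_nonneg _).trans (hM x))

lemma measurable_asymptoticVariance (hT : Measurable T) {Ψ : X → (X →ᵇ ℝ)} (hΨ : Continuous Ψ)
    {M : ℝ} (hM : ∀ x, ‖Ψ x‖ ≤ M) (hs : ∀ x, Summable (lagCovariance T μ (Ψ x))) :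
    Measurable fun x => asymptoticVariance T μ (Ψ x) := by
  have h1 : Continuous fun x => ∫ y, Ψ x y ^ 2 ∂μ := by
    refine continuous_of_dominated (bound := fun _ => M ^ 2) (fun x => ?_) (fun x => ?_)
      (integrable_const _) (ae_of_all _ fun y => by fun_prop)
    · exact ((Ψ x).continuous.measurable.pow_const 2).aestronglyMeasurable
    · refine ae_of_all _ fun y => ?_
      rw [norm_pow]
      exact pow_le_pow_left₀ (norm_nonneg _) (((Ψ x).norm_coe_le_norm _).trans (hM x)) 2
  have h2 : Measurable fun x => ∑' k, lagCovariance T μ (Ψ x) k := by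
    refine measurable_of_tendsto_metrizable
      (f := fun n x => ∑ k ∈ Finset.range n, lagCovariance T μ (Ψ x) k) (fun n => ?_)
      (tendsto_pi_nhds.2 fun x => (hs x).hasSum.tendsto_sum_nat)
    exact Finset.measurable_fun_sum _ fun k _ => (continuous_lagCovariance hT hΨ hM k).measurable
  exact h1.measurable.add (h2.const_mul 2)

/-- A fibrewise limit of characteristic functions passes to the integral over the fibres. -/
lemma tendsto_integral_charBirkhoff (hT : Measurable T) {Ψ : X → (X →ᵇ ℝ)} (hΨ : Continuous Ψ)
    (τ : ℕ → ℝ) (m : ℕ → ℕ) {g : X → ℂ}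
    (h : ∀ x, Tendsto (fun n => charBirkhoff T μ (Ψ x) (τ n) (m n)) atTop (𝓝 (g x))) :
    Tendsto (fun n => ∫ x, charBirkhoff T μ (Ψ x) (τ n) (m n) ∂μ) atTop (𝓝 (∫ x, g x ∂μ)) :=
  tendsto_integral_of_dominated_convergence (fun _ => 1)
    (fun n => (continuous_charBirkhoff hT hΨ (τ n) (m n)).aestronglyMeasurable)
    (integrable_const _) (fun _ => ae_of_all _ fun _ => norm_charBirkhoff_le _ _ _ _ _)
    (ae_of_all _ h)

variable [SecondCountableTopology X]

/-- **Fibred central limit theorem on the diagonal.** With `q = ⌈n ^ (3/8)⌉` and `p = ⌈n ^ (3/4)⌉`,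
the times before `q` are negligible in sup norm. The window `[q, p)` is too long for that; its
exponential decouples from the starting point and so has mean close to `1`, which suffices since it
is unimodular. The remaining window `[p, n)` carries the Gaussian limit. -/
theorem MultipleDecorrelation.tendsto_integral_expBirkhoff_diag (hdec : MultipleDecorrelation T μ)
    (hT : MeasurePreserving T μ μ) {V : ℕ → Set X} (hVo : ∀ N, IsOpen (V N)) (hVm : Monotone V)
    (hVu : (⋃ N, V N) = Set.univ) (hVp : ∀ N, PolynomiallyCovered (V N))
    {Ψ : X → (X →ᵇ ℝ)} (hΨc : Continuous Ψ) {c η : ℝ} (hc : 0 ≤ c) (hη : 0 < η)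
    (hΨ : ∀ x y, dist (Ψ x) (Ψ y) ≤ c * dist x y ^ η)
    (hHol : ∀ x, ∃ r : ℝ≥0, 0 < r ∧ MemHolder r (Ψ x)) {M : ℝ≥0} (hM : ∀ x, ‖Ψ x‖ ≤ M)
    (hM1 : 1 ≤ M) (hΨ0 : ∀ x, ∫ y, Ψ x y ∂μ = 0) (t : ℝ) :
    Tendsto (fun n : ℕ => ∫ x, expBirkhoff T (Ψ x) (t / √n) n x ∂μ) atTop
      (𝓝 (∫ x, ((Real.exp (-(1 / 2) * asymptoticVariance T μ (Ψ x) * t ^ 2) : ℝ) : ℂ) ∂μ)) := by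
  set q : ℕ → ℕ := fun n => ⌈(n : ℝ) ^ (3 / 8 : ℝ)⌉₊ with hq
  set p : ℕ → ℕ := fun n => ⌈(n : ℝ) ^ (3 / 4 : ℝ)⌉₊ with hp
  have hpow : ∀ (n : ℕ) {a b : ℝ}, 0 < a → a ≤ b → (n : ℝ) ^ a ≤ (n : ℝ) ^ b := by
    intro n a b ha hab
    rcases Nat.eq_zero_or_pos n with rfl | hn
    · simp [Real.zero_rpow ha.ne', Real.zero_rpow (ha.trans_le hab).ne']
    · exact Real.rpow_le_rpow_of_exponent_le (by exact_mod_cast hn) hab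
  have hqp : ∀ n, q n ≤ p n := fun n => Nat.ceil_mono (hpow n (by norm_num) (by norm_num))
  have hpn : ∀ n, p n ≤ n := fun n => Nat.ceil_le.2 <| by
    simpa using hpow n (a := 3 / 4) (b := 1) (by norm_num) (by norm_num)
  have hp0 : Tendsto (fun n => (p n : ℝ) / n) atTop (𝓝 0) :=
    tendsto_natCeil_rpow_div (by norm_num)
  have hmp : ∀ n : ℕ, 0 < n → ((p n - q n : ℕ) : ℝ) ≤ 2 * (n : ℝ) ^ (1 / 4 : ℝ) * √n := by
    intro n hn
    have hn1 : (1 : ℝ) ≤ n := by exact_mod_cast hn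
    have h1 : ((p n - q n : ℕ) : ℝ) ≤ p n := by exact_mod_cast Nat.sub_le _ _
    have h2 : (p n : ℝ) < (n : ℝ) ^ (3 / 4 : ℝ) + 1 := Nat.ceil_lt_add_one (by positivity)
    have h3 : (1 : ℝ) ≤ (n : ℝ) ^ (3 / 4 : ℝ) := Real.one_le_rpow hn1 (by norm_num)
    rw [Real.sqrt_eq_rpow, mul_assoc, ← Real.rpow_add (by linarith),
      show (1 / 4 + 1 / 2 : ℝ) = 3 / 4 by norm_num]
    linarith
  have hmn : ∀ n : ℕ, 0 < n → ((n - p n : ℕ) : ℝ) ≤ 1 * (n : ℝ) ^ (1 / 2 : ℝ) * √n := by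
    intro n hn
    rw [← Real.sqrt_eq_rpow, one_mul, Real.mul_self_sqrt n.cast_nonneg]
    exact_mod_cast Nat.sub_le _ _
  have hrate : ∀ x, ∃ (s L : ℝ≥0) (C δ : ℝ), DecorrelationRate T μ s C δ ∧ HolderWith L s (Ψ x) :=
    fun x => by
      obtain ⟨r, hr, hx⟩ := hHol x
      exact hdec.exists_decorrelationRate_of_memHolder hT.measurable hr hx
  have hdecay : ∀ x, ∃ K ρ, CorrelationDecay T μ (Ψ x) K ρ := fun x => by
    obtain ⟨s, L, C, δ, h, hL⟩ := hrate x
    exact h.exists_correlationDecay hT hL (hΨ0 x)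
  -- the exponential over the last window
  have hB : Tendsto (fun n : ℕ => ∫ x, expBirkhoff T (Ψ x) (t / √n) (n - p n) (T^[p n] x) ∂μ) atTop
      (𝓝 (∫ x, ((Real.exp (-(1 / 2) * asymptoticVariance T μ (Ψ x) * t ^ 2) : ℝ) : ℂ) ∂μ)) := by
    have h1 := hdec.tendsto_diag_sub hT hVo hVm hVu hVp hΨc hc hη hΨ hHol hM hM1 t
      (α := 3 / 4) (β := 1 / 2) (b := 1) (by norm_num) (by norm_num) (m := fun n => n - p n)
      (fun n => Nat.sub_le _ _) hmn
    have h2 := tendsto_integral_charBirkhoff (μ := μ) hT.measurable hΨc (fun n : ℕ => t / √n)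
      (fun n => n - p n) (g := fun x =>
        ((Real.exp (-(1 / 2) * asymptoticVariance T μ (Ψ x) * t ^ 2) : ℝ) : ℂ)) fun x => by
      obtain ⟨s, L, C, δ, h, hL⟩ := hrate x
      obtain ⟨K, ρ, hd⟩ := hdecay x
      have h3 := h.tendsto_charBirkhoff hT hL (hΨ0 x) t
      have h4 : Tendsto (fun n : ℕ => charBirkhoff T μ (Ψ x) (t / √n) n
          - charBirkhoff T μ (Ψ x) (t / √n) (n - p n)) atTop (𝓝 0) := by
        refine squeeze_zero_norm (fun n => ?_) (hd.tendsto_abs_mul_sqrt_integral_sq hT t hp0)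
        have := norm_charBirkhoff_add_sub_le_right (ψ := Ψ x) hT (t / √n) (p n) (n - p n)
        rwa [Nat.add_sub_cancel' (hpn n)] at this
      simpa using h3.sub h4
    simpa using h1.add h2
  -- the exponential over the middle window
  have hA : Tendsto (fun n : ℕ => ∫ x, expBirkhoff T (Ψ x) (t / √n) (p n - q n) (T^[q n] x) ∂μ)
      atTop (𝓝 1) := by
    have h1 := hdec.tendsto_diag_sub hT hVo hVm hVu hVp hΨc hc hη hΨ hHol hM hM1 t
      (α := 3 / 8) (β := 1 / 4) (b := 2) (by norm_num) (by norm_num) (m := fun n => p n - q n)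
      (fun n => (Nat.sub_le _ _).trans (hpn n)) hmp
    have h2 := tendsto_integral_charBirkhoff (μ := μ) hT.measurable hΨc (fun n : ℕ => t / √n)
      (fun n => p n - q n) (g := fun _ => 1) fun x => by
      obtain ⟨K, ρ, hd⟩ := hdecay x
      have h5 : Tendsto (fun n => ((p n - q n : ℕ) : ℝ) / n) atTop (𝓝 0) :=
        squeeze_zero (fun n => by positivity) (fun n => by
          gcongr; exact Nat.sub_le _ _) hp0
      have h4 : Tendsto (fun n : ℕ => charBirkhoff T μ (Ψ x) (t / √n) (p n - q n) - 1) atTop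
          (𝓝 0) := by
        refine squeeze_zero_norm (fun n => ?_) (hd.tendsto_abs_mul_sqrt_integral_sq hT t h5)
        have := norm_charBirkhoff_add_sub_le_left (ψ := Ψ x) hT (t / √n) 0 (p n - q n)
        simpa [charBirkhoff, expBirkhoff] using this
      simpa using h4.add_const 1
    simpa using h1.add h2
  have hmeas : ∀ n m a : ℕ, Measurable fun x => expBirkhoff T (Ψ x) (t / √n) m (T^[a] x) :=
    fun n => measurable_expBirkhoff_diag hT.measurable hΨc (t / √n)
  have hint : ∀ n m a : ℕ, Integrable (fun x => expBirkhoff T (Ψ x) (t / √n) m (T^[a] x)) μ :=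
    fun n m a => Integrable.of_bound (hmeas n m a).aestronglyMeasurable 1
      (ae_of_all _ fun x => (norm_expBirkhoff _ _ _ _ _).le)
  have hle : ∀ n : ℕ, ‖∫ x, expBirkhoff T (Ψ x) (t / √n) n x ∂μ
      - ∫ x, expBirkhoff T (Ψ x) (t / √n) (n - p n) (T^[p n] x) ∂μ‖
      ≤ |t| * M * (q n / (n : ℝ) ^ (1 / 2 : ℝ)) + √(2 *
        ‖∫ x, expBirkhoff T (Ψ x) (t / √n) (p n - q n) (T^[q n] x) ∂μ - 1‖) := fun n => by
    have h1 : ‖∫ x, expBirkhoff T (Ψ x) (t / √n) n x ∂μ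
        - ∫ x, expBirkhoff T (Ψ x) (t / √n) (n - q n) (T^[q n] x) ∂μ‖
        ≤ |t| * M * (q n / (n : ℝ) ^ (1 / 2 : ℝ)) := by
      rw [← integral_sub (by simpa using hint n n 0) (hint n _ _)]
      refine (norm_integral_le_of_norm_le_const
        (C := |t| * M * (q n / (n : ℝ) ^ (1 / 2 : ℝ))) (ae_of_all _ fun x => ?_)).trans (by simp)
      have e1 : expBirkhoff T (Ψ x) (t / √n) n x - expBirkhoff T (Ψ x) (t / √n) (n - q n)
          (T^[q n] x) = (expBirkhoff T (Ψ x) (t / √n) (q n) x - 1)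
            * expBirkhoff T (Ψ x) (t / √n) (n - q n) (T^[q n] x) := by
        rw [sub_one_mul, ← expBirkhoff_add, Nat.add_sub_cancel' ((hqp n).trans (hpn n))]
      rw [e1, norm_mul, norm_expBirkhoff, mul_one]
      have e2 : ‖expBirkhoff T (Ψ x) (t / √n) (q n) x - 1‖
          ≤ |t / √n * birkhoffSum T (Ψ x) (q n) x| := by
        simpa [expBirkhoff] using norm_exp_I_mul_sub_le (t / √n * birkhoffSum T (Ψ x) (q n) x) 0
      refine e2.trans ?_
      rw [abs_mul, abs_div, abs_of_nonneg (Real.sqrt_nonneg _), ← Real.sqrt_eq_rpow]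
      calc |t| / √n * |birkhoffSum T (Ψ x) (q n) x| ≤ |t| / √n * (q n * M) := by
            gcongr
            refine (abs_birkhoffSum_le T (Ψ x) (q n) x).trans ?_
            gcongr
            exact hM x
        _ = _ := by ring
    have h2 : ‖∫ x, expBirkhoff T (Ψ x) (t / √n) (n - q n) (T^[q n] x) ∂μ
        - ∫ x, expBirkhoff T (Ψ x) (t / √n) (n - p n) (T^[p n] x) ∂μ‖
        ≤ √(2 * ‖∫ x, expBirkhoff T (Ψ x) (t / √n) (p n - q n) (T^[q n] x) ∂μ - 1‖) := by
      have e1 : ∀ x, expBirkhoff T (Ψ x) (t / √n) (n - q n) (T^[q n] x)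
          = expBirkhoff T (Ψ x) (t / √n) (p n - q n) (T^[q n] x)
            * expBirkhoff T (Ψ x) (t / √n) (n - p n) (T^[p n] x) := fun x => by
        have e2 : T^[p n] x = T^[p n - q n] (T^[q n] x) := by
          rw [← Function.iterate_add_apply, Nat.sub_add_cancel (hqp n)]
        rw [e2, ← expBirkhoff_add]
        congr 1
        have := hqp n
        have := hpn n
        omega
      simp only [e1]
      exact norm_integral_mul_sub_le_sqrt (hmeas n _ _) (hmeas n _ _)
        (fun x => norm_expBirkhoff _ _ _ _ _) fun x => norm_expBirkhoff _ _ _ _ _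
    exact (norm_sub_le_norm_sub_add_norm_sub _ _ _).trans (add_le_add h1 h2)
  have hlim : Tendsto (fun n : ℕ => |t| * M * (q n / (n : ℝ) ^ (1 / 2 : ℝ)) + √(2 *
      ‖∫ x, expBirkhoff T (Ψ x) (t / √n) (p n - q n) (T^[q n] x) ∂μ - 1‖)) atTop (𝓝 0) := by
    have h1 := (tendsto_natCeil_rpow_div_rpow (α := 3 / 8) (γ := 1 / 2) (by norm_num)
      (by norm_num)).const_mul (|t| * M)
    have h2 := ((hA.sub_const 1).norm.const_mul 2).sqrt
    simpa using h1.add h2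
  simpa using (squeeze_zero_norm hle hlim).add hB

end

/-- The measurability of `v` matters: `Measure.bind` integrates a measurable kernel. -/
lemma charFun_gaussianMixture {X : Type*} [MeasurableSpace X] {μ : Measure X}
    [IsProbabilityMeasure μ] {v : X → ℝ} (hv : Measurable v) (hv0 : ∀ x, 0 ≤ v x) (t : ℝ) :
    charFun (gaussianMixture μ v) t = ((∫ x, Real.exp (-(1 / 2) * v x * t ^ 2) ∂μ : ℝ) : ℂ) := by
  have hκ : Measurable fun x => gaussianReal 0 (v x).toNNReal :=
    measurable_gaussianReal.comp (measurable_const.prodMk hv.real_toNNReal)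
  let κ : Kernel X ℝ := ⟨fun x => gaussianReal 0 (v x).toNNReal, hκ⟩
  have : IsMarkovKernel κ := ⟨fun x => inferInstanceAs (IsProbabilityMeasure (gaussianReal 0 _))⟩
  have h1 : gaussianMixture μ v = (κ ∘ₖ Kernel.const Unit μ) () := by
    rw [← Measure.comp_eq_comp_const_apply]; rfl
  rw [charFun_apply_real, h1, Kernel.integral_comp, Kernel.const_apply, ← integral_complex_ofReal]
  · refine integral_congr_ae (ae_of_all _ fun x => ?_)
    have h2 : ∫ y, Complex.exp (t * y * Complex.I) ∂(κ x)
        = charFun (gaussianReal 0 (v x).toNNReal) t := (charFun_apply_real t).symm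
    simp only [h2, charFun_gaussianReal, Real.coe_toNNReal _ (hv0 x)]
    push_cast
    congr 1
    ring
  · refine Integrable.of_bound (C := 1) (by fun_prop) (ae_of_all _ fun y => ?_)
    rw [← Complex.ofReal_mul, Complex.norm_exp_ofReal_mul_I]

/-! ### The centered functions `φ ∘ θ x` and the conclusion -/

section
variable {X : Type*} [MetricSpace X] [MeasurableSpace X] {μ : Measure X} [IsProbabilityMeasure μ]
  {φ : X →ᵇ ℝ} {θ : X → X → X}

lemma norm_centeredComp_le (x y : X) : ‖centeredComp μ φ θ x y‖ ≤ 2 * ‖φ‖ := by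
  have h1 : ‖∫ z, φ (θ x z) ∂μ‖ ≤ ‖φ‖ :=
    (norm_integral_le_of_norm_le_const (ae_of_all _ fun z => φ.norm_coe_le_norm _)).trans (by simp)
  have h2 := norm_sub_le (φ (θ x y)) (∫ z, φ (θ x z) ∂μ)
  have h3 := φ.norm_coe_le_norm (θ x y)
  rw [centeredComp]
  linarith

/-- `centeredComp` as a family of bounded continuous functions, for `θ x` continuous. -/
def centeredCompBCF (μ : Measure X) [IsProbabilityMeasure μ] (φ : X →ᵇ ℝ) {θ : X → X → X}
    (hθ : ∀ x, Continuous (θ x)) (x : X) : X →ᵇ ℝ :=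
  BoundedContinuousFunction.ofNormedAddCommGroup (centeredComp μ φ θ x)
    (by have := hθ x; unfold centeredComp; fun_prop) (2 * ‖φ‖) (norm_centeredComp_le x)

lemma coe_centeredCompBCF (hθ : ∀ x, Continuous (θ x)) (x : X) :
    ⇑(centeredCompBCF μ φ hθ x) = centeredComp μ φ θ x := rfl

lemma memHolder_centeredCompBCF (hθ : ∀ x, Continuous (θ x)) {r s : ℝ≥0} (hφ : MemHolder r φ)
    {x : X} (hx : MemHolder s (θ x)) : MemHolder (r * s) (centeredCompBCF μ φ hθ x) := by
  obtain ⟨L, hL⟩ := hφ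
  obtain ⟨L', hL'⟩ := hx
  refine ⟨L * L' ^ (r : ℝ), fun y z => ?_⟩
  have := (hL.comp hL') y z
  simpa [coe_centeredCompBCF, centeredComp, edist_sub_right] using this

end

section
variable {X : Type*} [MetricSpace X] [MeasurableSpace X] [BorelSpace X]
  {μ : Measure X} [IsProbabilityMeasure μ] {φ : X →ᵇ ℝ} {θ : X → X → X}

lemma integrable_comp_family (hθ : ∀ x, Continuous (θ x)) (x : X) :
    Integrable (fun z => φ (θ x z)) μ := by
  have := hθ x
  exact integrable_of_abs_le (Continuous.measurable (by fun_prop)) (C := ‖φ‖)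
    fun z => φ.norm_coe_le_norm _

lemma integral_centeredComp (hθ : ∀ x, Continuous (θ x)) (x : X) :
    ∫ y, centeredComp μ φ θ x y ∂μ = 0 := by
  simp only [centeredComp]
  rw [integral_sub (integrable_comp_family hθ x) (integrable_const _)]
  simp

lemma dist_centeredCompBCF_le (hθ : ∀ x, Continuous (θ x)) {L r : ℝ≥0} (hφ : HolderWith L r φ)
    {x y : X} {δ : ℝ} (hδ0 : 0 ≤ δ) (hδ : ∀ z, dist (θ x z) (θ y z) ≤ δ) :
    dist (centeredCompBCF μ φ hθ x) (centeredCompBCF μ φ hθ y) ≤ 2 * L * δ ^ (r : ℝ) := by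
  have h1 : ∀ z, |φ (θ x z) - φ (θ y z)| ≤ L * δ ^ (r : ℝ) := fun z => hφ.dist_le_of_le (hδ z)
  refine (BoundedContinuousFunction.dist_le (by positivity)).2 fun z => ?_
  have h2 : ‖∫ w, (φ (θ x w) - φ (θ y w)) ∂μ‖ ≤ L * δ ^ (r : ℝ) :=
    (norm_integral_le_of_norm_le_const (ae_of_all _ h1)).trans (by simp)
  rw [integral_sub (integrable_comp_family hθ x) (integrable_comp_family hθ y)] at h2
  have h3 : centeredComp μ φ θ x z - centeredComp μ φ θ y z = (φ (θ x z) - φ (θ y z))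
      - (∫ w, φ (θ x w) ∂μ - ∫ w, φ (θ y w) ∂μ) := by
    simp only [centeredComp]; ring
  rw [Real.dist_eq, coe_centeredCompBCF, coe_centeredCompBCF, h3]
  have h4 := norm_sub_le (φ (θ x z) - φ (θ y z)) (∫ w, φ (θ x w) ∂μ - ∫ w, φ (θ y w) ∂μ)
  rw [Real.norm_eq_abs, Real.norm_eq_abs] at h4
  have h5 := h1 z
  linarith

end

theorem mainTheorem1 {d : ℕ} {X : Type*} [MetricSpace X] [SecondCountableTopology X]
    [ChartedSpace (EuclideanSpace ℝ (Fin d)) X] [IsManifold (𝓡 d) ∞ X]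
    [RiemannianBundle (fun x : X => TangentSpace (𝓡 d) x)]
    [IsContMDiffRiemannianBundle (𝓡 d) ∞ (EuclideanSpace ℝ (Fin d))
      (fun x : X => TangentSpace (𝓡 d) x)]
    [IsRiemannianManifold (𝓡 d) X]
    [MeasurableSpace X] [BorelSpace X]
    (μ : Measure X) [IsProbabilityMeasure μ]
    (T : X → X) (hT : MeasurePreserving T μ μ) (hdec : MultipleDecorrelation T μ)
    (θ : X → X → X) (hθ : ∀ x, ∃ r : ℝ≥0, 0 < r ∧ MemHolder r (θ x))
    (hreg : ∃ C η : ℝ, 0 < η ∧ ∀ x y z, dist (θ x z) (θ y z) ≤ C * dist x y ^ η)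
    (φ : X →ᵇ ℝ) (hφ : ∃ r : ℝ≥0, 0 < r ∧ MemHolder r φ) (hφ0 : ∫ x, φ x ∂μ = 0) :
    (∀ x, Summable (lagCovariance T μ (centeredComp μ φ θ x))) ∧
    (∀ x, 0 ≤ asymptoticVariance T μ (centeredComp μ φ θ x)) ∧
    Measurable (fun x => asymptoticVariance T μ (centeredComp μ φ θ x)) ∧
    ∀ t : ℝ,
      Tendsto
        (fun n : ℕ => ∫ x, Complex.exp (Complex.I *
          ((t / √(n : ℝ) * ∑ k ∈ Finset.range n, centeredComp μ φ θ x (T^[k] x) : ℝ) : ℂ)) ∂μ)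
        atTop
        (𝓝 ((∫ x, Real.exp (-(1 / 2) * asymptoticVariance T μ (centeredComp μ φ θ x) * t ^ 2) ∂μ
          : ℝ) : ℂ)) ∧
      charFun (gaussianMixture μ fun x => asymptoticVariance T μ (centeredComp μ φ θ x)) t =
        ((∫ x, Real.exp (-(1 / 2) * asymptoticVariance T μ (centeredComp μ φ θ x) * t ^ 2) ∂μ
          : ℝ) : ℂ) := by
  have hθc : ∀ x, Continuous (θ x) := fun x => by
    obtain ⟨s, hs, L, hL⟩ := hθ x
    exact hL.continuous hs
  obtain ⟨r, hr, hφr⟩ := hφ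
  obtain ⟨L, hL⟩ := id hφr
  obtain ⟨C, η, hη, hC⟩ := hreg
  let Ψ : X → (X →ᵇ ℝ) := centeredCompBCF μ φ hθc
  have hM : ∀ x, ‖Ψ x‖ ≤ ((2 * ‖φ‖₊ + 1 : ℝ≥0) : ℝ) := fun x =>
    (BoundedContinuousFunction.norm_le (by positivity)).2 fun y =>
      (norm_centeredComp_le x y).trans (by push_cast; linarith)
  have hΨ0 : ∀ x, ∫ y, Ψ x y ∂μ = 0 := integral_centeredComp hθc
  have hΨH : ∀ x, ∃ r : ℝ≥0, 0 < r ∧ MemHolder r (Ψ x) := fun x => by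
    obtain ⟨s, hs, hx⟩ := hθ x
    exact ⟨r * s, mul_pos hr hs, memHolder_centeredCompBCF hθc hφr hx⟩
  have hηr : 0 < η * r := mul_pos hη hr
  have hΨd : ∀ x y, dist (Ψ x) (Ψ y) ≤ 2 * L * |C| ^ (r : ℝ) * dist x y ^ (η * r) := fun x y => by
    -- `C` itself may be negative when `X` has at most one point
    refine (dist_centeredCompBCF_le hθc hL (δ := |C| * dist x y ^ η) (by positivity) fun z =>
      (hC x y z).trans (by gcongr; exact le_abs_self C)).trans (le_of_eq ?_)
    rw [Real.mul_rpow (abs_nonneg _) (by positivity), ← Real.rpow_mul dist_nonneg]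
    ring
  have hΨc : Continuous Ψ := by
    refine continuous_iff_continuousAt.2 fun x => tendsto_iff_dist_tendsto_zero.2 ?_
    have h1 : Tendsto (fun y => 2 * L * |C| ^ (r : ℝ) * dist y x ^ (η * r)) (𝓝 x) (𝓝 0) := by
      have h2 := ((tendsto_iff_dist_tendsto_zero.1 (tendsto_id (x := 𝓝 x))).rpow_const
        (p := η * r) (Or.inr hηr.le)).const_mul (2 * L * |C| ^ (r : ℝ))
      simpa [Real.zero_rpow hηr.ne'] using h2
    exact squeeze_zero (fun y => dist_nonneg) (fun y => hΨd y x) h1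
  have hrate : ∀ x, ∃ K ρ, CorrelationDecay T μ (Ψ x) K ρ := fun x => by
    obtain ⟨s, hs, hx⟩ := hΨH x
    obtain ⟨s', L', C', δ, h, hL'⟩ := hdec.exists_decorrelationRate_of_memHolder hT.measurable hs hx
    exact h.exists_correlationDecay hT hL' (hΨ0 x)
  have hsum : ∀ x, Summable (lagCovariance T μ (Ψ x)) := fun x => by
    obtain ⟨K, ρ, h⟩ := hrate x
    exact h.summable_lagCovariance
  have hnonneg : ∀ x, 0 ≤ asymptoticVariance T μ (Ψ x) := fun x => by
    obtain ⟨K, ρ, h⟩ := hrate x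
    exact h.asymptoticVariance_nonneg hT
  have hmeas : Measurable fun x => asymptoticVariance T μ (Ψ x) :=
    measurable_asymptoticVariance hT.measurable hΨc hM hsum
  refine ⟨hsum, hnonneg, hmeas, fun t => ⟨?_, charFun_gaussianMixture hmeas hnonneg t⟩⟩
  obtain ⟨V, hVo, hVm, hVu, hVp⟩ := exists_monotone_polynomiallyCovered (d := d) X
  have h := hdec.tendsto_integral_expBirkhoff_diag hT hVo hVm hVu hVp hΨc (by positivity) hηr hΨd
    hΨH hM (by simp) hΨ0 t
  rw [integral_complex_ofReal] at h
  exact h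

end
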